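/- Let $p>2$ and $\omega>0$. Call $u:\mathbb R\to\mathbb R$ admissible if $u$ is continuous, $u\in L^2(\mathbb R)$, $u^2$ is locally absolutely continuous and $uu'=\tfrac12(u^2)'\in L^2(\mathbb R)$. Let $\Phi$ be a bell-shaped function (even, non-negative, non-increasing on $(0,\infty)$) which minimizes $$N[u]=\int_{\mathbb R}|u\,u'|^2\,dx+\omega\int_{\mathbb R}|u|^2\,dx$$ among all admissible $u$ with $\int_{\mathbb R}|u|^p\,dx=1$. Put $c=2\int_{\mathbb R}(\Phi\Phi')^2\,dx+\omega\int_{\mathbb R}\Phi^2\,dx$, and let $\Omega=\mathbb R$ or $\Omega=\{x:\Phi(x)>0\}$ (which is a bounded interval $(-L,L)$). Consider in the complex Hilbert space $L^2(\Omega)$ the symmetric operator with domain $C_c^\infty(\Omega)$ given by $$\mathcal L_+f=-\Phi\,\partial_x^2(\Phi f)+\omega f-(\Phi\Phi')'f-(p-1)\,c\,\Phi^{p-2}f .$$ Then every self-adjoint extension of this operator (also denoted $\mathcal L_+$) has exactly one negative eigenvalue, say $-\zeta^2$, and it is simple; zero is a simple eigenvalue, with $\ker\mathcal L_+=\mathrm{span}[\Phi']$;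 and the rest of the spectrum is away from zero: there exists $\delta>0$ such that $$\mathrm{spec}(\mathcal L_+)\setminus\{-\zeta^2,0\}\subset[\delta,+\infty).$$ -/

import Mathlib

open MeasureTheory Set

noncomputable section

namespace Compacton

/-! Constrained variational problem: minimize `N[u] = ∫ |u u'|² + ω ∫ |u|²` subject to
`∫ |u|^p = 1`. -/

/-- Even, non-negative and non-increasing on `(0, ∞)`. -/
def BellShaped (u : ℝ → ℝ) : Prop :=
  (∀ x, u (-x) = u x) ∧ (∀ x, 0 ≤ u x) ∧ AntitoneOn u (Ioi 0)

/-- The class on which the functional `N` is finite: `u` is continuous and square integrable, and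
`u ^ 2` is locally absolutely continuous with `u u' = (u ^ 2)' / 2` square integrable.
(If `u ^ 2` is differentiable at `x`, then so is `u` when `u x ≠ 0`, and both `(u ^ 2)' x` and
`u x * deriv u x` vanish when `u x = 0`, so `u * deriv u` is `(u ^ 2)' / 2` almost everywhere.) -/
structure Admissible (u : ℝ → ℝ) : Prop where
  continuous : Continuous u
  memLp : MemLp u 2 volume
  absCont : ∀ a b : ℝ, AbsolutelyContinuousOnInterval (fun x => u x ^ 2) a b
  memLp_deriv : MemLp (fun x => u x * deriv u x) 2 volume

/-- `N[u] = ∫ |u u'|² + ω ∫ |u|²`. -/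
def energy (ω : ℝ) (u : ℝ → ℝ) : ℝ :=
  (∫ x, |u x * deriv u x| ^ 2) + ω * ∫ x, |u x| ^ 2

/-- `Φ` minimizes `N[u]` among admissible functions subject to `∫ |u|^p = 1`. -/
structure IsConstrainedMinimizer (ω p : ℝ) (Φ : ℝ → ℝ) : Prop where
  admissible : Admissible Φ
  constraint : ∫ x, |Φ x| ^ p = 1
  le : ∀ u : ℝ → ℝ, Admissible u → ∫ x, |u x| ^ p = 1 → energy ω Φ ≤ energy ω u

/-- The Lagrange multiplier `c = 2 ∫ (Φ Φ')² + ω ∫ Φ²`. -/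
def multiplier (ω : ℝ) (Φ : ℝ → ℝ) : ℝ :=
  2 * (∫ x, (Φ x * deriv Φ x) ^ 2) + ω * ∫ x, Φ x ^ 2

/-- The differential expression
`𝓛₊ f = - Φ (Φ f)'' + ω f - (Φ Φ')' f - (p - 1) c Φ^(p-2) f`. -/
def linPlus (ω p : ℝ) (Φ : ℝ → ℝ) (f : ℝ → ℂ) (x : ℝ) : ℂ :=
  -(Φ x : ℂ) * deriv (deriv (fun y => (Φ y : ℂ) * f y)) x + (ω : ℂ) * f x
    - ((deriv (fun y => Φ y * deriv Φ y) x : ℝ) : ℂ) * f x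
    - (((p - 1) * multiplier ω Φ * Φ x ^ (p - 2) : ℝ) : ℂ) * f x

/-- The complex Hilbert space `L²(Ω)`. -/
abbrev L2 (Ω : Set ℝ) : Type := Lp ℂ 2 ((volume : Measure ℝ).restrict Ω)

/-- The graph in `L²(Ω) × L²(Ω)` of the symmetric operator `f ↦ 𝓛₊ f`, `f ∈ C_c^∞(Ω)`. -/
def linPlusGraph (ω p : ℝ) (Φ : ℝ → ℝ) (Ω : Set ℝ) : Set (L2 Ω × L2 Ω) :=
  {w | ∃ f : ℝ → ℂ, ContDiff ℝ ((⊤ : ℕ∞) : WithTop ℕ∞) f ∧ HasCompactSupport f ∧ tsupport f ⊆ Ω ∧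
    (w.1 : ℝ → ℂ) =ᵐ[(volume : Measure ℝ).restrict Ω] f ∧
    (w.2 : ℝ → ℂ) =ᵐ[(volume : Measure ℝ).restrict Ω] linPlus ω p Φ f}

section Spectrum

variable {H : Type*} [NormedAddCommGroup H] [NormedSpace ℂ H]

/-- The eigenspace `ker (A - z)` of an unbounded operator, as a subspace of the whole space. -/
def eigenspace (A : H →ₗ.[ℂ] H) (z : ℂ) : Submodule ℂ H :=
  (LinearMap.ker (A.toFun - z • A.domain.subtype)).map A.domain.subtype

/-- `z` is an eigenvalue: the eigenspace is non-trivial. -/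
def IsEigenvalue (A : H →ₗ.[ℂ] H) (z : ℂ) : Prop := eigenspace A z ≠ ⊥

/-- The resolvent set of an unbounded operator: those `z` for which `A - z` maps the domain
bijectively onto `H` with an everywhere defined bounded inverse `R`. -/
def resolventSet (A : H →ₗ.[ℂ] H) : Set ℂ :=
  {z | ∃ R : H →L[ℂ] H,
    (∀ y : H, ∃ h : R y ∈ A.domain, A ⟨R y, h⟩ - z • R y = y) ∧
    ∀ x : A.domain, R (A x - z • (x : H)) = x}

/-- The spectrum of an unbounded operator. -/
def spec (A : H →ₗ.[ℂ] H) : Set ℂ := (resolventSet A)ᶜ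

end Spectrum

end Compacton

end

open MeasureTheory Set

local notation "∞" => ((⊤ : ℕ∞) : WithTop ℕ∞)

namespace Compacton

open scoped InnerProductSpace ComplexConjugate
open RCLike

/-! ### Self-adjoint operators: graphs, resolvent points and cores -/

section Abstract

variable {H : Type*} [NormedAddCommGroup H] [InnerProductSpace ℂ H]

/-! The functional is quadratic in `v = Φ ^ 2`, so the variational problem is handled in terms of
`v`. Variations supported where `Φ > 0` give `v'' = 2 (ω - c v ^ (p/2 - 1))` there, hence a first
integral `(v'/2)² - ω v + (2c/p) v ^ (p/2) = E`. Dilations give a virial identity saying that `E`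
times the length of the support is zero, so `E = 0`. With `s = (p - 2)/2` and `κ = 2c/p` this reads
`Φ'² = ω - κ Φ ^ (2s)` and `Φ Φ'' = -κ s Φ ^ (2s)`. A positive function satisfying the second
equation is strictly concave, so the support is a bounded interval `(-l, l)` (`exists_profile`).

On that interval the two equations turn `𝓛₊` into `-(Φ² f')' - κ s (2s + 1) Φ ^ (2s) f`. Write `a_σ
f = Φ f' - σ Φ' f`, which kills `Φ ^ σ`, and let `a_σ*` be its formal adjoint. Then `𝓛₊ = a_σ* a_σ -
σ (σ + 1) ω` exactly when `σ (σ + 1 + s) = s (2s + 1)`, that is, for `σ = s` and for `σ = -(2s + 1)`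
(`innerOp_eq`).

The root `s` gives the ground state `Φ ^ s` with eigenvalue `-s (s + 1) ω`. The reversed product
satisfies `a_s a_s* = T + s (s + 1) ω`, where `T g = -(Φ² g')'` (`lad_ladStar_eq`). Since `T`
annihilates constants, `a_s* 1`, a multiple of `Φ'`, is annihilated by `𝓛₊`. Orthogonally to both
functions a Hardy inequality and the Poincaré inequality dual to it bound `𝓛₊` below by `δ = min
(ω/4) (ω s/2)` (`gap`).

The root `-(2s + 1)` settles self-adjointness. The equation `(𝓛₊ + 2s (2s + 1) ω) f = k` is solved
by two quadratures when `k` is orthogonal to two explicit solutions, and no nontrivial combination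
of these is square integrable at the end points. So the shifted operator has dense range on test
functions (`ae_eq_zero_of_orthogonal`).

For `Ω = ℝ` the operator outside the interval is multiplication by `ω`, which does not affect these
statements. Test functions vanishing near `±l` then form a core of every self-adjoint extension
(`graph_le_closure`), and the eigenvectors and the gap pass from the core to the extension
(`spectrum_of_core`). -/

lemma mem_eigenspace_iff (A : H →ₗ.[ℂ] H) (z : ℂ) (x : H) :
    x ∈ eigenspace A z ↔ (x, z • x) ∈ A.graph := by
  simp only [eigenspace, Submodule.mem_map, LinearMap.mem_ker, LinearPMap.mem_graph_iff]
  constructor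
  · rintro ⟨y, hy, rfl⟩
    exact ⟨y, rfl, sub_eq_zero.1 hy⟩
  · rintro ⟨y, rfl, hy⟩
    exact ⟨y, sub_eq_zero.2 hy, rfl⟩

variable [CompleteSpace H]

/-- This is `A* ⊆ A` in terms of graphs: a weak identity against the domain places `v` in the
domain. `inner_graph_symm` is the converse inclusion. -/
lemma mem_graph_of_forall_inner {A : H →ₗ.[ℂ] H} (hA : IsSelfAdjoint A) {v w : H}
    (h : ∀ x y, (x, y) ∈ A.graph → ⟪y, v⟫_ℂ = ⟪x, w⟫_ℂ) : (v, w) ∈ A.graph := by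
  have h1 := LinearPMap.adjoint_graph_eq_graph_adjoint hA.dense_domain
  rw [LinearPMap.isSelfAdjoint_def.1 hA] at h1
  rw [h1, Submodule.mem_adjoint_iff]
  intro a b hab
  rw [sub_eq_zero]
  exact h a b hab

lemma inner_graph_symm {A : H →ₗ.[ℂ] H} (hA : IsSelfAdjoint A) {x y v w : H}
    (h : (x, y) ∈ A.graph) (h' : (v, w) ∈ A.graph) : ⟪y, v⟫_ℂ = ⟪x, w⟫_ℂ := by
  have h1 := LinearPMap.adjoint_graph_eq_graph_adjoint hA.dense_domain
  rw [LinearPMap.isSelfAdjoint_def.1 hA] at h1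
  rw [h1, Submodule.mem_adjoint_iff] at h'
  exact sub_eq_zero.1 (h' x y h)

lemma isClosed_graph {A : H →ₗ.[ℂ] H} (hA : IsSelfAdjoint A) :
    IsClosed (A.graph : Set (H × H)) := hA.isClosed

/-- A self-adjoint operator for which `A - z` and its adjoint are bounded below has `z` in its
resolvent set. -/
lemma mem_resolventSet_of_bounded_below {A : H →ₗ.[ℂ] H} (hA : IsSelfAdjoint A) {z : ℂ} {ε : ℝ}
    (hε : 0 < ε) (h : ∀ x y, (x, y) ∈ A.graph → ε * ‖x‖ ≤ ‖y - z • x‖)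
    (h' : ∀ x, (x, conj z • x) ∈ A.graph → x = 0) : z ∈ resolventSet A := by
  let T : A.domain →ₗ[ℂ] H := A.toFun - z • A.domain.subtype
  have hT : ∀ x : A.domain, T x = A x - z • (x : H) := fun x => rfl
  have hbd : ∀ x : A.domain, ε * ‖(x : H)‖ ≤ ‖T x‖ := fun x => h x (A x) (A.mem_graph x)
  have hinj : Function.Injective T := by
    rw [← LinearMap.ker_eq_bot, LinearMap.ker_eq_bot']
    intro x hx
    have := hbd x
    rw [hx, norm_zero] at this
    have h2 : ‖(x : H)‖ ≤ 0 := by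
      by_contra! h3
      have := mul_pos hε h3
      linarith
    exact Subtype.ext (norm_le_zero_iff.1 h2)
  -- The lower bound makes preimages of a convergent sequence Cauchy, and closedness of the graph
  -- identifies their limit.
  have hclosed : IsClosed (LinearMap.range T : Set H) := by
    rw [← isSeqClosed_iff_isClosed]
    intro y b hy hb
    choose x hx using hy
    have hc : CauchySeq (fun n => (x n : H)) := by
      have hcy := hb.cauchySeq
      rw [Metric.cauchySeq_iff] at hcy ⊢
      intro r hr
      obtain ⟨N, hN⟩ := hcy (ε * r) (mul_pos hε hr)
      refine ⟨N, fun m hm n hn => ?_⟩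
      have h1 := hN m hm n hn
      have h2 := hbd (x m - x n)
      rw [map_sub, hx, hx, ← dist_eq_norm, AddSubgroupClass.coe_sub, ← dist_eq_norm] at h2
      exact lt_of_mul_lt_mul_left (h2.trans_lt h1) hε.le
    obtain ⟨a, ha⟩ := cauchySeq_tendsto_of_complete hc
    have hA' : Filter.Tendsto (fun n => ((x n : H), A (x n))) Filter.atTop (nhds (a, b + z • a)) := by
      refine ha.prodMk_nhds ?_
      have := hb.add (ha.const_smul z)
      refine this.congr fun n => ?_
      rw [← hx, hT, sub_add_cancel]
    have hmem := (isClosed_graph hA).mem_of_tendsto hA'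
      (Filter.Eventually.of_forall fun n => A.mem_graph (x n))
    obtain ⟨w, hw, hw'⟩ := (LinearPMap.mem_graph_iff A).1 hmem
    refine ⟨w, ?_⟩
    rw [hT, hw', hw]
    simp
  have hrange : LinearMap.range T = ⊤ := by
    -- The orthogonal complement of the range of `A - z` is the kernel of `A - conj z`, trivial by
    -- `h'`.
    have hbot : (LinearMap.range T)ᗮ = ⊥ := by
      rw [Submodule.eq_bot_iff]
      intro v hv
      apply h'
      apply mem_graph_of_forall_inner hA
      intro x y hxy
      obtain ⟨w, hw, hw'⟩ := (LinearPMap.mem_graph_iff A).1 hxy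
      have := (Submodule.mem_orthogonal _ _).1 hv (T w) ⟨w, rfl⟩
      rw [hT, inner_sub_left, hw', sub_eq_zero] at this
      simp only at this hw
      rw [this, hw, inner_smul_left, inner_smul_right]
    have hcomp : IsComplete (LinearMap.range T : Set H) := hclosed.isComplete
    have : (LinearMap.range T).HasOrthogonalProjection := by
      have : CompleteSpace (LinearMap.range T) := hcomp.completeSpace_coe
      infer_instance
    exact (Submodule.orthogonal_eq_bot_iff).1 hbot
  have hsurj : Function.Surjective T := LinearMap.range_eq_top.1 hrange
  let e := LinearEquiv.ofBijective T ⟨hinj, hsurj⟩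
  have he : ∀ y, T (e.symm y) = y := fun y => e.apply_symm_apply y
  let R : H →L[ℂ] H := (A.domain.subtype ∘ₗ e.symm.toLinearMap).mkContinuous ε⁻¹ (fun y => by
    have := hbd (e.symm y)
    rw [he] at this
    rw [inv_mul_eq_div, le_div_iff₀ hε, mul_comm]
    exact this)
  refine ⟨R, fun y => ⟨(e.symm y).2, he y⟩, fun x => ?_⟩
  have : e.symm (T x) = x := e.symm_apply_apply x
  exact congrArg Subtype.val this

/-- If a lower bounded restriction of a self-adjoint operator has dense range after a shift
below the bound, it is a core. -/
lemma graph_le_closure {A : H →ₗ.[ℂ] H} (hA : IsSelfAdjoint A) {C : Submodule ℂ (H × H)}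
    (hCA : C ≤ A.graph) {l m : ℝ} (hlm : l < m)
    (hlb : ∀ w ∈ C, m * ‖w.1‖ ^ 2 ≤ re ⟪w.2, w.1⟫_ℂ)
    (hdense : ∀ u : H, (∀ w ∈ C, ⟪w.2 - (l : ℂ) • w.1, u⟫_ℂ = 0) → u = 0) :
    (A.graph : Set (H × H)) ⊆ closure (C : Set (H × H)) := by
  let S : (H × H) →ₗ[ℂ] H := LinearMap.snd ℂ H H - (l : ℂ) • LinearMap.fst ℂ H H
  have hS : ∀ w, S w = w.2 - (l : ℂ) • w.1 := fun w => rfl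
  have hbd : ∀ w ∈ C, (m - l) * ‖w.1‖ ≤ ‖S w‖ := by
    intro w hw
    rcases eq_or_ne w.1 0 with h0 | h0
    · rw [h0, norm_zero, mul_zero]; exact norm_nonneg _
    have hpos : 0 < ‖w.1‖ := norm_pos_iff.2 h0
    have h1 : (m - l) * ‖w.1‖ ^ 2 ≤ re ⟪S w, w.1⟫_ℂ := by
      have h3 : re ⟪(l : ℂ) • w.1, w.1⟫_ℂ = l * ‖w.1‖ ^ 2 := by
        rw [inner_smul_left, inner_self_eq_norm_sq_to_K]
        simp [← Complex.ofReal_pow]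
      rw [hS, inner_sub_left, map_sub, h3]
      linarith [hlb w hw]
    have h2 := (re_inner_le_norm (𝕜 := ℂ) (S w) w.1)
    have : ((m - l) * ‖w.1‖) * ‖w.1‖ ≤ ‖S w‖ * ‖w.1‖ := by nlinarith
    exact le_of_mul_le_mul_right this hpos
  have hdr : closure ((C.map S : Submodule ℂ H) : Set H) = univ := by
    have : (C.map S).topologicalClosure = ⊤ := by
      rw [Submodule.topologicalClosure_eq_top_iff, Submodule.eq_bot_iff]
      intro u hu
      refine hdense u fun w hw => ?_
      exact (Submodule.mem_orthogonal _ _).1 hu _ ⟨w, hw, rfl⟩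
    have h2 := congrArg (fun K : Submodule ℂ H => (K : Set H)) this
    simpa using h2
  have key : ∀ z : H, ∃ w ∈ closure (C : Set (H × H)), S w = z := by
    intro z
    -- Density and the lower bound on `C` together make the shift map the closure of `C` onto `H`.
    have hz : z ∈ closure ((C.map S : Submodule ℂ H) : Set H) := by rw [hdr]; trivial
    obtain ⟨y, hy, hyz⟩ := mem_closure_iff_seq_limit.1 hz
    choose w hwC hw using hy
    have hc : CauchySeq (fun n => (w n).1) := by
      have hcy := hyz.cauchySeq
      rw [Metric.cauchySeq_iff] at hcy ⊢
      intro r hr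
      obtain ⟨N, hN⟩ := hcy ((m - l) * r) (mul_pos (by linarith) hr)
      refine ⟨N, fun i hi n hn => ?_⟩
      have h1 := hN i hi n hn
      have h2 := hbd (w i - w n) (C.sub_mem (hwC i) (hwC n))
      rw [map_sub, hw, hw, ← dist_eq_norm, Prod.fst_sub, ← dist_eq_norm] at h2
      exact lt_of_mul_lt_mul_left (h2.trans_lt h1) (by linarith)
    obtain ⟨a, ha⟩ := cauchySeq_tendsto_of_complete hc
    refine ⟨(a, z + (l : ℂ) • a), ?_, by rw [hS]; simp⟩
    refine mem_closure_of_tendsto (f := w) (b := Filter.atTop) ?_ (Filter.Eventually.of_forall hwC)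
    have : Filter.Tendsto (fun n => ((w n).1, (w n).2)) Filter.atTop (nhds (a, z + (l : ℂ) • a)) := by
      refine ha.prodMk_nhds ((hyz.add (ha.const_smul (l : ℂ))).congr fun n => ?_)
      rw [← hw, hS, sub_add_cancel]
    exact this
  intro v hv
  obtain ⟨w, hw, hwv⟩ := key (S v)
  have hwA : w ∈ (A.graph : Set (H × H)) :=
    closure_minimal hCA (isClosed_graph hA) hw
  have hd : v - w ∈ A.graph := A.graph.sub_mem hv hwA
  have hSd : S (v - w) = 0 := by rw [map_sub, hwv, sub_self]
  have h2 : (v - w).2 = (l : ℂ) • (v - w).1 := by rwa [hS, sub_eq_zero] at hSd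
  -- The difference lies in the kernel of `A - l`; by symmetry it is orthogonal to the dense range
  -- of the shift on `C`.
  have h1 : (v - w).1 = 0 := by
    refine hdense _ fun u hu => ?_
    have := inner_graph_symm hA (x := u.1) (y := u.2) (hCA hu) (show ((v - w).1, (v - w).2) ∈ _ from hd)
    rw [inner_sub_left, this, h2, inner_smul_left, inner_smul_right]
    simp
  have h3 : v - w = 0 := Prod.ext h1 (by rw [h2, h1, smul_zero]; rfl)
  rw [sub_eq_zero] at h3
  rwa [h3]

end Abstract

end Compacton

namespace Compacton

open scoped InnerProductSpace ComplexConjugate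
open RCLike

/-! ### Spectrum from two eigenvectors and a form bound on a core -/

section Gap

variable {H : Type*} [NormedAddCommGroup H] [InnerProductSpace ℂ H]

lemma re_inner_ofReal_smul_self (r : ℝ) (x : H) : re ⟪(r : ℂ) • x, x⟫_ℂ = r * ‖x‖ ^ 2 := by
  rw [inner_smul_left, inner_self_eq_norm_sq_to_K]
  simp [← Complex.ofReal_pow]

/-- A quadratic form bound on a two-codimensional part of a core extends to the whole domain. -/
lemma gap_of_core {A : H →ₗ.[ℂ] H} {C : Submodule ℂ (H × H)}
    (hcl : (A.graph : Set (H × H)) ⊆ closure (C : Set (H × H))) {δ : ℝ} {e₀ e₁ : H}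
    (hgap : ∀ w ∈ C, ⟪e₀, w.1⟫_ℂ = 0 → ⟪e₁, w.1⟫_ℂ = 0 → δ * ‖w.1‖ ^ 2 ≤ re ⟪w.2, w.1⟫_ℂ)
    {χ₀ χ₁ : H × H} (hχ₀ : χ₀ ∈ C) (hχ₁ : χ₁ ∈ C)
    (h00 : ⟪e₀, χ₀.1⟫_ℂ ≠ 0) (h10 : ⟪e₁, χ₀.1⟫_ℂ = 0)
    (h01 : ⟪e₀, χ₁.1⟫_ℂ = 0) (h11 : ⟪e₁, χ₁.1⟫_ℂ ≠ 0)
    {x y : H} (hxy : (x, y) ∈ A.graph) (h0 : ⟪e₀, x⟫_ℂ = 0) (h1 : ⟪e₁, x⟫_ℂ = 0) :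
    δ * ‖x‖ ^ 2 ≤ re ⟪y, x⟫_ℂ := by
  -- The eigenvectors need not belong to the core, so the components along them are removed by
  -- subtracting multiples of `χ₀` and `χ₁`. This oblique projection preserves `C`, is continuous on
  -- pairs, and fixes pairs that already satisfy both orthogonality conditions.
  let P : H × H → H × H := fun w =>
    w - (⟪e₀, w.1⟫_ℂ / ⟪e₀, χ₀.1⟫_ℂ) • χ₀ - (⟪e₁, w.1⟫_ℂ / ⟪e₁, χ₁.1⟫_ℂ) • χ₁
  have hP : Continuous P := by fun_prop
  let S : Set (H × H) := {w | δ * ‖(P w).1‖ ^ 2 ≤ re ⟪(P w).2, (P w).1⟫_ℂ}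
  have hS : IsClosed S := by
    refine isClosed_le (by fun_prop) ?_
    have : Continuous fun w => ⟪(P w).2, (P w).1⟫_ℂ := hP.snd.inner hP.fst
    exact RCLike.continuous_re.comp this
  have hCS : (C : Set (H × H)) ⊆ S := by
    intro w hw
    have hPC : P w ∈ C :=
      C.sub_mem (C.sub_mem hw (C.smul_mem _ hχ₀)) (C.smul_mem _ hχ₁)
    refine hgap _ hPC ?_ ?_
    · simp only [P, Prod.fst_sub, Prod.smul_fst, inner_sub_right, inner_smul_right, h01, mul_zero,
        sub_zero]
      field_simp
      simp
    · simp only [P, Prod.fst_sub, Prod.smul_fst, inner_sub_right, inner_smul_right, h10, mul_zero,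
        sub_zero]
      field_simp
      simp
  have hmem : (x, y) ∈ S := closure_minimal hCS hS (hcl hxy)
  have hPx : P (x, y) = (x, y) := by simp [P, h0, h1]
  simpa [S, hPx] using hmem

variable [CompleteSpace H]

/-- The spectrum of a self-adjoint operator with two orthogonal eigenvectors `e₀`, `e₁`, on the
complement of which the operator is bounded below by `δ`, when these data are given on a core. -/
theorem spectrum_of_core {A : H →ₗ.[ℂ] H} (hA : IsSelfAdjoint A) {C : Submodule ℂ (H × H)}
    (hCA : C ≤ A.graph) {l m δ : ℝ} (hlm : l < m) (hm : m < 0) (hδ : 0 < δ)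
    (hlb : ∀ w ∈ C, m * ‖w.1‖ ^ 2 ≤ re ⟪w.2, w.1⟫_ℂ)
    (hdense : ∀ u : H, (∀ w ∈ C, ⟪w.2 - (l : ℂ) • w.1, u⟫_ℂ = 0) → u = 0)
    {e₀ e₁ : H} (he₀ : e₀ ≠ 0) (he₁ : e₁ ≠ 0)
    (h₀ : ∀ w ∈ C, ⟪w.2, e₀⟫_ℂ = ⟪w.1, (m : ℂ) • e₀⟫_ℂ)
    (h₁ : ∀ w ∈ C, ⟪w.2, e₁⟫_ℂ = 0)
    (hgap : ∀ w ∈ C, ⟪e₀, w.1⟫_ℂ = 0 → ⟪e₁, w.1⟫_ℂ = 0 → δ * ‖w.1‖ ^ 2 ≤ re ⟪w.2, w.1⟫_ℂ)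
    {χ₀ χ₁ : H × H} (hχ₀ : χ₀ ∈ C) (hχ₁ : χ₁ ∈ C)
    (h00 : ⟪e₀, χ₀.1⟫_ℂ ≠ 0) (h10 : ⟪e₁, χ₀.1⟫_ℂ = 0)
    (h01 : ⟪e₀, χ₁.1⟫_ℂ = 0) (h11 : ⟪e₁, χ₁.1⟫_ℂ ≠ 0) :
    (∀ μ : ℝ, μ < 0 → (IsEigenvalue A (μ : ℂ) ↔ μ = m)) ∧
      Module.finrank ℂ (eigenspace A (m : ℂ)) = 1 ∧
      eigenspace A 0 = Submodule.span ℂ {e₁} ∧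
      spec A \ {(m : ℂ), 0} ⊆ (fun r : ℝ => (r : ℂ)) '' Ici δ := by
  have hcl := graph_le_closure hA hCA hlm hlb hdense
  have hgapA : ∀ {x y : H}, (x, y) ∈ A.graph → ⟪e₀, x⟫_ℂ = 0 → ⟪e₁, x⟫_ℂ = 0 →
      δ * ‖x‖ ^ 2 ≤ re ⟪y, x⟫_ℂ := fun hxy => gap_of_core hcl hgap hχ₀ hχ₁ h00 h10 h01 h11 hxy
  -- A weak eigenvector on the core is one on the whole graph by continuity, hence an eigenvector by
  -- self-adjointness.
  have heig : ∀ (e : H) (r : ℂ), (∀ w ∈ C, ⟪w.2, e⟫_ℂ = ⟪w.1, r • e⟫_ℂ) → (e, r • e) ∈ A.graph := by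
    intro e r h
    refine mem_graph_of_forall_inner hA fun x y hxy => ?_
    have hc : IsClosed {w : H × H | ⟪w.2, e⟫_ℂ = ⟪w.1, r • e⟫_ℂ} :=
      isClosed_eq (by fun_prop) (by fun_prop)
    exact closure_minimal (fun w hw => h w hw) hc (hcl hxy)
  have hA0 : (e₀, (m : ℂ) • e₀) ∈ A.graph := heig e₀ m h₀
  have hA1 : (e₁, (0 : H)) ∈ A.graph := by
    have := heig e₁ 0 (fun w hw => by rw [h₁ w hw]; simp)
    rwa [zero_smul] at this
  have he₀A : ∀ {x y : H}, (x, y) ∈ A.graph → ⟪e₀, y⟫_ℂ = m * ⟪e₀, x⟫_ℂ := by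
    intro x y hxy
    rw [← inner_graph_symm hA hA0 hxy, inner_smul_left, Complex.conj_ofReal]
  have he₁A : ∀ {x y : H}, (x, y) ∈ A.graph → ⟪e₁, y⟫_ℂ = 0 := by
    intro x y hxy
    rw [← inner_graph_symm hA hA1 hxy, inner_zero_left]
  have horth : ⟪e₁, e₀⟫_ℂ = 0 := by
    have := he₁A hA0
    rw [inner_smul_right] at this
    exact (mul_eq_zero.1 this).resolve_left (by exact_mod_cast hm.ne)
  have horth' : ⟪e₀, e₁⟫_ℂ = 0 := by rw [← inner_conj_symm, horth, map_zero]
  have hn0 : ⟪e₀, e₀⟫_ℂ ≠ 0 := inner_self_ne_zero.2 he₀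
  have hn1 : ⟪e₁, e₁⟫_ℂ ≠ 0 := inner_self_ne_zero.2 he₁
  have hker : ∀ {x : H} {μ : ℝ}, (x, (μ : ℂ) • x) ∈ A.graph → μ < δ → ⟪e₀, x⟫_ℂ = 0 →
      ⟪e₁, x⟫_ℂ = 0 → x = 0 := by
    intro x μ hx hμ hx0 hx1
    have := hgapA hx hx0 hx1
    rw [re_inner_ofReal_smul_self] at this
    by_contra hne
    have : 0 < ‖x‖ ^ 2 := by positivity
    nlinarith
  -- eigenvectors
  have hcoef0 : ∀ {x : H} {μ : ℝ}, (x, (μ : ℂ) • x) ∈ A.graph → μ ≠ m → ⟪e₀, x⟫_ℂ = 0 := by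
    intro x μ hx hμ
    have h := he₀A hx
    rw [inner_smul_right, ← sub_eq_zero, ← sub_mul] at h
    refine (mul_eq_zero.1 h).resolve_left ?_
    rw [sub_eq_zero]
    exact_mod_cast hμ
  have hcoef1 : ∀ {x : H} {μ : ℝ}, (x, (μ : ℂ) • x) ∈ A.graph → μ ≠ 0 → ⟪e₁, x⟫_ℂ = 0 := by
    intro x μ hx hμ
    have h := he₁A hx
    rw [inner_smul_right] at h
    exact (mul_eq_zero.1 h).resolve_left (by exact_mod_cast hμ)
  have hspan0 : eigenspace A (m : ℂ) = Submodule.span ℂ {e₀} := by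
    ext x
    rw [mem_eigenspace_iff, Submodule.mem_span_singleton]
    constructor
    · intro hx
      refine ⟨⟪e₀, x⟫_ℂ / ⟪e₀, e₀⟫_ℂ, ?_⟩
      set a := ⟪e₀, x⟫_ℂ / ⟪e₀, e₀⟫_ℂ with ha
      have hd : (x - a • e₀, (m : ℂ) • (x - a • e₀)) ∈ A.graph := by
        have := A.graph.sub_mem hx (A.graph.smul_mem a hA0)
        rwa [smul_sub, smul_comm (m : ℂ) a]
      have h0 : ⟪e₀, x - a • e₀⟫_ℂ = 0 := by
        rw [inner_sub_right, inner_smul_right, ha]; field_simp; simp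
      have := hker hd (hm.trans hδ) h0 (hcoef1 hd hm.ne)
      rw [sub_eq_zero] at this
      exact this.symm
    · rintro ⟨a, rfl⟩
      have := A.graph.smul_mem a hA0
      rwa [smul_comm]
  have hspan1 : eigenspace A 0 = Submodule.span ℂ {e₁} := by
    ext x
    rw [mem_eigenspace_iff, Submodule.mem_span_singleton, zero_smul]
    constructor
    · intro hx
      refine ⟨⟪e₁, x⟫_ℂ / ⟪e₁, e₁⟫_ℂ, ?_⟩
      set a := ⟪e₁, x⟫_ℂ / ⟪e₁, e₁⟫_ℂ with ha
      have hd : (x - a • e₁, ((0 : ℝ) : ℂ) • (x - a • e₁)) ∈ A.graph := by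
        have := A.graph.sub_mem hx (A.graph.smul_mem a hA1)
        simpa using this
      have h0 : ⟪e₁, x - a • e₁⟫_ℂ = 0 := by
        rw [inner_sub_right, inner_smul_right, ha]; field_simp; simp
      have := hker hd hδ (hcoef0 hd hm.ne') h0
      rw [sub_eq_zero] at this
      exact this.symm
    · rintro ⟨a, rfl⟩
      have := A.graph.smul_mem a hA1
      simpa using this
  refine ⟨fun μ hμ => ⟨fun h => ?_, fun h => ?_⟩, ?_, hspan1, ?_⟩
  · by_contra hne
    refine h ((Submodule.eq_bot_iff _).2 fun x hx => ?_)
    rw [mem_eigenspace_iff] at hx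
    exact hker hx (hμ.trans hδ) (hcoef0 hx hne) (hcoef1 hx hμ.ne)
  · rw [IsEigenvalue, h, hspan0, Ne, Submodule.span_singleton_eq_bot]
    exact he₀
  · rw [hspan0, finrank_span_singleton he₀]
  · rintro z ⟨hz, hz'⟩
    simp only [mem_insert_iff, mem_singleton_iff, not_or] at hz'
    by_contra hnot
    apply hz
    by_cases him : z.im = 0
    · obtain ⟨μ, rfl⟩ : ∃ μ : ℝ, z = μ := ⟨z.re, Complex.ext rfl (by simpa using him)⟩
      have hμδ : μ < δ := by
        by_contra! h
        exact hnot ⟨μ, h, rfl⟩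
      have hμm : μ ≠ m := fun h => hz'.1 (by rw [h])
      have hμ0 : μ ≠ 0 := fun h => hz'.2 (by rw [h]; simp)
      have hc0 : 0 < |m - μ| := abs_pos.2 (sub_ne_zero.2 hμm.symm)
      have hc1 : 0 < |μ| := abs_pos.2 hμ0
      have hcδ : 0 < δ - μ := sub_pos.2 hμδ
      -- One term for each component of `x`: along `e₀`, along `e₁`, and in the remainder `u`. The 3
      -- arises because `(A - μ) u` is `(A - μ) x` minus its two eigencomponents, each of the three
      -- having norm at most `‖(A - μ) x‖`.
      have hsum : 0 < 1 / |m - μ| + 1 / |μ| + 3 / (δ - μ) := by positivity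
      refine mem_resolventSet_of_bounded_below hA
        (ε := (1 / |m - μ| + 1 / |μ| + 3 / (δ - μ))⁻¹) (by positivity) (fun x y hxy => ?_)
        (fun x hx => ?_)
      · set K := ‖y - (μ : ℂ) • x‖ with hK
        set a := ⟪e₀, x⟫_ℂ / ⟪e₀, e₀⟫_ℂ with ha
        set b := ⟪e₁, x⟫_ℂ / ⟪e₁, e₁⟫_ℂ with hb
        have hproj : ∀ e : H, e ≠ 0 → ∀ v : H,
            ‖(⟪e, v⟫_ℂ / ⟪e, e⟫_ℂ) • e‖ = ‖⟪e, v⟫_ℂ‖ / ‖e‖ := by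
          intro e he v
          rw [norm_smul, norm_div, inner_self_eq_norm_sq_to_K]
          have : ‖e‖ ≠ 0 := norm_ne_zero_iff.2 he
          simp
          field_simp
        have hbound : ∀ e : H, e ≠ 0 → ∀ r : ℂ, ⟪e, y - (μ : ℂ) • x⟫_ℂ = r * ⟪e, x⟫_ℂ →
            ‖r‖ * ‖(⟪e, x⟫_ℂ / ⟪e, e⟫_ℂ) • e‖ ≤ K := by
          intro e he r hr
          rw [hproj e he, ← mul_div_assoc, ← norm_mul, ← hr, div_le_iff₀ (norm_pos_iff.2 he),
            mul_comm]
          exact norm_inner_le_norm _ _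
        have hb0 : |m - μ| * ‖a • e₀‖ ≤ K := by
          have := hbound e₀ he₀ ((m - μ : ℝ) : ℂ) (by
            rw [inner_sub_right, he₀A hxy, inner_smul_right]; push_cast; ring)
          rwa [Complex.norm_real, Real.norm_eq_abs] at this
        have hb1 : |μ| * ‖b • e₁‖ ≤ K := by
          have := hbound e₁ he₁ ((-μ : ℝ) : ℂ) (by
            rw [inner_sub_right, he₁A hxy, inner_smul_right]; push_cast; ring)
          rwa [Complex.norm_real, Real.norm_eq_abs, abs_neg] at this
        set u := x - a • e₀ - b • e₁ with hu
        set v := y - a • (m : ℂ) • e₀ - b • (0 : H) with hv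
        have huv : (u, v) ∈ A.graph :=
          A.graph.sub_mem (A.graph.sub_mem hxy (A.graph.smul_mem a hA0)) (A.graph.smul_mem b hA1)
        have hu0 : ⟪e₀, u⟫_ℂ = 0 := by
          rw [hu, inner_sub_right, inner_sub_right, inner_smul_right, inner_smul_right, horth', ha]
          field_simp; simp
        have hu1 : ⟪e₁, u⟫_ℂ = 0 := by
          rw [hu, inner_sub_right, inner_sub_right, inner_smul_right, inner_smul_right, horth, hb]
          field_simp; simp
        have hg := hgapA huv hu0 hu1
        have hb2 : (δ - μ) * ‖u‖ ≤ 3 * K := by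
          have h1 : (δ - μ) * ‖u‖ ≤ ‖v - (μ : ℂ) • u‖ := by
            rcases eq_or_ne u 0 with h0 | h0
            · rw [h0, norm_zero, mul_zero]; exact norm_nonneg _
            have hpos : 0 < ‖u‖ := norm_pos_iff.2 h0
            have h2 : (δ - μ) * ‖u‖ ^ 2 ≤ re ⟪v - (μ : ℂ) • u, u⟫_ℂ := by
              rw [inner_sub_left, map_sub, re_inner_ofReal_smul_self]
              linarith
            have h3 := (re_inner_le_norm (𝕜 := ℂ) (v - (μ : ℂ) • u) u)
            exact le_of_mul_le_mul_right (by nlinarith) hpos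
          have h2 : v - (μ : ℂ) • u = (y - (μ : ℂ) • x) - ((m - μ : ℝ) : ℂ) • (a • e₀)
              + (μ : ℂ) • (b • e₁) := by
            rw [hu, hv]; push_cast; module
          have h3 : ‖v - (μ : ℂ) • u‖ ≤ K + |m - μ| * ‖a • e₀‖ + |μ| * ‖b • e₁‖ := by
            rw [h2]
            refine (norm_add_le _ _).trans (add_le_add ((norm_sub_le _ _).trans ?_) ?_)
            · rw [norm_smul _ (a • e₀), Complex.norm_real, Real.norm_eq_abs]
            · rw [norm_smul, Complex.norm_real, Real.norm_eq_abs]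
          linarith
        have hx : x = a • e₀ + b • e₁ + u := by rw [hu]; abel
        rw [inv_mul_le_iff₀ hsum]
        have t0 : ‖a • e₀‖ ≤ 1 / |m - μ| * K := by
          rw [one_div, inv_mul_eq_div, le_div_iff₀ hc0]; linarith
        have t1 : ‖b • e₁‖ ≤ 1 / |μ| * K := by
          rw [one_div, inv_mul_eq_div, le_div_iff₀ hc1]; linarith
        have t2 : ‖u‖ ≤ 3 / (δ - μ) * K := by
          rw [div_mul_eq_mul_div, le_div_iff₀ hcδ]; linarith
        calc ‖x‖ ≤ ‖a • e₀‖ + ‖b • e₁‖ + ‖u‖ := by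
              conv_lhs => rw [hx]
              exact norm_add₃_le
          _ ≤ _ := by linarith
      · rw [Complex.conj_ofReal] at hx
        exact hker hx hμδ (hcoef0 hx hμm) (hcoef1 hx hμ0)
    -- For non-real `z` no spectral information is needed: `⟪x, A x⟫` is real, so the imaginary part
    -- of `⟪x, (A - w) x⟫` is `-Im w ‖x‖²`.
    · have hbd : ∀ (w : ℂ) x y, (x, y) ∈ A.graph → |w.im| * ‖x‖ ≤ ‖y - w • x‖ := by
        intro w x y hxy
        rcases eq_or_ne x 0 with h0 | h0
        · rw [h0, norm_zero, mul_zero]; exact norm_nonneg _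
        have hpos : 0 < ‖x‖ := norm_pos_iff.2 h0
        have hreal : (⟪x, y⟫_ℂ).im = 0 := by
          have h1 := inner_graph_symm hA hxy hxy
          rw [← inner_conj_symm] at h1
          exact Complex.conj_eq_iff_im.1 h1
        have h2 : (⟪x, y - w • x⟫_ℂ).im = - (w.im * ‖x‖ ^ 2) := by
          rw [inner_sub_right, inner_smul_right, inner_self_eq_norm_sq_to_K, Complex.sub_im, hreal]
          simp [← Complex.ofReal_pow]
        have h3 : |w.im| * ‖x‖ ^ 2 ≤ ‖x‖ * ‖y - w • x‖ := by
          have h4 := (Complex.abs_im_le_norm ⟪x, y - w • x⟫_ℂ).trans (norm_inner_le_norm _ _)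
          rwa [h2, abs_neg, abs_mul, abs_of_nonneg (by positivity : 0 ≤ ‖x‖ ^ 2)] at h4
        exact le_of_mul_le_mul_right (by nlinarith) hpos
      refine mem_resolventSet_of_bounded_below hA (abs_pos.2 him) (hbd z) fun x hx => ?_
      have := hbd (conj z) x _ hx
      rw [sub_self, norm_zero, Complex.conj_im, abs_neg] at this
      by_contra hne
      have : 0 < |z.im| * ‖x‖ := mul_pos (abs_pos.2 him) (norm_pos_iff.2 hne)
      linarith

end Gap

end Compacton

/-! ### Test functions and their primitives -/

namespace Compacton

/-- Real-valued test functions on `U`. -/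
structure IsTest (U : Set ℝ) (f : ℝ → ℝ) : Prop where
  smooth : ContDiff ℝ ∞ f
  compact : HasCompactSupport f
  subset : tsupport f ⊆ U

namespace IsTest

variable {U V : Set ℝ} {f g G : ℝ → ℝ}

lemma mono (hf : IsTest U f) (h : U ⊆ V) : IsTest V f := ⟨hf.smooth, hf.compact, hf.subset.trans h⟩

lemma continuous (hf : IsTest U f) : Continuous f := hf.smooth.continuous

lemma integrable (hf : IsTest U f) : Integrable f := hf.continuous.integrable_of_hasCompactSupport hf.compact

lemma hasDerivAt (hf : IsTest U f) (x : ℝ) : HasDerivAt f (deriv f x) x :=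
  (hf.smooth.differentiable (by simp) x).hasDerivAt

lemma eq_zero (hf : IsTest U f) {x : ℝ} (hx : x ∉ U) : f x = 0 :=
  image_eq_zero_of_notMem_tsupport fun h => hx (hf.subset h)

lemma deriv (hf : IsTest U f) : IsTest U (deriv f) := by
  refine ⟨?_, hf.compact.deriv, (tsupport_deriv_subset).trans hf.subset⟩
  exact (contDiff_infty_iff_deriv.1 hf.smooth).2

lemma mul_left (hU : IsOpen U) (hG : ContDiffOn ℝ ∞ G U) (hf : IsTest U f) :
    IsTest U (fun x => G x * f x) := by
  refine ⟨?_, hf.compact.mul_left, (tsupport_mul_subset_right).trans hf.subset⟩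
  refine contDiff_iff_contDiffAt.2 fun x => ?_
  by_cases hx : x ∈ tsupport f
  · exact (hG.contDiffAt (hU.mem_nhds (hf.subset hx))).mul hf.smooth.contDiffAt
  · have : (fun x => G x * f x) =ᶠ[nhds x] fun _ => 0 := by
      filter_upwards [notMem_tsupport_iff_eventuallyEq.1 hx] with y hy
      simp [hy]
    exact contDiffAt_const.congr_of_eventuallyEq this

lemma add (hf : IsTest U f) (hg : IsTest U g) : IsTest U (fun x => f x + g x) :=
  ⟨hf.smooth.add hg.smooth, hf.compact.add hg.compact,
    (tsupport_add f g).trans (union_subset hf.subset hg.subset)⟩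

lemma const_mul (hf : IsTest U f) (c : ℝ) : IsTest U (fun x => c * f x) :=
  ⟨contDiff_const.mul hf.smooth, hf.compact.mul_left, (tsupport_mul_subset_right).trans hf.subset⟩

lemma neg (hf : IsTest U f) : IsTest U (fun x => - f x) := by
  simpa using hf.const_mul (-1)

lemma sub (hf : IsTest U f) (hg : IsTest U g) : IsTest U (fun x => f x - g x) := by
  simpa [sub_eq_add_neg] using hf.add hg.neg

lemma mul (hf : IsTest U f) (hg : IsTest U g) : IsTest U (fun x => f x * g x) :=
  ⟨hf.smooth.mul hg.smooth, hg.compact.mul_left, (tsupport_mul_subset_right).trans hg.subset⟩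

lemma zero : IsTest U (fun _ => 0) :=
  ⟨contDiff_const, HasCompactSupport.zero, by
    have : tsupport (fun _ : ℝ => (0 : ℝ)) = ∅ := tsupport_eq_empty_iff.2 rfl
    simp [this]⟩

lemma congr (hf : IsTest U f) (h : ∀ x, g x = f x) : IsTest U g := by
  rwa [show g = f from funext h]

lemma integral_deriv (hf : IsTest U f) : ∫ x, _root_.deriv f x = 0 := by
  refine integral_eq_zero_of_hasDerivAt_of_integrable hf.hasDerivAt hf.deriv.integrable
    hf.integrable

/-- The primitive from `a` vanishes to the left of the support trivially and to the right because
the total integral is zero. This is what lets first-order equations be solved within test functions.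
-/
lemma exists_primitive {a b : ℝ} (hf : IsTest (Ioo a b) f) (h0 : ∫ x, f x = 0) :
    ∃ F, IsTest (Ioo a b) F ∧ ∀ x, HasDerivAt F (f x) x := by
  rcases (tsupport f).eq_empty_or_nonempty with he | hne
  · refine ⟨fun _ => 0, zero, fun x => ?_⟩
    have : f x = 0 := image_eq_zero_of_notMem_tsupport (by simp [he])
    rw [this]
    exact hasDerivAt_const _ _
  -- The extreme points of the support lie strictly inside `(a, b)`, so `Icc c d` supports the
  -- primitive compactly.
  obtain ⟨c, hc, hc'⟩ := (show IsCompact (tsupport f) from hf.compact).exists_isLeast hne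
  obtain ⟨d, hd, hd'⟩ := (show IsCompact (tsupport f) from hf.compact).exists_isGreatest hne
  have hac := hf.subset hc
  have hbd := hf.subset hd
  have hF : ∀ x, HasDerivAt (fun x => ∫ t in a..x, f t) (f x) x := fun x =>
    intervalIntegral.integral_hasDerivAt_right (hf.continuous.intervalIntegrable _ _)
      hf.continuous.stronglyMeasurable.stronglyMeasurableAtFilter hf.continuous.continuousAt
  have hz : ∀ t, t ∉ Icc c d → f t = 0 := fun t ht =>
    image_eq_zero_of_notMem_tsupport fun h => ht ⟨hc' h, hd' h⟩
  have hsupp : Function.support (fun x => ∫ t in a..x, f t) ⊆ Icc c d := by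
    intro x hx
    by_contra hxn
    apply hx
    rcases lt_or_ge x c with hxc | hxc
    · have : EqOn f (fun _ => 0) (uIcc a x) := fun t ht => hz t fun ht' => by
        rw [mem_uIcc] at ht
        rcases ht with ht | ht <;> linarith [ht'.1, hac.1]
      simp only
      rw [intervalIntegral.integral_congr this]
      simp
    · have hxd : d < x := by
        by_contra! h
        exact hxn ⟨hxc, h⟩
      have hax : a ≤ x := by linarith [hac.1]
      simp only
      rw [intervalIntegral.integral_of_le hax, setIntegral_eq_integral_of_forall_compl_eq_zero, h0]
      intro t ht
      refine hz t fun ht' => ht ⟨by linarith [ht'.1, hac.1], by linarith [ht'.2]⟩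
  have hts : tsupport (fun x => ∫ t in a..x, f t) ⊆ Icc c d := closure_minimal hsupp isClosed_Icc
  refine ⟨fun x => ∫ t in a..x, f t, ⟨?_, ?_, ?_⟩, hF⟩
  · rw [contDiff_infty_iff_deriv]
    refine ⟨fun x => (hF x).differentiableAt, ?_⟩
    rw [show _root_.deriv (fun x => ∫ t in a..x, f t) = f from funext fun x => (hF x).deriv]
    exact hf.smooth
  · exact HasCompactSupport.of_support_subset_isCompact isCompact_Icc hsupp
  · exact hts.trans fun x hx => ⟨hac.1.trans_le hx.1, hx.2.trans_lt hbd.2⟩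

end IsTest

end Compacton

/-! ### Factorization of the operator and the spectral gap on the interval -/

namespace Compacton

/-- Functions that differ by the derivative of a test function have the same integral. -/
lemma integral_eq_of_hasDerivAt_sub {l : ℝ} {F u v : ℝ → ℝ} (hF : IsTest (Ioo (-l) l) F)
    (hu : IsTest (Ioo (-l) l) u) (hv : IsTest (Ioo (-l) l) v)
    (h : ∀ x ∈ Ioo (-l) l, HasDerivAt F (u x - v x) x) : ∫ x, u x = ∫ x, v x := by
  rw [← sub_eq_zero, ← integral_sub hu.integrable hv.integrable, ← hF.integral_deriv]
  congr 1
  funext x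
  by_cases hx : x ∈ Ioo (-l) l
  · exact (h x hx).deriv.symm
  · rw [hu.eq_zero hx, hv.eq_zero hx, hF.deriv.eq_zero hx, sub_zero]

/-- The properties of a compacton profile that enter the spectral analysis. -/
structure Profile (s ω κ l : ℝ) (Φ : ℝ → ℝ) : Prop where
  s_pos : 0 < s
  ω_pos : 0 < ω
  κ_pos : 0 < κ
  l_pos : 0 < l
  even : ∀ x, Φ (-x) = Φ x
  cont : Continuous Φ
  pos : ∀ x ∈ Ioo (-l) l, 0 < Φ x
  zero : ∀ x, x ∉ Ioo (-l) l → Φ x = 0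
  smooth : ContDiffOn ℝ ∞ Φ (Ioo (-l) l)
  deriv_sq : ∀ x ∈ Ioo (-l) l, deriv Φ x ^ 2 = ω - κ * Φ x ^ (2 * s)
  deriv_deriv : ∀ x ∈ Ioo (-l) l, Φ x * deriv (deriv Φ) x = -κ * s * Φ x ^ (2 * s)

/-- The first order operator `f ↦ Φ f' - σ Φ' f`. -/
noncomputable def lad (Φ : ℝ → ℝ) (σ : ℝ) (f : ℝ → ℝ) (x : ℝ) : ℝ := Φ x * deriv f x - σ * deriv Φ x * f x

/-- The formal adjoint of `lad Φ σ`. -/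
noncomputable def ladStar (Φ : ℝ → ℝ) (σ : ℝ) (f : ℝ → ℝ) (x : ℝ) : ℝ :=
  -(Φ x * deriv f x) - (1 + σ) * deriv Φ x * f x

/-- The operator `f ↦ -(Φ² f')' - κ s (2 s + 1) Φ ^ (2 s) f`. -/
noncomputable def innerOp (s κ : ℝ) (Φ f : ℝ → ℝ) (x : ℝ) : ℝ :=
  -(Φ x ^ 2 * deriv (deriv f) x + 2 * Φ x * deriv Φ x * deriv f x)
    - κ * s * (2 * s + 1) * Φ x ^ (2 * s) * f x

namespace Profile

variable {s ω κ l : ℝ} {Φ : ℝ → ℝ} (P : Profile s ω κ l Φ)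
include P

lemma hasDerivAt {x : ℝ} (hx : x ∈ Ioo (-l) l) : HasDerivAt Φ (deriv Φ x) x :=
  ((P.smooth.contDiffAt (isOpen_Ioo.mem_nhds hx)).differentiableAt (by simp)).hasDerivAt

lemma smooth_deriv : ContDiffOn ℝ ∞ (deriv Φ) (Ioo (-l) l) :=
  P.smooth.deriv_of_isOpen isOpen_Ioo (by simp)

lemma hasDerivAt_deriv {x : ℝ} (hx : x ∈ Ioo (-l) l) :
    HasDerivAt (deriv Φ) (deriv (deriv Φ) x) x :=
  ((P.smooth_deriv.contDiffAt (isOpen_Ioo.mem_nhds hx)).differentiableAt (by simp)).hasDerivAt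

lemma smooth_rpow (a : ℝ) : ContDiffOn ℝ ∞ (fun x => Φ x ^ a) (Ioo (-l) l) :=
  P.smooth.rpow_const_of_ne fun x hx => (P.pos x hx).ne'

lemma hasDerivAt_rpow (a : ℝ) {x : ℝ} (hx : x ∈ Ioo (-l) l) :
    HasDerivAt (fun x => Φ x ^ a) (a * Φ x ^ (a - 1) * deriv Φ x) x := by
  have := (P.hasDerivAt hx).rpow_const (p := a) (Or.inl (P.pos x hx).ne')
  convert this using 1
  ring

lemma isTest_lad (σ : ℝ) {f : ℝ → ℝ} (hf : IsTest (Ioo (-l) l) f) :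
    IsTest (Ioo (-l) l) (lad Φ σ f) :=
  ((hf.deriv.mul_left isOpen_Ioo P.smooth).sub
    ((hf.mul_left isOpen_Ioo P.smooth_deriv).const_mul σ)).congr fun x => by rw [lad]; ring

lemma isTest_ladStar (σ : ℝ) {f : ℝ → ℝ} (hf : IsTest (Ioo (-l) l) f) :
    IsTest (Ioo (-l) l) (ladStar Φ σ f) :=
  ((hf.deriv.mul_left isOpen_Ioo P.smooth).neg.sub
    ((hf.mul_left isOpen_Ioo P.smooth_deriv).const_mul (1 + σ))).congr fun x => by
      rw [ladStar]; ring

lemma isTest_innerOp {f : ℝ → ℝ} (hf : IsTest (Ioo (-l) l) f) :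
    IsTest (Ioo (-l) l) (innerOp s κ Φ f) := by
  have h1 : ContDiffOn ℝ ∞ (fun x => -(Φ x ^ 2)) (Ioo (-l) l) := (P.smooth.pow 2).neg
  have h2 : ContDiffOn ℝ ∞ (fun x => -(2 * (Φ x * deriv Φ x))) (Ioo (-l) l) :=
    (contDiffOn_const.mul (P.smooth.mul P.smooth_deriv)).neg
  have h3 : ContDiffOn ℝ ∞ (fun x => (κ * s * (2 * s + 1)) * Φ x ^ (2 * s)) (Ioo (-l) l) :=
    contDiffOn_const.mul (P.smooth_rpow (2 * s))
  refine (((hf.deriv.deriv.mul_left isOpen_Ioo h1).add (hf.deriv.mul_left isOpen_Ioo h2)).sub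
    (hf.mul_left isOpen_Ioo h3)).congr fun x => ?_
  rw [innerOp]; ring

lemma deriv_lad (σ : ℝ) {f : ℝ → ℝ} (hf : IsTest (Ioo (-l) l) f) {x : ℝ}
    (hx : x ∈ Ioo (-l) l) :
    deriv (lad Φ σ f) x = deriv Φ x * deriv f x + Φ x * deriv (deriv f) x
      - (σ * deriv (deriv Φ) x * f x + σ * deriv Φ x * deriv f x) :=
  (((P.hasDerivAt hx).mul (hf.deriv.hasDerivAt x)).sub
    (((P.hasDerivAt_deriv hx).const_mul σ).mul (hf.hasDerivAt x))).deriv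

lemma deriv_ladStar (σ : ℝ) {f : ℝ → ℝ} (hf : IsTest (Ioo (-l) l) f) {x : ℝ}
    (hx : x ∈ Ioo (-l) l) :
    deriv (ladStar Φ σ f) x = -(deriv Φ x * deriv f x + Φ x * deriv (deriv f) x)
      - ((1 + σ) * deriv (deriv Φ) x * f x + (1 + σ) * deriv Φ x * deriv f x) :=
  (((P.hasDerivAt hx).mul (hf.deriv.hasDerivAt x)).neg.sub
    (((P.hasDerivAt_deriv hx).const_mul (1 + σ)).mul (hf.hasDerivAt x))).deriv

/-- The factorization of the operator. -/
lemma innerOp_eq {σ : ℝ} (hσ : σ * (σ + 1 + s) = s * (2 * s + 1)) {f : ℝ → ℝ}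
    (hf : IsTest (Ioo (-l) l) f) (x : ℝ) :
    innerOp s κ Φ f x = ladStar Φ σ (lad Φ σ f) x - σ * (σ + 1) * ω * f x := by
  by_cases hx : x ∈ Ioo (-l) l
  · rw [ladStar, P.deriv_lad σ hf hx, lad, innerOp]
    have h1 := P.deriv_sq x hx
    have h2 := P.deriv_deriv x hx
    -- The product contributes the potential `σ Φ Φ'' + σ (σ + 1) Φ'²`, up to sign. The profile
    -- equations make it a constant plus a multiple of `Φ ^ (2s)`, and `hσ` matches that multiple.
    linear_combination (-κ * Φ x ^ (2 * s) * f x) * (-hσ) - σ * f x * h2 - σ * (σ + 1) * f x * h1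
  · rw [(P.isTest_innerOp hf).eq_zero hx, hf.eq_zero hx,
      (P.isTest_ladStar σ (P.isTest_lad σ hf)).eq_zero hx]
    ring

/-- The intertwining relation with the divergence form operator `g ↦ -(Φ² g')'`. -/
lemma lad_ladStar_eq {g : ℝ → ℝ} (hg : IsTest (Ioo (-l) l) g) (x : ℝ) :
    lad Φ s (ladStar Φ s g) x = ladStar Φ 0 (lad Φ 0 g) x + s * (s + 1) * ω * g x := by
  by_cases hx : x ∈ Ioo (-l) l
  · rw [ladStar, lad, P.deriv_lad 0 hg hx, P.deriv_ladStar s hg hx, lad, ladStar]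
    have h1 := P.deriv_sq x hx
    have h2 := P.deriv_deriv x hx
    linear_combination -(1 + s) * g x * h2 + s * (s + 1) * g x * h1
  · rw [(P.isTest_lad s (P.isTest_ladStar s hg)).eq_zero hx, hg.eq_zero hx,
      (P.isTest_ladStar 0 (P.isTest_lad 0 hg)).eq_zero hx]
    ring

lemma integral_ladStar_mul (σ : ℝ) {f g : ℝ → ℝ} (hf : IsTest (Ioo (-l) l) f)
    (hg : IsTest (Ioo (-l) l) g) :
    ∫ x, ladStar Φ σ g x * f x = ∫ x, g x * lad Φ σ f x := by
  refine integral_eq_of_hasDerivAt_sub (F := fun x => -(Φ x * (g x * f x)))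
    ((hg.mul hf).mul_left isOpen_Ioo P.smooth).neg ((P.isTest_ladStar σ hg).mul hf)
    (hg.mul (P.isTest_lad σ hf)) fun x hx => ?_
  refine ((P.hasDerivAt hx).fun_mul ((hg.hasDerivAt x).fun_mul
    (hf.hasDerivAt x))).fun_neg.congr_deriv ?_
  simp only [ladStar, lad]; ring

/-- Solvability of `ladStar Φ σ g = f`. -/
lemma exists_ladStar_eq {σ : ℝ} {f : ℝ → ℝ} (hf : IsTest (Ioo (-l) l) f)
    (h0 : ∫ x, Φ x ^ σ * f x = 0) :
    ∃ F g, IsTest (Ioo (-l) l) F ∧ (∀ x, HasDerivAt F (Φ x ^ σ * f x) x) ∧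
      IsTest (Ioo (-l) l) g ∧ (∀ x, g x = Φ x ^ (-(1 + σ)) * (-F x)) ∧
      ∀ x, ladStar Φ σ g x = f x := by
  -- Integrating factor: `ladStar Φ σ g = -Φ ^ (-σ) (Φ ^ (1 + σ) g)'`, so `Φ ^ (1 + σ) g = -F`.
  obtain ⟨F, hF, hF'⟩ := (hf.mul_left isOpen_Ioo (P.smooth_rpow σ)).exists_primitive h0
  have hg : IsTest (Ioo (-l) l) (fun x => Φ x ^ (-(1 + σ)) * (-F x)) :=
    hF.neg.mul_left isOpen_Ioo (P.smooth_rpow _)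
  refine ⟨F, _, hF, hF', hg, fun x => rfl, fun x => ?_⟩
  by_cases hx : x ∈ Ioo (-l) l
  · have hd := ((P.hasDerivAt_rpow (-(1 + σ)) hx).fun_mul (hF' x).fun_neg).deriv
    have hpos := P.pos x hx
    rw [ladStar]
    rw [hd]
    have e1 : Φ x ^ (-(1 + σ)) * Φ x ^ σ * Φ x = 1 := by
      rw [← Real.rpow_add hpos, ← Real.rpow_add_one hpos.ne']
      ring_nf; exact Real.rpow_zero _
    have e2 : Φ x ^ (-(1 + σ)) = Φ x ^ (-(1 + σ) - 1) * Φ x := by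
      rw [← Real.rpow_add_one hpos.ne']; ring_nf
    linear_combination f x * e1 + (1 + σ) * deriv Φ x * F x * e2
  · rw [(P.isTest_ladStar σ hg).eq_zero hx, hf.eq_zero hx]

/-- Solvability of `lad Φ σ f = g`. -/
lemma exists_lad_eq {σ : ℝ} {g : ℝ → ℝ} (hg : IsTest (Ioo (-l) l) g)
    (h0 : ∫ x, Φ x ^ (-(1 + σ)) * g x = 0) :
    ∃ f, IsTest (Ioo (-l) l) f ∧ ∀ x, lad Φ σ f x = g x := by
  -- Integrating factor: `lad Φ σ f = Φ ^ (1 + σ) (Φ ^ (-σ) f)'`, so `f = Φ ^ σ F`.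
  obtain ⟨F, hF, hF'⟩ := (hg.mul_left isOpen_Ioo (P.smooth_rpow (-(1 + σ)))).exists_primitive h0
  have hf : IsTest (Ioo (-l) l) (fun x => Φ x ^ σ * F x) :=
    hF.mul_left isOpen_Ioo (P.smooth_rpow _)
  refine ⟨_, hf, fun x => ?_⟩
  by_cases hx : x ∈ Ioo (-l) l
  · have hd := ((P.hasDerivAt_rpow σ hx).fun_mul (hF' x)).deriv
    have hpos := P.pos x hx
    rw [lad]
    rw [hd]
    have e1 : Φ x ^ (-(1 + σ)) * Φ x ^ σ * Φ x = 1 := by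
      rw [← Real.rpow_add hpos, ← Real.rpow_add_one hpos.ne']
      ring_nf; exact Real.rpow_zero _
    have e2 : Φ x ^ σ = Φ x ^ (σ - 1) * Φ x := by
      rw [← Real.rpow_add_one hpos.ne']; ring_nf
    linear_combination g x * e1 - σ * deriv Φ x * F x * e2
  · rw [(P.isTest_lad σ hf).eq_zero hx, hg.eq_zero hx]

lemma rpow_le {x : ℝ} (hx : x ∈ Ioo (-l) l) : κ * Φ x ^ (2 * s) ≤ ω := by
  have := P.deriv_sq x hx
  nlinarith [sq_nonneg (deriv Φ x)]

/-- A Hardy type inequality. -/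
lemma hardy {k : ℝ → ℝ} (hk : IsTest (Ioo (-l) l) k) :
    min (ω / 4) (ω * s / 2) * ∫ x, k x ^ 2 ≤ ∫ x, ladStar Φ 0 k x ^ 2 := by
  set δ := min (ω / 4) (ω * s / 2) with hδ
  have hk2 : IsTest (Ioo (-l) l) (fun x => k x ^ 2) := (hk.mul hk).congr fun x => by ring
  have hS := P.isTest_ladStar 0 hk
  have hS2 : IsTest (Ioo (-l) l) (fun x => ladStar Φ 0 k x ^ 2) :=
    (hS.mul hS).congr fun x => by ring
  have hΦ' : ContDiffOn ℝ ∞ (fun x => Φ x * deriv Φ x) (Ioo (-l) l) := P.smooth.mul P.smooth_deriv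
  -- Subtracting the exact derivative `(Φ Φ' k²)' / 2`, of zero integral, from `((Φ k)')²` leaves
  -- `(Φ k' + Φ' k / 2)² + (Φ'²/4 - Φ Φ''/2) k²`, so the inequality can be checked pointwise.
  have hF : IsTest (Ioo (-l) l) (fun x => (Φ x * deriv Φ x) * (k x ^ 2)) :=
    hk2.mul_left isOpen_Ioo hΦ'
  have hF2 := hF.deriv.const_mul (1 / 2)
  rw [← integral_const_mul]
  have h0 : ∫ x, (1 / 2) * deriv (fun x => (Φ x * deriv Φ x) * (k x ^ 2)) x = 0 := by
    rw [integral_const_mul, hF.integral_deriv, mul_zero]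
  have h6 := integral_add (hk2.const_mul δ).integrable hF2.integrable
  rw [h0, add_zero] at h6
  rw [← h6]
  refine integral_mono ((hk2.const_mul δ).integrable.add hF2.integrable) hS2.integrable fun x => ?_
  by_cases hx : x ∈ Ioo (-l) l
  · have hd : deriv (fun x => (Φ x * deriv Φ x) * (k x ^ 2)) x =
        (deriv Φ x * deriv Φ x + Φ x * deriv (deriv Φ) x) * k x ^ 2
          + Φ x * deriv Φ x * (2 * k x * deriv k x) := by
      rw [(((P.hasDerivAt hx).fun_mul (P.hasDerivAt_deriv hx)).fun_mul
        ((hk.hasDerivAt x).fun_pow 2)).deriv]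
      simp
    simp only
    rw [hd, ladStar]
    have h1 := P.deriv_sq x hx
    have h2 := P.deriv_deriv x hx
    have h3 := P.rpow_le hx
    have h5 : 0 ≤ κ * Φ x ^ (2 * s) := mul_nonneg P.κ_pos.le (Real.rpow_nonneg (P.pos x hx).le _)
    have h4 : δ ≤ 1 / 4 * deriv Φ x ^ 2 - 1 / 2 * (Φ x * deriv (deriv Φ) x) := by
      rw [h1, h2]
      have a1 : δ ≤ ω / 4 := min_le_left _ _
      have a2 : δ ≤ ω * s / 2 := min_le_right _ _
      set X := κ * Φ x ^ (2 * s) with hX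
      have hω := P.ω_pos
      -- The potential is affine in `X`, which ranges in `[0, ω]`; its end values are `ω/4` and `ω
      -- s/2`.
      have e : ω * (1 / 4 * (ω - X) - 1 / 2 * (-κ * s * Φ x ^ (2 * s)) - δ)
        = (ω - X) * (ω / 4 - δ) + X * (ω * s / 2 - δ) := by rw [hX]; ring
      have : 0 ≤ ω * (1 / 4 * (ω - X) - 1 / 2 * (-κ * s * Φ x ^ (2 * s)) - δ) := by
        rw [e]
        exact add_nonneg (mul_nonneg (by linarith) (by linarith)) (mul_nonneg h5 (by linarith))
      have := nonneg_of_mul_nonneg_right this hω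
      linarith
    nlinarith [mul_le_mul_of_nonneg_right h4 (sq_nonneg (k x)),
      sq_nonneg (Φ x * deriv k x + 1 / 2 * deriv Φ x * k x)]
  · simp only
    rw [hk2.eq_zero hx, hF.deriv.eq_zero hx, hS2.eq_zero hx]; simp

lemma delta_pos : 0 < min (ω / 4) (ω * s / 2) :=
  lt_min (by linarith [P.ω_pos]) (by have := mul_pos P.ω_pos P.s_pos; linarith)

/-- A Poincaré type inequality, dual to the Hardy inequality. -/
lemma poincare {g : ℝ → ℝ} (hg : IsTest (Ioo (-l) l) g) (h0 : ∫ x, g x = 0) :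
    min (ω / 4) (ω * s / 2) * ∫ x, g x ^ 2 ≤ ∫ x, lad Φ 0 g x ^ 2 := by
  have hδ := P.delta_pos
  set δ := min (ω / 4) (ω * s / 2)
  -- Duality: `g = -(Φ h)'` with `h` a test function, so `‖g‖² = ⟨h, Φ g'⟩` while the Hardy
  -- inequality bounds `‖h‖` by `‖g‖`. Young's inequality with weight `δ` concludes.
  obtain ⟨-, h, -, -, hh, -, hgh⟩ := P.exists_ladStar_eq (σ := 0) hg (by simpa using h0)
  have hk := P.isTest_lad 0 hg
  have hH : δ * ∫ x, h x ^ 2 ≤ ∫ x, g x ^ 2 := by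
    have := P.hardy hh
    simpa only [hgh] using this
  have hG : ∫ x, g x ^ 2 = ∫ x, h x * lad Φ 0 g x := by
    rw [← P.integral_ladStar_mul 0 hg hh]
    simp only [hgh, sq]
  have hh2 : IsTest (Ioo (-l) l) (fun x => h x ^ 2) := (hh.mul hh).congr fun x => by ring
  have hk2 : IsTest (Ioo (-l) l) (fun x => lad Φ 0 g x ^ 2) := (hk.mul hk).congr fun x => by ring
  have hle : ∫ x, h x * lad Φ 0 g x ≤
      ∫ x, (δ / 2 * h x ^ 2 + 1 / (2 * δ) * lad Φ 0 g x ^ 2) := by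
    refine integral_mono (hh.mul hk).integrable
      ((hh2.const_mul _).add (hk2.const_mul _)).integrable fun x => ?_
    have : δ / 2 * h x ^ 2 + 1 / (2 * δ) * lad Φ 0 g x ^ 2 - h x * lad Φ 0 g x
        = (δ * h x - lad Φ 0 g x) ^ 2 / (2 * δ) := by field_simp; ring
    have h2 : 0 ≤ (δ * h x - lad Φ 0 g x) ^ 2 / (2 * δ) := by positivity
    simp only
    linarith
  rw [integral_add (hh2.const_mul _).integrable (hk2.const_mul _).integrable, integral_const_mul,
    integral_const_mul, ← hG] at hle
  have : 1 / (2 * δ) * ∫ x, lad Φ 0 g x ^ 2 = (∫ x, lad Φ 0 g x ^ 2) / (2 * δ) := by ring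
  rw [this] at hle
  have h3 : (∫ x, g x ^ 2) / 2 ≤ (∫ x, lad Φ 0 g x ^ 2) / (2 * δ) := by linarith
  rw [le_div_iff₀ (by positivity)] at h3
  linarith

lemma integral_innerOp_mul {σ : ℝ} (hσ : σ * (σ + 1 + s) = s * (2 * s + 1)) {f : ℝ → ℝ}
    (hf : IsTest (Ioo (-l) l) f) :
    ∫ x, innerOp s κ Φ f x * f x = (∫ x, lad Φ σ f x ^ 2) - σ * (σ + 1) * ω * ∫ x, f x ^ 2 := by
  have hl := P.isTest_lad σ hf
  have h1 : ∀ x, innerOp s κ Φ f x * f x =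
      ladStar Φ σ (lad Φ σ f) x * f x - σ * (σ + 1) * ω * (f x * f x) := fun x => by
    rw [P.innerOp_eq hσ hf]; ring
  simp only [h1]
  rw [integral_sub ((P.isTest_ladStar σ hl).mul hf).integrable ((hf.mul hf).const_mul _).integrable,
    P.integral_ladStar_mul σ hf hl, integral_const_mul]
  simp only [sq]

lemma lower_bound {f : ℝ → ℝ} (hf : IsTest (Ioo (-l) l) f) :
    -(s * (s + 1) * ω) * ∫ x, f x ^ 2 ≤ ∫ x, innerOp s κ Φ f x * f x := by
  rw [P.integral_innerOp_mul (σ := s) (by ring) hf]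
  have : 0 ≤ ∫ x, lad Φ s f x ^ 2 := integral_nonneg fun x => sq_nonneg _
  linarith

/-- The profile equations give `lad Φ s Φ' = Φ Φ'' - s Φ'² = -s ω`, a constant. Thus orthogonality
of `ladStar Φ s g` to `Φ'` is the mean-zero condition on `g` required by the Poincaré inequality. -/
lemma integral_deriv_mul_ladStar {g : ℝ → ℝ} (hg : IsTest (Ioo (-l) l) g) :
    ∫ x, deriv Φ x * ladStar Φ s g x = -(s * ω) * ∫ x, g x := by
  rw [← integral_const_mul]
  refine integral_eq_of_hasDerivAt_sub (F := fun x => -((Φ x * deriv Φ x) * g x))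
    (hg.mul_left isOpen_Ioo (P.smooth.mul P.smooth_deriv)).neg
    ((P.isTest_ladStar s hg).mul_left isOpen_Ioo P.smooth_deriv) (hg.const_mul _) fun x hx => ?_
  refine (((P.hasDerivAt hx).fun_mul (P.hasDerivAt_deriv hx)).fun_mul
    (hg.hasDerivAt x)).fun_neg.congr_deriv ?_
  rw [ladStar]
  have h1 := P.deriv_sq x hx
  have h2 := P.deriv_deriv x hx
  linear_combination s * g x * h1 - g x * h2

/-- `Φ ^ s` is an eigenfunction, in the weak sense. -/
lemma integral_rpow_mul_innerOp {f : ℝ → ℝ} (hf : IsTest (Ioo (-l) l) f) :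
    ∫ x, Φ x ^ s * innerOp s κ Φ f x = -(s * (s + 1) * ω) * ∫ x, Φ x ^ s * f x := by
  rw [← integral_const_mul]
  have hg := P.isTest_lad s hf
  refine integral_eq_of_hasDerivAt_sub (F := fun x => -(Φ x ^ (s + 1) * lad Φ s f x))
    (hg.mul_left isOpen_Ioo (P.smooth_rpow _)).neg
    ((P.isTest_innerOp hf).mul_left isOpen_Ioo (P.smooth_rpow _))
    ((hf.mul_left isOpen_Ioo (P.smooth_rpow _)).const_mul _) fun x hx => ?_
  refine ((P.hasDerivAt_rpow (s + 1) hx).fun_mul (hg.hasDerivAt x)).fun_neg.congr_deriv ?_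
  rw [P.innerOp_eq (σ := s) (by ring) hf, ladStar, Real.rpow_add_one (P.pos x hx).ne',
    add_sub_cancel_right]
  ring

/-- `Φ'` is in the kernel, in the weak sense. -/
lemma integral_deriv_mul_innerOp {f : ℝ → ℝ} (hf : IsTest (Ioo (-l) l) f) :
    ∫ x, deriv Φ x * innerOp s κ Φ f x = 0 := by
  have hg := P.isTest_lad s hf
  have h1 : ∫ x, lad Φ s f x = ∫ x, -(1 + s) * (deriv Φ x * f x) := by
    refine integral_eq_of_hasDerivAt_sub (F := fun x => Φ x * f x)
      (hf.mul_left isOpen_Ioo P.smooth) hg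
      ((hf.mul_left isOpen_Ioo P.smooth_deriv).const_mul _) fun x hx => ?_
    refine ((P.hasDerivAt hx).fun_mul (hf.hasDerivAt x)).congr_deriv ?_
    rw [lad]; ring
  have e : ∀ x, deriv Φ x * innerOp s κ Φ f x = deriv Φ x * ladStar Φ s (lad Φ s f) x
      - (s * (s + 1) * ω) * (deriv Φ x * f x) := fun x => by
    rw [P.innerOp_eq (σ := s) (by ring) hf]; ring
  simp only [e]
  rw [integral_sub ((P.isTest_ladStar s hg).mul_left isOpen_Ioo P.smooth_deriv).integrable
    ((hf.mul_left isOpen_Ioo P.smooth_deriv).const_mul _).integrable,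
    P.integral_deriv_mul_ladStar hg, h1, integral_const_mul, integral_const_mul]
  ring

/-- Orthogonality to `Φ ^ s` allows `f = ladStar Φ s g`, and orthogonality to `Φ'` gives `∫ g = 0`.
With `k = Φ g'`, `T g = -(Φ² g')'` and `c = s (s + 1) ω`, the intertwining relation yields `‖f‖² =
‖k‖² + c ‖g‖²` and form value `‖T g‖² + c ‖k‖²`. Hardy for `k` and Poincaré for `g` compare these
term by term. -/
lemma gap {f : ℝ → ℝ} (hf : IsTest (Ioo (-l) l) f) (h0 : ∫ x, Φ x ^ s * f x = 0)
    (h1 : ∫ x, deriv Φ x * f x = 0) :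
    min (ω / 4) (ω * s / 2) * ∫ x, f x ^ 2 ≤ ∫ x, innerOp s κ Φ f x * f x := by
  have hδ := P.delta_pos
  obtain ⟨-, g, -, -, hg, -, hgf⟩ := P.exists_ladStar_eq (σ := s) hf h0
  have hg0 : ∫ x, g x = 0 := by
    have h2 := P.integral_deriv_mul_ladStar hg
    simp only [hgf] at h2
    rw [h1, eq_comm, mul_eq_zero] at h2
    exact h2.resolve_left (by have := mul_pos P.s_pos P.ω_pos; linarith)
  have hk := P.isTest_lad 0 hg
  have hLg := P.isTest_ladStar 0 hk
  set c := s * (s + 1) * ω with hc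
  have hcpos : 0 ≤ c := by have := P.s_pos; have := P.ω_pos; positivity
  have hlf : ∀ x, lad Φ s f x = ladStar Φ 0 (lad Φ 0 g) x + c * g x := fun x => by
    rw [← P.lad_ladStar_eq hg, show ladStar Φ s g = f from funext hgf]
  have e1 : ∫ x, f x ^ 2 = (∫ x, lad Φ 0 g x ^ 2) + c * ∫ x, g x ^ 2 := by
    have a1 : ∫ x, f x ^ 2 = ∫ x, g x * lad Φ s f x := by
      rw [← P.integral_ladStar_mul s hf hg]; simp only [hgf, sq]
    rw [a1]
    have a2 : ∀ x, g x * lad Φ s f x = ladStar Φ 0 (lad Φ 0 g) x * g x + c * (g x * g x) :=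
      fun x => by rw [hlf]; ring
    simp only [a2]
    rw [integral_add (hLg.mul hg).integrable ((hg.mul hg).const_mul _).integrable,
      P.integral_ladStar_mul 0 hg hk, integral_const_mul]
    simp only [sq]
  have e2 : ∫ x, lad Φ s f x ^ 2 = (∫ x, ladStar Φ 0 (lad Φ 0 g) x ^ 2)
      + 2 * c * (∫ x, lad Φ 0 g x ^ 2) + c ^ 2 * ∫ x, g x ^ 2 := by
    have a2 : ∀ x, lad Φ s f x ^ 2 = ladStar Φ 0 (lad Φ 0 g) x * ladStar Φ 0 (lad Φ 0 g) x
        + 2 * c * (ladStar Φ 0 (lad Φ 0 g) x * g x) + c ^ 2 * (g x * g x) :=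
      fun x => by rw [hlf]; ring
    simp only [a2]
    rw [integral_add ((hLg.mul hLg).add ((hLg.mul hg).const_mul _)).integrable
        ((hg.mul hg).const_mul _).integrable,
      integral_add (hLg.mul hLg).integrable ((hLg.mul hg).const_mul _).integrable,
      integral_const_mul, integral_const_mul, P.integral_ladStar_mul 0 hg hk]
    simp only [sq]
  rw [P.integral_innerOp_mul (σ := s) (by ring) hf, ← hc, e1, e2]
  have i1 := P.hardy hk
  have i2 := P.poincare hg hg0
  have i3 := mul_le_mul_of_nonneg_left i2 hcpos
  nlinarith

end Profile

end Compacton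

/-! ### Dense range of the shifted operator on the interval -/

namespace Compacton

lemma integral_eq_zero_of_odd {f : ℝ → ℝ} (hf : ∀ x, f (-x) = -f x) : ∫ x, f x = 0 := by
  have h := integral_neg_eq_self f volume
  simp only [hf, integral_neg] at h
  linarith

lemma deriv_neg_of_even {f : ℝ → ℝ} (hf : ∀ x, f (-x) = f x) (x : ℝ) :
    deriv f (-x) = -deriv f x := by
  have h := deriv_comp_neg f (-x)
  rw [neg_neg, show (fun x => f (-x)) = f from funext hf] at h
  exact h

namespace Profile

variable {s ω κ l : ℝ} {Φ : ℝ → ℝ} (P : Profile s ω κ l Φ)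
include P

lemma exists_even_bump : ∃ ρ : ℝ → ℝ, IsTest (Ioo (-l) l) ρ ∧ (∀ x, 0 ≤ ρ x) ∧
    (∀ x, ρ (-x) = ρ x) ∧ ∀ x ∈ Ioo (-(l / 2)) (l / 2), 0 < ρ x := by
  have hl := P.l_pos
  let b : ContDiffBump (0 : ℝ) := ⟨l / 4, l / 2, by linarith, by linarith⟩
  refine ⟨b, ⟨b.contDiff, b.hasCompactSupport, ?_⟩, fun x => b.nonneg, fun x => b.neg x, ?_⟩
  · rw [b.tsupport_eq, Real.closedBall_eq_Icc]
    intro x hx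
    simp only [b, mem_Icc, mem_Ioo] at hx ⊢
    constructor <;> linarith [hx.1, hx.2]
  · intro x hx
    refine b.pos_of_mem_ball ?_
    rw [Real.ball_eq_Ioo]
    simpa [b] using hx

/-- The equation for `Φ'²` gives `|Φ'| ≤ √ω`; apply the mean value theorem up to the zero at `l`. At
most linear vanishing is what makes negative powers of `Φ` non-integrable. -/
lemma le_sqrt_mul {x : ℝ} (hx : x ∈ Ioo 0 l) : Φ x ≤ Real.sqrt ω * (l - x) := by
  obtain ⟨c, hc, hc'⟩ := exists_deriv_eq_slope Φ hx.2 P.cont.continuousOn fun y hy =>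
    (P.hasDerivAt ⟨by linarith [hx.1, hy.1, P.l_pos], hy.2⟩).differentiableAt.differentiableWithinAt
  have hcI : c ∈ Ioo (-l) l := ⟨by linarith [hx.1, hc.1, P.l_pos], hc.2⟩
  have h1 : |deriv Φ c| ≤ Real.sqrt ω := by
    refine Real.abs_le_sqrt ?_
    rw [P.deriv_sq c hcI]
    have := Real.rpow_nonneg (P.pos c hcI).le (2 * s)
    nlinarith [P.κ_pos]
  have hpos : 0 < l - x := by linarith [hx.2]
  rw [P.zero l (by simp), eq_div_iff hpos.ne'] at hc'
  have := (abs_le.1 h1).1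
  nlinarith

/-- A function on the interval with the growth of the second order Euler equation is not square
integrable at the end points. -/
lemma not_integrableOn_rpow {δ : ℝ} (hδ : δ < l) (hδ0 : 0 < δ) :
    ¬ IntegrableOn (fun x => Φ x ^ (-(4 * s + 2))) (Ioo δ l) := by
  intro h
  have hl := P.l_pos
  have hs := P.s_pos
  have hω := Real.sqrt_pos.2 P.ω_pos
  have h1 : IntegrableOn (fun x => (x - l)⁻¹) (Ioo δ l) := by
    refine Integrable.mono' (h.const_mul (Real.sqrt ω * (Real.sqrt ω * l) ^ (4 * s + 1)))
      (by fun_prop) ?_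
    refine (ae_restrict_mem measurableSet_Ioo).mono fun x hx => ?_
    have hxl : 0 < l - x := by linarith [hx.2]
    have hx0 : x ∈ Ioo 0 l := ⟨hδ0.trans hx.1, hx.2⟩
    have hpos := P.pos x ⟨by linarith [hx0.1], hx.2⟩
    have hle := P.le_sqrt_mul hx0
    have e : Φ x ^ (4 * s + 2) = Φ x ^ (4 * s + 1) * Φ x := by
      rw [← Real.rpow_add_one hpos.ne']; ring_nf
    have h2 : Φ x ^ (4 * s + 1) ≤ (Real.sqrt ω * l) ^ (4 * s + 1) :=
      Real.rpow_le_rpow hpos.le (hle.trans (by nlinarith [hx0.1])) (by linarith)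
    have h3 : Φ x ^ (4 * s + 2) ≤ (Real.sqrt ω * l) ^ (4 * s + 1) * (Real.sqrt ω * (l - x)) := by
      rw [e]
      exact mul_le_mul h2 hle hpos.le (by positivity)
    rw [norm_inv, Real.norm_eq_abs, abs_sub_comm, abs_of_pos hxl, Real.rpow_neg hpos.le,
      ← div_eq_mul_inv, inv_eq_one_div, div_le_div_iff₀ hxl (by positivity)]
    linarith
  rw [← intervalIntegrable_iff_integrableOn_Ioo_of_le hδ.le, intervalIntegrable_sub_inv_iff] at h1
  rcases h1 with h1 | h1
  · exact hδ.ne h1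
  · exact h1 right_mem_uIcc

/-- The shifted operator on test functions has dense range. -/
lemma ae_eq_zero_of_orthogonal {u : ℝ → ℂ} (hu : MemLp u 2 volume)
    (h : ∀ f, IsTest (Ioo (-l) l) f →
      ∫ x, (innerOp s κ Φ f x + (2 * s + 1) * (2 * s) * ω * f x) • u x = 0) :
    ∀ᵐ x, x ∈ Ioo (-l) l → u x = 0 := by
  have hl := P.l_pos
  have hs := P.s_pos
  have huloc : LocallyIntegrable u := hu.locallyIntegrable (by norm_num)
  have hint : ∀ {k}, IsTest (Ioo (-l) l) k → Integrable (fun x => k x • u x) := fun hk =>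
    huloc.integrable_smul_left_of_hasCompactSupport hk.continuous hk.compact
  -- The other root of the factorization condition: here `σ (σ + 1) ω` equals the shift, so the
  -- shifted operator is a pure product of first-order operators.
  obtain ⟨σ, hσ⟩ : ∃ σ, σ = -(2 * s + 1) := ⟨_, rfl⟩
  have hσeq : σ * (σ + 1 + s) = s * (2 * s + 1) := by rw [hσ]; ring
  -- the second solution
  have hcont : Continuous fun x => Φ x ^ (4 * s) :=
    P.cont.rpow_const fun x => Or.inr (by linarith)
  let J : ℝ → ℝ := fun x => ∫ t in (0 : ℝ)..x, Φ t ^ (4 * s)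
  have hJ : ∀ x, HasDerivAt J (Φ x ^ (4 * s)) x := fun x =>
    intervalIntegral.integral_hasDerivAt_right (hcont.intervalIntegrable _ _)
      hcont.stronglyMeasurable.stronglyMeasurableAtFilter hcont.continuousAt
  have hJodd : ∀ x, J (-x) = -J x := by
    intro x
    have := intervalIntegral.integral_comp_neg (a := 0) (b := x) (fun t => Φ t ^ (4 * s))
    simp only [P.even, neg_zero] at this
    simp only [J]
    rw [this, intervalIntegral.integral_symm]
  have hJpos : ∀ x ∈ Ioo 0 l, 0 < J x := fun x hx =>
    intervalIntegral.intervalIntegral_pos_of_pos_on (hcont.intervalIntegrable _ _)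
      (fun t ht => Real.rpow_pos_of_pos (P.pos t ⟨by linarith [ht.1], ht.2.trans hx.2⟩) _) hx.1
  have hJmono : Monotone J := monotone_of_deriv_nonneg (fun x => (hJ x).differentiableAt)
    fun x => by
      rw [(hJ x).deriv]
      refine Real.rpow_nonneg ?_ _
      by_cases hx : x ∈ Ioo (-l) l
      · exact (P.pos x hx).le
      · exact (P.zero x hx).ge
  have hJsm : ContDiffOn ℝ ∞ J (Ioo (-l) l) := by
    rw [contDiffOn_infty_iff_deriv_of_isOpen isOpen_Ioo]
    refine ⟨fun x _ => (hJ x).differentiableAt.differentiableWithinAt, ?_⟩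
    rw [show deriv J = fun x => Φ x ^ (4 * s) from funext fun x => (hJ x).deriv]
    exact P.smooth_rpow _
  have hψ := P.smooth_rpow σ
  have hJψ : ContDiffOn ℝ ∞ (fun x => J x * Φ x ^ σ) (Ioo (-l) l) := hJsm.mul hψ
  -- The first condition solves `ladStar Φ σ g = k`. After an integration by parts the second is the
  -- condition for solving `lad Φ σ f = g`.
  have hrange : ∀ k, IsTest (Ioo (-l) l) k → ∫ x, Φ x ^ σ * k x = 0 →
      ∫ x, J x * Φ x ^ σ * k x = 0 → ∫ x, k x • u x = 0 := by
    intro k hk h0 h1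
    obtain ⟨F, g, hF, hF', hg, hgF, hgk⟩ := P.exists_ladStar_eq hk h0
    have hJF : IsTest (Ioo (-l) l) fun x => J x * F x := hF.mul_left isOpen_Ioo hJsm
    have e : ∀ x ∈ Ioo (-l) l, Φ x ^ (-(1 + σ)) * g x = -(Φ x ^ (4 * s) * F x) := by
      intro x hx
      have : Φ x ^ (4 * s) = Φ x ^ (-(1 + σ)) * Φ x ^ (-(1 + σ)) := by
        rw [← Real.rpow_add (P.pos x hx), hσ]; ring_nf
      rw [hgF, this]; ring
    have h2 : ∫ x, Φ x ^ (-(1 + σ)) * g x = ∫ x, J x * Φ x ^ σ * k x := by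
      refine integral_eq_of_hasDerivAt_sub hJF.neg (hg.mul_left isOpen_Ioo (P.smooth_rpow _))
        (hk.mul_left isOpen_Ioo hJψ) fun x hx => ?_
      refine ((hJ x).fun_mul (hF' x)).fun_neg.congr_deriv ?_
      rw [e x hx]; ring
    obtain ⟨f, hf, hfg⟩ := P.exists_lad_eq hg (h2.trans h1)
    have h3 := h f hf
    have h4 : ∀ x, innerOp s κ Φ f x + (2 * s + 1) * (2 * s) * ω * f x = k x := by
      intro x
      rw [P.innerOp_eq hσeq hf, show lad Φ σ f = g from funext hfg, hgk, hσ]; ring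
    simpa only [h4] using h3
  -- The two solutions have opposite parity, so weighting them by an even bump gives test functions
  -- with a diagonal Gram matrix against the solutions.
  obtain ⟨ρ, hρ, hρ0, hρe, hρpos⟩ := P.exists_even_bump
  have hk1 : IsTest (Ioo (-l) l) fun x => Φ x ^ σ * ρ x := hρ.mul_left isOpen_Ioo hψ
  have hk2 : IsTest (Ioo (-l) l) fun x => J x * Φ x ^ σ * ρ x := hρ.mul_left isOpen_Ioo hJψ
  have h11 : 0 < ∫ x, Φ x ^ σ * (Φ x ^ σ * ρ x) := by
    refine (hk1.mul_left isOpen_Ioo hψ).continuous.integral_pos_of_hasCompactSupport_nonneg_nonzero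
      (hk1.mul_left isOpen_Ioo hψ).compact (fun x => ?_) (x := 0) ?_
    · simp only [Pi.zero_apply]
      rw [← mul_assoc]
      exact mul_nonneg (mul_self_nonneg _) (hρ0 x)
    · have := P.pos 0 ⟨by linarith, hl⟩
      have := hρpos 0 ⟨by linarith, by linarith⟩
      positivity
  have h22 : 0 < ∫ x, J x * Φ x ^ σ * (J x * Φ x ^ σ * ρ x) := by
    refine (hk2.mul_left isOpen_Ioo hJψ).continuous.integral_pos_of_hasCompactSupport_nonneg_nonzero
      (hk2.mul_left isOpen_Ioo hJψ).compact (fun x => ?_) (x := l / 4) ?_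
    · simp only [Pi.zero_apply]
      rw [← mul_assoc]
      exact mul_nonneg (mul_self_nonneg _) (hρ0 x)
    · have := P.pos (l / 4) ⟨by linarith, by linarith⟩
      have := hρpos (l / 4) ⟨by linarith, by linarith⟩
      have := hJpos (l / 4) ⟨by linarith, by linarith⟩
      positivity
  have h12 : ∫ x, Φ x ^ σ * (J x * Φ x ^ σ * ρ x) = 0 :=
    integral_eq_zero_of_odd fun x => by rw [hJodd, P.even, hρe]; ring
  have h21 : ∫ x, J x * Φ x ^ σ * (Φ x ^ σ * ρ x) = 0 :=
    integral_eq_zero_of_odd fun x => by rw [hJodd, P.even, hρe]; ring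
  obtain ⟨N1, hN1⟩ : ∃ N1, ∫ x, Φ x ^ σ * (Φ x ^ σ * ρ x) = N1 := ⟨_, rfl⟩
  obtain ⟨N2, hN2⟩ : ∃ N2, ∫ x, J x * Φ x ^ σ * (J x * Φ x ^ σ * ρ x) = N2 := ⟨_, rfl⟩
  rw [hN1] at h11
  rw [hN2] at h22
  obtain ⟨A, hA⟩ : ∃ A : ℂ, A = N1⁻¹ • ∫ x, (Φ x ^ σ * ρ x) • u x := ⟨_, rfl⟩
  obtain ⟨B, hB⟩ : ∃ B : ℂ, B = N2⁻¹ • ∫ x, (J x * Φ x ^ σ * ρ x) • u x := ⟨_, rfl⟩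
  -- A functional vanishing on all test functions orthogonal to the two solutions is a combination
  -- of them.
  have hae : ∀ᵐ x, x ∈ Ioo (-l) l → u x - (Φ x ^ σ • A + (J x * Φ x ^ σ) • B) = 0 := by
    have hcψ : ContinuousOn (fun x => Φ x ^ σ • A + (J x * Φ x ^ σ) • B) (Ioo (-l) l) :=
      (hψ.continuousOn.smul continuousOn_const).add (hJψ.continuousOn.smul continuousOn_const)
    refine isOpen_Ioo.ae_eq_zero_of_integral_contDiff_smul_eq_zero
      ((huloc.locallyIntegrableOn _).sub (hcψ.locallyIntegrableOn measurableSet_Ioo)) ?_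
    intro k hk1' hk2' hk3'
    have hk : IsTest (Ioo (-l) l) k := ⟨hk1', hk2', hk3'⟩
    set a := (∫ x, Φ x ^ σ * k x) * N1⁻¹ with ha
    set b := (∫ x, J x * Φ x ^ σ * k x) * N2⁻¹ with hb
    have t0 := hk.mul_left isOpen_Ioo hψ
    have t1 := hk1.mul_left isOpen_Ioo hψ
    have t2 := hk2.mul_left isOpen_Ioo hψ
    have r0 := hk.mul_left isOpen_Ioo hJψ
    have r1 := hk1.mul_left isOpen_Ioo hJψ
    have r2 := hk2.mul_left isOpen_Ioo hJψ
    have hk' := (hk.sub (hk1.const_mul a)).sub (hk2.const_mul b)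
    have i1 := hrange _ hk' (by
      have e : ∀ x, Φ x ^ σ * (k x - a * (Φ x ^ σ * ρ x) - b * (J x * Φ x ^ σ * ρ x))
          = Φ x ^ σ * k x - a * (Φ x ^ σ * (Φ x ^ σ * ρ x))
            - b * (Φ x ^ σ * (J x * Φ x ^ σ * ρ x)) := fun x => by ring
      simp only [e]
      rw [integral_sub (t0.sub (t1.const_mul a)).integrable (t2.const_mul b).integrable,
        integral_sub t0.integrable (t1.const_mul a).integrable, integral_const_mul,
        integral_const_mul, h12, hN1, ha, mul_assoc, inv_mul_cancel₀ h11.ne']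
      ring) (by
      have e : ∀ x, J x * Φ x ^ σ * (k x - a * (Φ x ^ σ * ρ x) - b * (J x * Φ x ^ σ * ρ x))
          = J x * Φ x ^ σ * k x - a * (J x * Φ x ^ σ * (Φ x ^ σ * ρ x))
            - b * (J x * Φ x ^ σ * (J x * Φ x ^ σ * ρ x)) := fun x => by ring
      simp only [e]
      rw [integral_sub (r0.sub (r1.const_mul a)).integrable (r2.const_mul b).integrable,
        integral_sub r0.integrable (r1.const_mul a).integrable, integral_const_mul,
        integral_const_mul, h21, hN2, hb, mul_assoc _ N2⁻¹, inv_mul_cancel₀ h22.ne']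
      ring)
    have e1 : ∀ x, (k x - a * (Φ x ^ σ * ρ x) - b * (J x * Φ x ^ σ * ρ x)) • u x
        = k x • u x - a • (Φ x ^ σ * ρ x) • u x - b • (J x * Φ x ^ σ * ρ x) • u x := fun x => by
      simp only [smul_smul, sub_smul]
    simp only [e1] at i1
    have j1 : Integrable fun x => k x • u x - a • (Φ x ^ σ * ρ x) • u x :=
      (hint hk).sub ((hint hk1).smul a)
    have j2 : Integrable fun x => k x • u x - (Φ x ^ σ * k x) • A :=
      (hint hk).sub (t0.integrable.smul_const A)
    rw [integral_sub j1 ((hint hk2).fun_smul b),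
      integral_sub (hint hk) ((hint hk1).fun_smul a), integral_smul, integral_smul] at i1
    have e2 : ∀ x, k x • (u x - (Φ x ^ σ • A + (J x * Φ x ^ σ) • B))
        = k x • u x - (Φ x ^ σ * k x) • A - (J x * Φ x ^ σ * k x) • B := fun x => by
      rw [smul_sub, smul_add, smul_smul, smul_smul, sub_sub, mul_comm (k x), mul_comm (k x)]
    simp only [e2]
    rw [integral_sub j2 (r0.integrable.smul_const B),
      integral_sub (hint hk) (t0.integrable.smul_const A), integral_smul_const,
      integral_smul_const, hA, hB, smul_smul, smul_smul]
    exact i1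
  -- square integrability forces both coefficients to vanish
  have hAB : A = 0 ∧ B = 0 := by
    by_contra hne
    set m := ‖A‖ ^ 2 + ‖B‖ ^ 2 * J (l / 2) ^ 2 with hm
    have hJl : 0 < J (l / 2) := hJpos _ ⟨by linarith, by linarith⟩
    have hmpos : 0 < m := by
      rcases not_and_or.1 hne with h | h
      · have := norm_pos_iff.2 h
        positivity
      · have := norm_pos_iff.2 h
        positivity
    have hsq : Integrable (fun x => ‖u x‖ ^ 2) := hu.integrable_norm_pow (by norm_num)
    have hsum : Integrable (fun x => ‖u x‖ ^ 2 + ‖u (-x)‖ ^ 2) := hsq.add hsq.comp_neg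
    refine P.not_integrableOn_rpow (δ := l / 2) (by linarith) (by linarith) ?_
    refine Integrable.mono' ((hsum.integrableOn (s := Ioo (l / 2) l)).const_mul (2 * m)⁻¹) ?_ ?_
    · refine ContinuousOn.aestronglyMeasurable ?_ measurableSet_Ioo
      exact (P.smooth_rpow _).continuousOn.mono
        (Ioo_subset_Ioo (by linarith) le_rfl)
    · have hae' : ∀ᵐ x, -x ∈ Ioo (-l) l → u (-x) - (Φ (-x) ^ σ • A + (J (-x) * Φ (-x) ^ σ) • B) = 0 :=
        (Measure.measurePreserving_neg (volume : Measure ℝ)).quasiMeasurePreserving.ae hae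
      filter_upwards [ae_restrict_mem measurableSet_Ioo, ae_restrict_of_ae hae,
        ae_restrict_of_ae hae'] with x hx h1 h2
      have hxI : x ∈ Ioo (-l) l := ⟨by linarith [hx.1], hx.2⟩
      have hxI' : -x ∈ Ioo (-l) l := ⟨by linarith [hx.2], by linarith [hx.1]⟩
      have hpos := P.pos x hxI
      have e1 : u x = Φ x ^ σ • (A + J x • B) := by
        rw [sub_eq_zero.1 (h1 hxI), smul_add, smul_smul, mul_comm (J x)]
      have e2 : u (-x) = Φ x ^ σ • (A - J x • B) := by
        rw [sub_eq_zero.1 (h2 hxI'), hJodd, P.even, smul_sub, smul_smul, mul_comm (-J x),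
          mul_neg, neg_smul, sub_eq_add_neg]
      -- As `J` is odd, adding the values at `x` and `-x` removes the cross term. What remains is at
      -- least a positive multiple of `Φ ^ (-(4s + 2))` near `l`, whichever coefficient is nonzero.
      have hpar := parallelogram_law_with_norm ℝ A (J x • B)
      rw [norm_smul, Real.norm_eq_abs] at hpar
      have e3 : ‖u x‖ ^ 2 + ‖u (-x)‖ ^ 2 =
          Φ x ^ (-(4 * s + 2)) * (2 * (‖A‖ ^ 2 + ‖B‖ ^ 2 * J x ^ 2)) := by
        have : Φ x ^ (-(4 * s + 2)) = (Φ x ^ σ) ^ 2 := by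
          rw [← Real.rpow_natCast, ← Real.rpow_mul hpos.le, hσ]; congr 1; push_cast; ring
        rw [e1, e2, norm_smul, norm_smul, this, Real.norm_eq_abs, mul_pow, mul_pow, sq_abs,
          ← mul_add, ← sq_abs (J x)]
        congr 1
        linarith
      have hJx : J (l / 2) ^ 2 ≤ J x ^ 2 := by
        have := hJmono hx.1.le
        nlinarith
      have hΦp : 0 < Φ x ^ (-(4 * s + 2)) := Real.rpow_pos_of_pos hpos _
      rw [Real.norm_eq_abs, abs_of_pos hΦp, inv_mul_eq_div, le_div_iff₀ (by positivity), e3]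
      refine mul_le_mul_of_nonneg_left ?_ hΦp.le
      rw [hm]
      nlinarith [mul_le_mul_of_nonneg_left hJx (sq_nonneg ‖B‖)]
  filter_upwards [hae] with x hx hxI
  simpa [hAB.1, hAB.2] using hx hxI

end Profile

end Compacton

/-! ### The variational problem in terms of the square of the profile -/

namespace Compacton

section Variations

/-- Squares of admissible functions. -/
structure AdmissibleSq (f : ℝ → ℝ) : Prop where
  cont : Continuous f
  nonneg : ∀ x, 0 ≤ f x
  integrable : Integrable f
  absCont : ∀ a b : ℝ, AbsolutelyContinuousOnInterval f a b
  memLp_deriv : MemLp (deriv f) 2 volume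

lemma ae_differentiableAt_of_absCont {f : ℝ → ℝ}
    (hf : ∀ a b : ℝ, AbsolutelyContinuousOnInterval f a b) : ∀ᵐ x, DifferentiableAt ℝ f x := by
  have h : ∀ n : ℕ, ∀ᵐ x, x ∈ uIcc (-(n : ℝ)) n → DifferentiableAt ℝ f x := fun n =>
    (hf _ _).ae_differentiableAt
  filter_upwards [ae_all_iff.2 h] with x hx
  obtain ⟨n, hn⟩ := exists_nat_ge |x|
  refine hx n ?_
  rw [uIcc_of_le (by linarith [abs_nonneg x])]
  exact abs_le.1 hn

/-- Where `u` vanishes, `u ^ 2` has a minimum and both sides are zero; elsewhere `u` is locally plus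
or minus the square root of `u ^ 2`, hence differentiable. -/
lemma mul_deriv_eq {u : ℝ → ℝ} (hu : Continuous u) {x : ℝ}
    (hd : DifferentiableAt ℝ (fun y => u y ^ 2) x) :
    u x * deriv u x = deriv (fun y => u y ^ 2) x / 2 := by
  by_cases hx : u x = 0
  · have hmin : IsLocalMin (fun y => u y ^ 2) x :=
      Filter.Eventually.of_forall fun y => by
        simp only [hx, ne_eq, OfNat.ofNat_ne_zero, not_false_eq_true, zero_pow]
        exact sq_nonneg _
    rw [hmin.deriv_eq_zero, hx]
    simp
  · have hdu : DifferentiableAt ℝ u x := by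
      rcases lt_or_gt_of_ne hx with h | h
      · have he : (fun y => -Real.sqrt (u y ^ 2)) =ᶠ[nhds x] u := by
          filter_upwards [hu.continuousAt.eventually_lt continuousAt_const h] with y hy
          rw [Real.sqrt_sq_eq_abs, abs_of_neg hy, neg_neg]
        exact ((hd.sqrt (by positivity)).neg).congr_of_eventuallyEq he.symm
      · have he : (fun y => Real.sqrt (u y ^ 2)) =ᶠ[nhds x] u := by
          filter_upwards [hu.continuousAt.eventually_const_lt h] with y hy
          rw [Real.sqrt_sq hy.le]
        exact (hd.sqrt (by positivity)).congr_of_eventuallyEq he.symm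
    rw [(hdu.hasDerivAt.fun_pow 2).deriv]
    simp
    ring

lemma Admissible.mul_deriv_ae_eq {u : ℝ → ℝ} (hu : Admissible u) :
    (fun x => u x * deriv u x) =ᵐ[volume] fun x => deriv (fun y => u y ^ 2) x / 2 := by
  filter_upwards [ae_differentiableAt_of_absCont hu.absCont] with x hx
  exact mul_deriv_eq hu.continuous hx

lemma Admissible.sq {u : ℝ → ℝ} (hu : Admissible u) : AdmissibleSq (fun x => u x ^ 2) := by
  refine ⟨hu.continuous.pow 2, fun x => sq_nonneg _, ?_, hu.absCont, ?_⟩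
  · exact hu.memLp.integrable_sq
  · have h := hu.memLp_deriv.const_mul 2
    refine h.ae_eq ?_
    filter_upwards [hu.mul_deriv_ae_eq] with x hx
    rw [hx]; ring

lemma AdmissibleSq.sqrt {f : ℝ → ℝ} (hf : AdmissibleSq f) :
    Admissible (fun x => Real.sqrt (f x)) := by
  have hsq : (fun x => Real.sqrt (f x) ^ 2) = f := funext fun x => Real.sq_sqrt (hf.nonneg x)
  have hc : Continuous fun x => Real.sqrt (f x) := hf.cont.sqrt
  refine ⟨hc, ?_, fun a b => by rw [hsq]; exact hf.absCont a b, ?_⟩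
  · rw [memLp_two_iff_integrable_sq hc.aestronglyMeasurable, hsq]
    exact hf.integrable
  · refine (hf.memLp_deriv.const_mul (1 / 2)).ae_eq ?_
    filter_upwards [ae_differentiableAt_of_absCont hf.absCont] with x hx
    have := mul_deriv_eq hc (x := x) (by rwa [hsq])
    rw [hsq] at this
    rw [this]; ring

lemma Admissible.energy_eq {u : ℝ → ℝ} (hu : Admissible u) (ω : ℝ) :
    energy ω u = (1 / 4) * (∫ x, deriv (fun y => u y ^ 2) x ^ 2) + ω * ∫ x, u x ^ 2 := by
  have h : ∫ x, |u x * deriv u x| ^ 2 = ∫ x, 1 / 4 * deriv (fun y => u y ^ 2) x ^ 2 := by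
    refine integral_congr_ae ?_
    filter_upwards [hu.mul_deriv_ae_eq] with x hx
    rw [sq_abs, hx]; ring
  simp only [energy, sq_abs] at h ⊢
  rw [h, integral_const_mul]

variable {ω p : ℝ} {Φ : ℝ → ℝ}

lemma IsConstrainedMinimizer.le_of_sq (hmin : IsConstrainedMinimizer ω p Φ) {f : ℝ → ℝ}
    (hf : AdmissibleSq f) (h1 : ∫ x, f x ^ (p / 2) = 1) :
    energy ω Φ ≤ (1 / 4) * (∫ x, deriv f x ^ 2) + ω * ∫ x, f x := by
  have hsq : (fun x => Real.sqrt (f x) ^ 2) = f := funext fun x => Real.sq_sqrt (hf.nonneg x)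
  have h := hmin.le _ hf.sqrt (by
    rw [← h1]
    congr 1
    funext x
    rw [abs_of_nonneg (Real.sqrt_nonneg _), Real.sqrt_eq_rpow, ← Real.rpow_mul (hf.nonneg x)]
    ring_nf)
  rw [hf.sqrt.energy_eq, hsq] at h
  simpa only [Real.sq_sqrt (hf.nonneg _)] using h

lemma AdmissibleSq.const_mul {f : ℝ → ℝ} (hf : AdmissibleSq f) {c : ℝ} (hc : 0 ≤ c) :
    AdmissibleSq (fun x => c * f x) := by
  refine ⟨continuous_const.mul hf.cont, fun x => mul_nonneg hc (hf.nonneg x),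
    hf.integrable.const_mul c, fun a b => (hf.absCont a b).const_mul c, ?_⟩
  rw [show deriv (fun x => c * f x) = fun x => c * deriv f x from
    funext fun x => deriv_const_mul_field c]
  exact hf.memLp_deriv.const_mul c

/-- Multiplying `f` by the power `-2/p` of its constraint integral normalizes it, so competitors
need not satisfy the constraint. -/
lemma IsConstrainedMinimizer.le_of_integral_pos (hp : 2 < p)
    (hmin : IsConstrainedMinimizer ω p Φ) {f : ℝ → ℝ}
    (hf : AdmissibleSq f) (hG : 0 < ∫ x, f x ^ (p / 2)) :
    energy ω Φ ≤ (∫ x, f x ^ (p / 2)) ^ (-(4 / p)) * ((1 / 4) * ∫ x, deriv f x ^ 2)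
      + ω * ((∫ x, f x ^ (p / 2)) ^ (-(2 / p)) * ∫ x, f x) := by
  obtain ⟨G, hGe⟩ : ∃ G, ∫ x, f x ^ (p / 2) = G := ⟨_, rfl⟩
  rw [hGe] at hG ⊢
  have hc : 0 ≤ G ^ (-(2 / p)) := Real.rpow_nonneg hG.le _
  have hp0 : p ≠ 0 := by linarith
  have h := hmin.le_of_sq (hf.const_mul hc) (by
    simp only [Real.mul_rpow hc (hf.nonneg _)]
    rw [integral_const_mul, hGe, ← Real.rpow_mul hG.le]
    rw [show -(2 / p) * (p / 2) = -1 by field_simp, Real.rpow_neg_one]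
    exact inv_mul_cancel₀ hG.ne')
  rw [show deriv (fun x => G ^ (-(2 / p)) * f x) = fun x => G ^ (-(2 / p)) * deriv f x from
    funext fun x => deriv_const_mul_field _] at h
  simp only [mul_pow] at h
  rw [integral_const_mul, integral_const_mul, ← Real.rpow_natCast, ← Real.rpow_mul hG.le] at h
  rw [show -(2 / p) * ((2 : ℕ) : ℝ) = -(4 / p) by push_cast; ring] at h
  linarith

lemma AdmissibleSq.comp_mul {f : ℝ → ℝ} (hf : AdmissibleSq f) {t : ℝ} (ht : 0 < t) :
    AdmissibleSq (fun x => f (t * x)) := by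
  have hd : deriv (fun x => f (t * x)) = fun x => t * deriv f (t * x) :=
    funext fun x => by rw [deriv_comp_mul_left]; rfl
  refine ⟨hf.cont.comp (by fun_prop), fun x => hf.nonneg _, hf.integrable.comp_mul_left' ht.ne',
    fun a b => ?_, ?_⟩
  · have hi : IntervalIntegrable (fun x => deriv f (t * x)) volume a b := by
      have := ((hf.absCont (t * a) (t * b)).intervalIntegrable_deriv).comp_mul_left (c := t)
      simpa [ht.ne'] using this
    -- Absolute continuity of the dilate is obtained by recognizing it as the integral of its
    -- derivative.
    have h1 := (hi.absolutelyContinuousOnInterval_intervalIntegral (c := a) (by simp)).const_mul t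
    have h2 : AbsolutelyContinuousOnInterval (fun _ : ℝ => f (t * a)) a b :=
      ContDiffOn.absolutelyContinuousOnInterval contDiffOn_const
    have h3 := h2.fun_add h1
    have e : (fun x => f (t * a) + t * ∫ y in a..x, deriv f (t * y)) = fun x => f (t * x) := by
      funext x
      rw [intervalIntegral.integral_comp_mul_left _ ht.ne',
        (hf.absCont (t * a) (t * x)).integral_deriv_eq_sub, smul_eq_mul]
      field_simp
      ring
    rwa [e] at h3
  · rw [hd]
    have hm : AEStronglyMeasurable (fun x => t * deriv f (t * x)) volume :=
      ((measurable_deriv f).comp (measurable_const_mul t)).const_mul t |>.aestronglyMeasurable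
    rw [memLp_two_iff_integrable_sq hm]
    have := ((hf.memLp_deriv.integrable_sq).comp_mul_left' ht.ne').const_mul (t ^ 2)
    refine this.congr (Filter.Eventually.of_forall fun x => ?_)
    simp only; ring

variable (hp : 2 < p) (hω : 0 < ω) (hΦ0 : ∀ x, 0 ≤ Φ x) (hmin : IsConstrainedMinimizer ω p Φ)
include hp hmin

include hΦ0 in
omit hp in
lemma integral_sq_rpow : ∫ x, (Φ x ^ 2) ^ (p / 2) = 1 := by
  rw [← hmin.constraint]
  congr 1
  funext x
  rw [← Real.rpow_natCast, ← Real.rpow_mul (hΦ0 x), abs_of_nonneg (hΦ0 x)]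
  congr 1
  push_cast; ring

omit hp in
lemma multiplier_eq : multiplier ω Φ =
    2 * ((1 / 4) * ∫ x, deriv (fun y => Φ y ^ 2) x ^ 2) + ω * ∫ x, Φ x ^ 2 := by
  have h : ∫ x, (Φ x * deriv Φ x) ^ 2 = ∫ x, 1 / 4 * deriv (fun y => Φ y ^ 2) x ^ 2 := by
    refine integral_congr_ae ?_
    filter_upwards [hmin.admissible.mul_deriv_ae_eq] with x hx
    rw [hx]; ring
  rw [multiplier, h, integral_const_mul]

include hΦ0 in
/-- The virial identity obtained from dilations. -/
lemma virial : (1 / 4) * (∫ x, deriv (fun y => Φ y ^ 2) x ^ 2) - ω * (∫ x, Φ x ^ 2)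
    + 2 * multiplier ω Φ / p = 0 := by
  have hp0 : p ≠ 0 := by linarith
  have hv := hmin.admissible.sq
  have hG := integral_sq_rpow hΦ0 hmin
  rw [multiplier_eq hmin]
  have hE := hmin.admissible.energy_eq ω
  obtain ⟨K, hK⟩ : ∃ K, (1 / 4) * ∫ x, deriv (fun y => Φ y ^ 2) x ^ 2 = K := ⟨_, rfl⟩
  obtain ⟨M, hM⟩ : ∃ M, ∫ x, Φ x ^ 2 = M := ⟨_, rfl⟩
  rw [hK, hM] at hE ⊢
  -- Energy of the normalized dilate `v (t x)`: its constraint integral is `1/t`, the gradient term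
  -- scales by `t` and the mass by `1/t`.
  let g : ℝ → ℝ := fun t => t ^ (4 / p + 1) * K + ω * (t ^ (2 / p - 1) * M)
  have hloc : IsLocalMin g 1 := by
    filter_upwards [lt_mem_nhds (show (0 : ℝ) < 1 by norm_num)] with t ht
    have hGt : ∫ x, (fun x => Φ (t * x) ^ 2) x ^ (p / 2) = t⁻¹ := by
      have := Measure.integral_comp_mul_left (fun x => (Φ x ^ 2) ^ (p / 2)) t
      rw [hG, abs_of_pos (inv_pos.2 ht), smul_eq_mul, mul_one] at this
      exact this
    have h := hmin.le_of_integral_pos hp (hv.comp_mul ht) (by rw [hGt]; exact inv_pos.2 ht)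
    rw [hGt] at h
    have hd : ∫ x, deriv (fun x => Φ (t * x) ^ 2) x ^ 2
        = t * ∫ x, deriv (fun x => Φ x ^ 2) x ^ 2 := by
      have e : ∀ x, deriv (fun x => Φ (t * x) ^ 2) x ^ 2
          = t ^ 2 * (fun z => deriv (fun x => Φ x ^ 2) z ^ 2) (t * x) := fun x => by
        rw [deriv_comp_mul_left t (fun x => Φ x ^ 2)]; simp only [smul_eq_mul]; ring
      simp only [e]
      rw [integral_const_mul, Measure.integral_comp_mul_left
        (fun z => deriv (fun x => Φ x ^ 2) z ^ 2) t, abs_of_pos (inv_pos.2 ht), smul_eq_mul]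
      field_simp
    have hm : ∫ x, Φ (t * x) ^ 2 = t⁻¹ * M := by
      have := Measure.integral_comp_mul_left (fun x => Φ x ^ 2) t
      rwa [hM, abs_of_pos (inv_pos.2 ht), smul_eq_mul] at this
    rw [hd, hm, hE] at h
    have e1 : t⁻¹ ^ (-(4 / p)) * (1 / 4 * (t * ∫ x, deriv (fun x => Φ x ^ 2) x ^ 2))
        = t ^ (4 / p + 1) * K := by
      rw [Real.rpow_neg (inv_pos.2 ht).le, Real.inv_rpow ht.le, inv_inv,
        Real.rpow_add_one ht.ne', ← hK]
      ring
    have e2 : t⁻¹ ^ (-(2 / p)) * (t⁻¹ * M) = t ^ (2 / p - 1) * M := by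
      rw [Real.rpow_neg (inv_pos.2 ht).le, Real.inv_rpow ht.le, inv_inv,
        Real.rpow_sub_one ht.ne']
      ring
    rw [e1, e2] at h
    simpa [g] using h
  have hder : HasDerivAt g ((4 / p + 1) * K + ω * ((2 / p - 1) * M)) 1 := by
    have h1 := ((Real.hasDerivAt_rpow_const (x := 1) (p := 4 / p + 1)
      (Or.inl one_ne_zero)).mul_const K)
    have h2 := ((Real.hasDerivAt_rpow_const (x := 1) (p := 2 / p - 1)
      (Or.inl one_ne_zero)).mul_const M).const_mul ω
    have := h1.fun_add h2
    simpa using this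
  have h0 := hloc.hasDerivAt_eq_zero hder
  field_simp at h0 ⊢
  linarith

omit hp hmin in
-- The tangent line bound for a convex power. It linearizes the constraint from below, so no
-- differentiation under the integral is needed.
lemma bernoulli_rpow {a b r : ℝ} (ha : 0 < a) (hab : 0 ≤ a + b) (hr : 1 ≤ r) :
    a ^ r + r * (a ^ (r - 1) * b) ≤ (a + b) ^ r := by
  have h := one_add_mul_self_le_rpow_one_add (s := b / a) (p := r) (by
    rw [le_div_iff₀ ha]; linarith) hr
  have e : a + b = a * (1 + b / a) := by field_simp
  have e2 : 0 ≤ 1 + b / a := by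
    by_contra! h
    have := mul_neg_of_pos_of_neg ha h
    linarith
  rw [e, Real.mul_rpow ha.le e2]
  have h3 := mul_le_mul_of_nonneg_left h (Real.rpow_nonneg ha.le r)
  refine le_trans (le_of_eq ?_) h3
  rw [Real.rpow_sub_one ha.ne']
  ring

include hΦ0 hω in
/-- The weak Euler-Lagrange equation. -/
lemma weak_equation {η : ℝ → ℝ} (hη : IsTest (Function.support Φ) η) :
    (1 / 2) * (∫ x, deriv (fun y => Φ y ^ 2) x * deriv η x) + ω * (∫ x, η x)
      - multiplier ω Φ * ∫ x, (Φ x ^ 2) ^ (p / 2 - 1) * η x = 0 := by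
  have hp0 : p ≠ 0 := by linarith
  have hr : 1 ≤ p / 2 := by linarith
  have hv := hmin.admissible.sq
  have hG := integral_sq_rpow hΦ0 hmin
  rw [multiplier_eq hmin]
  have hE := hmin.admissible.energy_eq ω
  have hvpos : ∀ x ∈ Function.support Φ, 0 < Φ x ^ 2 := fun x hx => by
    have : Φ x ≠ 0 := hx
    positivity
  generalize hvdef : (fun y => Φ y ^ 2) = v at *
  have hvx : ∀ x, Φ x ^ 2 = v x := fun x => by rw [← hvdef]
  simp only [hvx] at *
  obtain ⟨K, hK⟩ : ∃ K, (1 / 4) * ∫ x, deriv v x ^ 2 = K := ⟨_, rfl⟩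
  obtain ⟨M, hM⟩ : ∃ M, ∫ x, v x = M := ⟨_, rfl⟩
  obtain ⟨b, hb⟩ : ∃ b, ∫ x, v x ^ (p / 2 - 1) * η x = b := ⟨_, rfl⟩
  obtain ⟨k1, hk1⟩ : ∃ k1, (1 / 2) * ∫ x, deriv v x * deriv η x = k1 := ⟨_, rfl⟩
  obtain ⟨m1, hm1⟩ : ∃ m1, ∫ x, η x = m1 := ⟨_, rfl⟩
  obtain ⟨k2, hk2⟩ : ∃ k2, (1 / 4) * ∫ x, deriv η x ^ 2 = k2 := ⟨_, rfl⟩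
  rw [hK, hM] at hE ⊢
  rw [hb, hk1, hm1]
  have hcont1 : Continuous fun x => v x ^ (p / 2) :=
    hv.cont.rpow_const fun x => Or.inr (by linarith)
  have hcont2 : Continuous fun x => v x ^ (p / 2 - 1) :=
    hv.cont.rpow_const fun x => Or.inr (by linarith)
  have hbint : Integrable fun x => v x ^ (p / 2 - 1) * η x :=
    (hcont2.mul hη.continuous).integrable_of_hasCompactSupport hη.compact.mul_left
  have hGint : Integrable fun x => v x ^ (p / 2) := by
    by_contra h
    rw [integral_undef h] at hG
    exact zero_ne_one hG
  -- An explicit upper bound for the normalized energy of `v + ε η`: the constraint integral, which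
  -- carries negative powers, is replaced by its tangent lower bound. Equality holds at `ε = 0`, so
  -- `g` has a local minimum there and its derivative is the Euler equation.
  let g : ℝ → ℝ := fun ε => (1 + ε * (p / 2 * b)) ^ (-(4 / p)) * (K + ε * k1 + ε ^ 2 * k2)
    + ω * ((1 + ε * (p / 2 * b)) ^ (-(2 / p)) * (M + ε * m1))
  -- the variations stay nonnegative
  obtain ⟨ε₀, hε₀, hnn⟩ : ∃ ε₀ > 0, ∀ ε, |ε| < ε₀ → ∀ x, 0 ≤ v x + ε * η x := by
    rcases (tsupport η).eq_empty_or_nonempty with he | hne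
    · refine ⟨1, one_pos, fun ε _ x => ?_⟩
      rw [image_eq_zero_of_notMem_tsupport (f := η) (by simp [he])]
      simpa using hv.nonneg x
    obtain ⟨x₀, hx₀, hx₀'⟩ := (show IsCompact (tsupport η) from hη.compact).exists_isMinOn hne
      hv.cont.continuousOn
    obtain ⟨B, hB⟩ := (show IsCompact (tsupport η) from hη.compact).exists_bound_of_continuousOn
      hη.continuous.continuousOn
    have hm := hvpos x₀ (hη.subset hx₀)
    have hB0 : 0 ≤ B := (norm_nonneg _).trans (hB x₀ hx₀)
    refine ⟨v x₀ / (B + 1), by positivity, fun ε hε x => ?_⟩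
    by_cases hx : x ∈ tsupport η
    · have h1 : v x₀ ≤ v x := hx₀' hx
      have h2 := hB x hx
      rw [Real.norm_eq_abs] at h2
      have h3 : |ε * η x| ≤ v x₀ := by
        rw [abs_mul]
        rw [lt_div_iff₀ (by positivity)] at hε
        nlinarith [abs_nonneg ε]
      linarith [(abs_le.1 h3).1]
    · rw [image_eq_zero_of_notMem_tsupport hx]
      simpa using hv.nonneg x
  have hloc : IsLocalMin g 0 := by
    have hc1 : ContinuousAt (fun ε : ℝ => 1 + ε * (p / 2 * b)) 0 := by fun_prop
    have hpos : ∀ᶠ ε in nhds (0 : ℝ), 0 < 1 + ε * (p / 2 * b) :=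
      hc1.eventually_const_lt (by norm_num)
    filter_upwards [hpos, Metric.ball_mem_nhds (0 : ℝ) hε₀] with ε hε1 hε2
    rw [Metric.mem_ball, dist_zero_right, Real.norm_eq_abs] at hε2
    have hnonneg := hnn ε hε2
    have hdae : deriv (fun x => v x + ε * η x) =ᵐ[volume] fun x => deriv v x + ε * deriv η x := by
      filter_upwards [ae_differentiableAt_of_absCont hv.absCont] with x hx
      exact (hx.hasDerivAt.fun_add ((hη.hasDerivAt x).const_mul ε)).deriv
    have hη2 : MemLp (deriv η) 2 volume :=
      hη.deriv.continuous.memLp_of_hasCompactSupport hη.deriv.compact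
    have hadm : AdmissibleSq (fun x => v x + ε * η x) := by
      refine ⟨hv.cont.add (hη.continuous.const_mul ε), hnonneg,
        hv.integrable.add (hη.integrable.const_mul ε), fun a b => ?_, ?_⟩
      · refine (hv.absCont a b).fun_add (AbsolutelyContinuousOnInterval.const_mul ε ?_)
        exact (hη.smooth.of_le (by simp)).contDiffOn.absolutelyContinuousOnInterval
      · exact (hv.memLp_deriv.add (hη2.const_mul ε)).ae_eq hdae.symm
    have hGle : 1 + ε * (p / 2 * b) ≤ ∫ x, (v x + ε * η x) ^ (p / 2) := by
      have e : 1 + ε * (p / 2 * b)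
          = ∫ x, (v x ^ (p / 2) + (ε * (p / 2)) * (v x ^ (p / 2 - 1) * η x)) := by
        rw [integral_add hGint (hbint.const_mul _), integral_const_mul, hG, hb]; ring
      rw [e]
      have hint2 : Integrable fun x => (v x + ε * η x) ^ (p / 2) := by
        have hc : Continuous fun x => (v x + ε * η x) ^ (p / 2) - v x ^ (p / 2) :=
          ((hv.cont.add (hη.continuous.const_mul ε)).rpow_const
            fun x => Or.inr (by linarith)).sub hcont1
        have hs : HasCompactSupport fun x => (v x + ε * η x) ^ (p / 2) - v x ^ (p / 2) :=
          HasCompactSupport.of_support_subset_isCompact hη.compact fun x hx => by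
            by_contra hn
            apply hx
            simp [image_eq_zero_of_notMem_tsupport hn]
        have := (hc.integrable_of_hasCompactSupport hs).add hGint
        refine this.congr (Filter.Eventually.of_forall fun x => ?_)
        simp
      refine integral_mono (hGint.add (hbint.const_mul _)) hint2 fun x => ?_
      by_cases hx : x ∈ Function.support Φ
      · have := bernoulli_rpow (hvpos x hx) (hnonneg x) hr
        simp only
        linarith
      · simp only [hη.eq_zero hx, mul_zero, add_zero]
        exact le_refl _
    have hGpos := hε1.trans_le hGle
    have h := hmin.le_of_integral_pos hp hadm hGpos
    have hm : ∫ x, (v x + ε * η x) = M + ε * m1 := by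
      rw [integral_add hv.integrable (hη.integrable.const_mul ε), integral_const_mul, hM, hm1]
    have hk : (1 / 4) * ∫ x, deriv (fun x => v x + ε * η x) x ^ 2 = K + ε * k1 + ε ^ 2 * k2 := by
      have i1 := hv.memLp_deriv.integrable_sq
      have i2 : Integrable fun x => deriv v x * deriv η x := hv.memLp_deriv.integrable_mul hη2
      have i3 := hη2.integrable_sq
      have e : ∫ x, deriv (fun x => v x + ε * η x) x ^ 2
          = ∫ x, (deriv v x ^ 2 + (2 * ε) * (deriv v x * deriv η x) + ε ^ 2 * deriv η x ^ 2) := by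
        refine integral_congr_ae ?_
        filter_upwards [hdae] with x hx
        rw [hx]; ring
      have i12 : Integrable fun x => deriv v x ^ 2 + (2 * ε) * (deriv v x * deriv η x) :=
        i1.add (i2.const_mul _)
      rw [e, integral_add i12 (i3.const_mul _), integral_add i1 (i2.const_mul _),
        integral_const_mul, integral_const_mul, ← hK, ← hk1, ← hk2]
      ring
    have hm0 : 0 ≤ M + ε * m1 := by
      rw [← hm]; exact integral_nonneg hnonneg
    have hk0 : 0 ≤ K + ε * k1 + ε ^ 2 * k2 := by
      rw [← hk]; exact mul_nonneg (by norm_num) (integral_nonneg fun x => sq_nonneg _)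
    rw [hm, hk, hE] at h
    have hppos : 0 < p := by linarith
    have c1 := mul_le_mul_of_nonneg_right (Real.rpow_le_rpow_of_nonpos hε1 hGle
      (show -(4 / p) ≤ 0 by rw [neg_nonpos]; positivity)) hk0
    have c2 := mul_le_mul_of_nonneg_right (Real.rpow_le_rpow_of_nonpos hε1 hGle
      (show -(2 / p) ≤ 0 by rw [neg_nonpos]; positivity)) hm0
    have c3 := mul_le_mul_of_nonneg_left c2 hω.le
    have e0 : g 0 = K + ω * M := by simp [g]
    rw [e0]
    simp only [g]
    linarith
  have hder : HasDerivAt g (-(4 / p) * (p / 2 * b) * K + k1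
      + ω * (-(2 / p) * (p / 2 * b) * M + m1)) 0 := by
    have hlin : HasDerivAt (fun ε : ℝ => 1 + ε * (p / 2 * b)) (p / 2 * b) 0 := by
      simpa using ((hasDerivAt_id (0 : ℝ)).mul_const (p / 2 * b)).const_add 1
    have h1 : ∀ q : ℝ, HasDerivAt (fun ε : ℝ => (1 + ε * (p / 2 * b)) ^ q) (q * (p / 2 * b)) 0 := by
      intro q
      have := hlin.rpow_const (p := q) (Or.inl (by norm_num))
      refine this.congr_deriv ?_
      simp; ring
    have h2 : HasDerivAt (fun ε : ℝ => K + ε * k1 + ε ^ 2 * k2) k1 0 := by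
      have := (((hasDerivAt_id (0 : ℝ)).mul_const k1).const_add K).fun_add
        (((hasDerivAt_id (0 : ℝ)).fun_pow 2).mul_const k2)
      simpa using this
    have h3 : HasDerivAt (fun ε : ℝ => M + ε * m1) m1 0 := by
      simpa using ((hasDerivAt_id (0 : ℝ)).mul_const m1).const_add M
    have := ((h1 (-(4 / p))).fun_mul h2).fun_add (((h1 (-(2 / p))).fun_mul h3).const_mul ω)
    refine this.congr_deriv ?_
    simp
  have h0 := hloc.hasDerivAt_eq_zero hder
  rw [← h0]
  field_simp
  ring

end Variations

end Compacton

/-! ### Regularity, the first integral and the shape of the minimizer -/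

namespace Compacton

lemma exists_isTest_integral_eq_one {a b : ℝ} (hab : a < b) :
    ∃ χ, IsTest (Ioo a b) χ ∧ ∫ x, χ x = 1 := by
  let B : ContDiffBump ((a + b) / 2) := ⟨(b - a) / 8, (b - a) / 4, by linarith, by linarith⟩
  refine ⟨B.normed volume, ⟨B.contDiff_normed, B.hasCompactSupport_normed, ?_⟩, B.integral_normed⟩
  rw [B.tsupport_normed_eq, Real.closedBall_eq_Icc]
  intro x hx
  simp only [B, mem_Icc, mem_Ioo] at hx ⊢
  constructor <;> linarith [hx.1, hx.2]

/-- The lemma of du Bois-Reymond. -/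
lemma ae_eq_const_of_integral_eq_zero {a b : ℝ} (hab : a < b) {u : ℝ → ℝ}
    (hu : LocallyIntegrable u)
    (h : ∀ k, IsTest (Ioo a b) k → ∫ x, k x = 0 → ∫ x, k x * u x = 0) :
    ∃ C, ∀ᵐ x, x ∈ Ioo a b → u x = C := by
  have hint : ∀ {k}, IsTest (Ioo a b) k → Integrable (fun x => k x * u x) := fun hk => by
    simpa only [smul_eq_mul] using
      hu.integrable_smul_left_of_hasCompactSupport hk.continuous hk.compact
  obtain ⟨χ, hχ, hχ1⟩ := exists_isTest_integral_eq_one hab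
  obtain ⟨C, hC⟩ : ∃ C, ∫ x, χ x * u x = C := ⟨_, rfl⟩
  refine ⟨C, ?_⟩
  have := isOpen_Ioo.ae_eq_zero_of_integral_contDiff_smul_eq_zero (U := Ioo a b)
    (f := fun x => u x - C) (μ := volume)
    ((hu.locallyIntegrableOn _).sub (continuous_const.locallyIntegrable.locallyIntegrableOn _)) ?_
  · filter_upwards [this] with x hx hxI
    exact sub_eq_zero.1 (hx hxI)
  intro k k1 k2 k3
  have hk : IsTest (Ioo a b) k := ⟨k1, k2, k3⟩
  have h1 := h _ (hk.sub (hχ.const_mul (∫ x, k x))) (by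
    rw [integral_sub hk.integrable (hχ.const_mul _).integrable, integral_const_mul, hχ1]; ring)
  have e1 : ∀ x, (k x - (∫ x, k x) * χ x) * u x = k x * u x - (∫ x, k x) * (χ x * u x) :=
    fun x => by ring
  simp only [e1] at h1
  rw [integral_sub (hint hk) ((hint hχ).const_mul _), integral_const_mul, hC] at h1
  have e2 : ∀ x, k x • (u x - C) = k x * u x - k x * C := fun x => by
    rw [smul_eq_mul]; ring
  simp only [e2]
  rw [integral_sub (hint hk) (hk.integrable.mul_const C), integral_mul_const]
  exact h1

/-- Weak solutions of `v'' = q` with continuous right-hand side are classical. -/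
lemma hasDerivAt_deriv_of_weak {v q : ℝ → ℝ} {a b : ℝ} (hab : a < b)
    (hv : ∀ a b : ℝ, AbsolutelyContinuousOnInterval v a b) (hv2 : MemLp (deriv v) 2 volume)
    (hq : Continuous q)
    (h : ∀ η, IsTest (Ioo a b) η → ∫ x, deriv v x * deriv η x = -∫ x, q x * η x)
    {x : ℝ} (hx : x ∈ Ioo a b) :
    DifferentiableAt ℝ v x ∧ HasDerivAt (deriv v) (q x) x := by
  let W : ℝ → ℝ := fun x => ∫ t in (0 : ℝ)..x, q t
  have hW : ∀ x, HasDerivAt W (q x) x := fun x =>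
    intervalIntegral.integral_hasDerivAt_right (hq.intervalIntegrable _ _)
      hq.stronglyMeasurable.stronglyMeasurableAtFilter hq.continuousAt
  have hWc : Continuous W := continuous_iff_continuousAt.2 fun x => (hW x).continuousAt
  have hvl : LocallyIntegrable (deriv v) := hv2.locallyIntegrable (by norm_num)
  have hI : ∀ {f g : ℝ → ℝ}, LocallyIntegrable f → IsTest (Ioo a b) g →
      Integrable (fun x => f x * g x) := fun hf hg => by
    simpa only [smul_eq_mul, mul_comm] using
      hf.integrable_smul_left_of_hasCompactSupport hg.continuous hg.compact
  -- Testing with primitives of mean-zero functions shows that `v' - W` is almost everywhere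
  -- constant. Absolute continuity of `v` then turns this into a pointwise derivative.
  obtain ⟨C, hC⟩ := ae_eq_const_of_integral_eq_zero hab
    (u := fun x => deriv v x - W x) (hvl.sub hWc.locallyIntegrable) (fun k hk h0 => by
      obtain ⟨η, hη, hη'⟩ := hk.exists_primitive h0
      have hd : deriv η = k := funext fun x => (hη' x).deriv
      have h1 := h η hη
      rw [hd] at h1
      have i1 := hI hWc.locallyIntegrable hk
      have i2 := hI hq.locallyIntegrable hη
      have h2 : ∫ x, (q x * η x + W x * k x) = 0 := by
        refine integral_eq_zero_of_hasDerivAt_of_integrable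
          (f := fun x => W x * η x) (fun x => ?_) (i2.add i1) (hI hWc.locallyIntegrable hη)
        exact (hW x).fun_mul (hη' x)
      rw [integral_add i2 i1] at h2
      have e : ∀ x, k x * (deriv v x - W x) = deriv v x * k x - W x * k x := fun x => by ring
      simp only [e]
      rw [integral_sub (hI hvl hk) i1, h1]
      linarith)
  have hWC : Continuous fun t => W t + C := hWc.add continuous_const
  have hder : ∀ y ∈ Ioo a b, HasDerivAt v (W y + C) y := by
    intro y hy
    have h1 : HasDerivAt (fun z => v x + ∫ t in x..z, (W t + C)) (W y + C) y :=
      (intervalIntegral.integral_hasDerivAt_right (hWC.intervalIntegrable _ _)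
        hWC.stronglyMeasurable.stronglyMeasurableAtFilter hWC.continuousAt).const_add _
    refine h1.congr_of_eventuallyEq ?_
    filter_upwards [isOpen_Ioo.mem_nhds hy] with z hz
    have h2 : ∫ t in x..z, (W t + C) = ∫ t in x..z, deriv v t := by
      refine intervalIntegral.integral_congr_ae ?_
      filter_upwards [hC] with t ht htz
      have htI : t ∈ Ioo a b := (ordConnected_Ioo.uIcc_subset hx hz) (uIoc_subset_uIcc htz)
      have := ht htI
      linarith
    rw [h2, (hv x z).integral_deriv_eq_sub]
    ring
  refine ⟨(hder x hx).differentiableAt, ?_⟩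
  refine ((hW x).add_const C).congr_of_eventuallyEq ?_
  filter_upwards [isOpen_Ioo.mem_nhds hx] with y hy
  exact (hder y hy).deriv

/-- Monotonicity is assumed only on the open half-line; continuity extends it to the origin and
evenness to negative arguments. -/
lemma BellShaped.le_of_abs_le {Φ : ℝ → ℝ} (h : BellShaped Φ) (hc : Continuous Φ) {x y : ℝ}
    (hxy : |x| ≤ |y|) : Φ y ≤ Φ x := by
  have habs : ∀ x, Φ |x| = Φ x := fun x => by
    rcases abs_choice x with hx | hx
    · rw [hx]
    · rw [hx, h.1]
  rw [← habs x, ← habs y]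
  rcases (abs_nonneg x).eq_or_lt with hx | hx
  · rw [← hx]
    rcases (abs_nonneg y).eq_or_lt with hy | hy
    · rw [← hy]
    · have ht : Filter.Tendsto Φ (nhdsWithin 0 (Ioi 0)) (nhds (Φ 0)) :=
        hc.continuousAt.tendsto.mono_left nhdsWithin_le_nhds
      refine ge_of_tendsto ht ?_
      filter_upwards [Ioo_mem_nhdsGT hy] with z hz
      exact h.2.2 hz.1 hy hz.2.le
  · exact h.2.2 hx (hx.trans_le hxy) hxy

section

variable {ω p : ℝ} {Φ : ℝ → ℝ} (hp : 2 < p) (hω : 0 < ω) (hbell : BellShaped Φ)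
  (hmin : IsConstrainedMinimizer ω p Φ)
include hp hbell hmin

lemma profile_zero_pos : 0 < Φ 0 := by
  refine (hbell.2.1 0).lt_of_ne' fun h => ?_
  have h0 : ∀ x, Φ x = 0 := fun x => le_antisymm
    (h ▸ hbell.le_of_abs_le hmin.admissible.continuous (by simp)) (hbell.2.1 x)
  have := hmin.constraint
  simp only [h0, abs_zero, Real.zero_rpow (show p ≠ 0 by linarith), integral_zero] at this
  exact zero_ne_one this

omit hp in
-- A point between `x` and `y` is no farther from the origin than one of them. Connectedness makes
-- the first integral a single constant.
lemma ordConnected_support : (Function.support Φ).OrdConnected := by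
  refine ⟨fun x hx y hy z hz => ?_⟩
  have hc := hmin.admissible.continuous
  have hpos : ∀ t ∈ Function.support Φ, 0 < Φ t := fun t ht =>
    (hbell.2.1 t).lt_of_ne' ht
  rcases le_total |x| |y| with h | h
  · refine ((hpos y hy).trans_le (hbell.le_of_abs_le hc ?_)).ne'
    rw [abs_le]
    constructor
    · linarith [hz.1, neg_abs_le x]
    · linarith [hz.2, le_abs_self y]
  · refine ((hpos x hx).trans_le (hbell.le_of_abs_le hc ?_)).ne'
    rw [abs_le]
    constructor
    · linarith [hz.1, neg_abs_le x]
    · linarith [hz.2, le_abs_self y]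

include hω in
lemma multiplier_pos : 0 < multiplier ω Φ := by
  have hpos := profile_zero_pos hp hbell hmin
  have h1 : 0 ≤ ∫ x, (Φ x * deriv Φ x) ^ 2 := integral_nonneg fun x => sq_nonneg _
  have h2 : 0 < ∫ x, Φ x ^ 2 := by
    have hc : Continuous fun x => Φ x ^ 2 := hmin.admissible.continuous.pow 2
    exact integral_pos_of_integrable_nonneg_nonzero hc hmin.admissible.memLp.integrable_sq
      (fun x => sq_nonneg _) (x := 0) (by positivity)
  rw [multiplier]
  have := mul_pos hω h2
  linarith

include hω in
lemma hasDerivAt_deriv_sq {x : ℝ} (hx : x ∈ Function.support Φ) :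
    DifferentiableAt ℝ (fun y => Φ y ^ 2) x ∧ HasDerivAt (deriv fun y => Φ y ^ 2)
      (2 * (ω - multiplier ω Φ * (Φ x ^ 2) ^ (p / 2 - 1))) x := by
  have hc := hmin.admissible.continuous
  have hopen : IsOpen (Function.support Φ) := isOpen_ne_fun hc continuous_const
  obtain ⟨r, hr, hball⟩ := Metric.isOpen_iff.1 hopen x hx
  rw [Real.ball_eq_Ioo] at hball
  have hv := hmin.admissible.sq
  have hcont2 : Continuous fun x => (Φ x ^ 2) ^ (p / 2 - 1) :=
    hv.cont.rpow_const fun x => Or.inr (by linarith)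
  refine hasDerivAt_deriv_of_weak (a := x - r) (b := x + r)
    (q := fun x => 2 * (ω - multiplier ω Φ * (Φ x ^ 2) ^ (p / 2 - 1))) (by linarith) hv.absCont
    hv.memLp_deriv (by fun_prop) (fun η hη => ?_) ⟨by linarith, by linarith⟩
  have h := weak_equation hp hω hbell.2.1 hmin (hη.mono hball)
  have hint : Integrable fun x => (Φ x ^ 2) ^ (p / 2 - 1) * η x :=
    (hcont2.mul hη.continuous).integrable_of_hasCompactSupport hη.compact.mul_left
  have e : ∀ x, 2 * (ω - multiplier ω Φ * (Φ x ^ 2) ^ (p / 2 - 1)) * η x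
      = (2 * ω) * η x - (2 * multiplier ω Φ) * ((Φ x ^ 2) ^ (p / 2 - 1) * η x) := fun x => by ring
  simp only [e]
  rw [integral_sub (hη.integrable.const_mul _) (hint.const_mul _), integral_const_mul,
    integral_const_mul]
  linarith

/-- The minimizer is a compacton profile. -/
theorem exists_profile (hω : 0 < ω) :
    ∃ l, Profile ((p - 2) / 2) ω (2 * multiplier ω Φ / p) l Φ := by
  have hc := hmin.admissible.continuous
  have hΦ0 := hbell.2.1
  have hc0 := multiplier_pos hp hω hbell hmin
  have h00 := profile_zero_pos hp hbell hmin
  have hD := fun {x} => hasDerivAt_deriv_sq hp hω hbell hmin (x := x)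
  have hvir := virial hp hΦ0 hmin
  have hG := integral_sq_rpow hΦ0 hmin
  have hv := hmin.admissible.sq
  have hp0 : p ≠ 0 := by linarith
  have hopen : IsOpen (Function.support Φ) := isOpen_ne_fun hc continuous_const
  have hIpos : ∀ x ∈ Function.support Φ, 0 < Φ x := fun x hx => (hΦ0 x).lt_of_ne' hx
  obtain ⟨c, hcdef⟩ : ∃ c, multiplier ω Φ = c := ⟨_, rfl⟩
  rw [hcdef] at hc0 hvir ⊢
  simp only [hcdef] at hD
  obtain ⟨v, hvdef⟩ : ∃ v, v = fun y => Φ y ^ 2 := ⟨_, rfl⟩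
  have hvx : ∀ x, Φ x ^ 2 = v x := fun x => by rw [hvdef]
  simp only [hvx] at hD hvir hG hv
  have hvpos : ∀ x ∈ Function.support Φ, 0 < v x := fun x hx => by
    have := hIpos x hx
    rw [← hvx]; positivity
  -- the first integral
  have hfi : ∃ E, ∀ x ∈ Function.support Φ,
      (deriv v x / 2) ^ 2 - ω * v x + 2 * c / p * v x ^ (p / 2) = E := by
    have hd : ∀ x ∈ Function.support Φ, HasDerivAt
        (fun x => (deriv v x / 2) ^ 2 - ω * v x + 2 * c / p * v x ^ (p / 2)) 0 x := by
      intro x hx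
      obtain ⟨h1, h2⟩ := hD hx
      have h3 := h1.hasDerivAt.rpow_const (p := p / 2) (Or.inl (hvpos x hx).ne')
      refine ((((h2.div_const 2).fun_pow 2).fun_sub (h1.hasDerivAt.const_mul ω)).fun_add
        (h3.const_mul (2 * c / p))).congr_deriv ?_
      field_simp
      ring
    have hpre : IsPreconnected (Function.support Φ) :=
      (ordConnected_support hbell hmin).isPreconnected
    refine ⟨_, fun x hx => hopen.is_const_of_deriv_eq_zero hpre
      (fun y hy => (hd y hy).differentiableAt.differentiableWithinAt)
      (fun y hy => (hd y hy).deriv) hx (show (0 : ℝ) ∈ Function.support Φ from h00.ne')⟩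
  obtain ⟨E, hE⟩ := hfi
  have hGint : Integrable fun x => v x ^ (p / 2) := by
    by_contra h
    rw [integral_undef h] at hG
    exact zero_ne_one hG
  have hind : (Function.support Φ).indicator (fun _ => E) =
      fun x => (1 / 4) * deriv v x ^ 2 - ω * v x + 2 * c / p * v x ^ (p / 2) := by
    funext x
    by_cases hx : x ∈ Function.support Φ
    · rw [indicator_of_mem hx, ← hE x hx]; ring
    · have hx0 : v x = 0 := by
        rw [← hvx, Function.notMem_support.1 hx]; norm_num
      have hm : IsLocalMin v x := Filter.Eventually.of_forall fun y => by
        rw [hx0]; exact hv.nonneg y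
      rw [indicator_of_notMem hx, hm.deriv_eq_zero, hx0, Real.zero_rpow (by positivity)]
      simp
  have i1 := hv.memLp_deriv.integrable_sq.const_mul (1 / 4)
  have i2 := hv.integrable.const_mul ω
  have i3 := hGint.const_mul (2 * c / p)
  have i12 : Integrable fun x => (1 / 4) * deriv v x ^ 2 - ω * v x := i1.sub i2
  -- Integrating the first integral over the line reproduces the virial identity, so `E` times the
  -- length of the support vanishes. If the support had infinite length, integrability alone would
  -- force `E = 0`.
  have hE0 : E = 0 := by
    have hint : Integrable ((Function.support Φ).indicator fun _ => E) := by
      rw [hind]; exact i12.add i3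
    have hval : ∫ x, (Function.support Φ).indicator (fun _ => E) x = 0 := by
      rw [hind, integral_add i12 i3, integral_sub i1 i2, integral_const_mul, integral_const_mul,
        integral_const_mul, hG]
      linarith
    rw [integral_indicator hopen.measurableSet, setIntegral_const, smul_eq_mul, mul_eq_zero] at hval
    refine hval.elim (fun h => ?_) id
    rw [integrable_indicator_iff hopen.measurableSet] at hint
    rcases (integrableOn_const_iff (by simp)).1 hint with h' | h'
    · simpa using h'
    · rw [measureReal_eq_zero_iff h'.ne] at h
      exact absurd h (hopen.measure_pos volume ⟨0, h00.ne'⟩).ne'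
  subst hE0
  -- regularity
  have hvsm : ContDiffOn ℝ ∞ v (Function.support Φ) := by
    refine contDiffOn_infty.2 fun n => ?_
    -- Bootstrap on `v` and `v'` together: `v''` is a smooth function of `v` where `v > 0`.
    suffices h : ∀ n : ℕ, ContDiffOn ℝ n v (Function.support Φ) ∧
        ContDiffOn ℝ n (deriv v) (Function.support Φ) from (h n).1
    intro n
    induction n with
    | zero =>
      simp only [Nat.cast_zero, contDiffOn_zero]
      exact ⟨hv.cont.continuousOn, fun x hx => (hD hx).2.continuousAt.continuousWithinAt⟩
    | succ n ih =>
      push_cast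
      rw [contDiffOn_succ_iff_deriv_of_isOpen hopen, contDiffOn_succ_iff_deriv_of_isOpen hopen]
      refine ⟨⟨fun x hx => (hD hx).1.differentiableWithinAt, by simp, ih.2⟩,
        fun x hx => (hD hx).2.differentiableAt.differentiableWithinAt, by simp, ?_⟩
      have h1 : ContDiffOn ℝ n (fun x => 2 * (ω - c * v x ^ (p / 2 - 1))) (Function.support Φ) :=
        contDiffOn_const.mul (contDiffOn_const.sub (contDiffOn_const.mul
          (ih.1.rpow_const_of_ne fun x hx => (hvpos x hx).ne')))
      exact h1.congr fun x hx => (hD hx).2.deriv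
  have hsm : ContDiffOn ℝ ∞ Φ (Function.support Φ) :=
    (hvsm.sqrt fun x hx => (hvpos x hx).ne').congr fun x _ => by
      rw [← hvx, Real.sqrt_sq (hΦ0 x)]
  have hd1 : ∀ x ∈ Function.support Φ, HasDerivAt Φ (deriv Φ x) x := fun x hx =>
    ((hsm.contDiffAt (hopen.mem_nhds hx)).differentiableAt (by simp)).hasDerivAt
  have hsm' : ContDiffOn ℝ ∞ (deriv Φ) (Function.support Φ) :=
    hsm.deriv_of_isOpen hopen (by simp)
  have hd2 : ∀ x ∈ Function.support Φ, HasDerivAt (deriv Φ) (deriv (deriv Φ) x) x := fun x hx =>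
    ((hsm'.contDiffAt (hopen.mem_nhds hx)).differentiableAt (by simp)).hasDerivAt
  have hdv : ∀ x ∈ Function.support Φ, deriv v x = 2 * (Φ x * deriv Φ x) := fun x hx => by
    have := mul_deriv_eq hc (x := x) (by rw [← hvdef]; exact (hD hx).1)
    rw [← hvdef] at this
    linarith
  have hpow : ∀ x ∈ Function.support Φ, v x ^ (p / 2 - 1) = Φ x ^ (2 * ((p - 2) / 2)) := by
    intro x hx
    rw [← hvx, ← Real.rpow_natCast, ← Real.rpow_mul (hΦ0 x)]
    congr 1
    push_cast; ring
  have hsq : ∀ x ∈ Function.support Φ,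
      deriv Φ x ^ 2 = ω - 2 * c / p * Φ x ^ (2 * ((p - 2) / 2)) := by
    intro x hx
    have h1 := hE x hx
    have h2 : v x ^ (p / 2) = v x ^ (p / 2 - 1) * v x := by
      rw [← Real.rpow_add_one (hvpos x hx).ne']; ring_nf
    rw [h2, hdv x hx, hpow x hx, ← hvx] at h1
    have h3 : Φ x ^ 2 * (deriv Φ x ^ 2 - (ω - 2 * c / p * Φ x ^ (2 * ((p - 2) / 2)))) = 0 := by
      linarith
    have h4 : Φ x ^ 2 ≠ 0 := by have := hIpos x hx; positivity
    exact sub_eq_zero.1 ((mul_eq_zero.1 h3).resolve_left h4)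
  have hdd : ∀ x ∈ Function.support Φ, Φ x * deriv (deriv Φ) x =
      -(2 * c / p) * ((p - 2) / 2) * Φ x ^ (2 * ((p - 2) / 2)) := by
    intro x hx
    have h1 : HasDerivAt (deriv v)
        (2 * (deriv Φ x * deriv Φ x + Φ x * deriv (deriv Φ) x)) x := by
      refine (((hd1 x hx).fun_mul (hd2 x hx)).const_mul 2).congr_of_eventuallyEq ?_
      filter_upwards [hopen.mem_nhds hx] with y hy
      exact hdv y hy
    have h2 := h1.unique (hD hx).2
    rw [hpow x hx] at h2
    have h3 := hsq x hx
    have h4 : Φ x * deriv (deriv Φ) x = (2 * c / p - c) * Φ x ^ (2 * ((p - 2) / 2)) := by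
      linarith
    rw [h4]
    field_simp
    ring
  -- boundedness of the support
  have hbdd : ∃ x, x ∉ Function.support Φ := by
    by_contra! hall
    have hneg : ∀ x, deriv (deriv Φ) x < 0 := by
      intro x
      have h1 := hdd x (hall x)
      have h2 := hIpos x (hall x)
      have h3 : 0 < 2 * c / p * ((p - 2) / 2) * Φ x ^ (2 * ((p - 2) / 2)) := by
        have : 0 < p - 2 := by linarith
        positivity
      by_contra! h4
      have := mul_nonneg h2.le h4
      linarith
    have hanti : StrictAnti (deriv Φ) := strictAnti_of_deriv_neg hneg
    have h0 : deriv Φ 0 = 0 := by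
      have := deriv_neg_of_even hbell.1 0
      rw [neg_zero] at this
      linarith
    have h1 : deriv Φ 1 < 0 := by
      have := hanti (show (0 : ℝ) < 1 by norm_num)
      linarith
    -- One unit beyond the zero of the tangent line at 1; concavity puts `Φ X` below that line,
    -- hence below `Φ' 1 < 0`.
    obtain ⟨X, hX⟩ : ∃ X, X = 2 + Φ 1 / (-deriv Φ 1) := ⟨_, rfl⟩
    have hX1 : 1 < X := by
      have : 0 ≤ Φ 1 / (-deriv Φ 1) := div_nonneg (hΦ0 1) (by linarith)
      linarith
    obtain ⟨t, ht, ht'⟩ := exists_deriv_eq_slope Φ hX1 hc.continuousOn fun y _ =>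
      (hd1 y (hall y)).differentiableAt.differentiableWithinAt
    have h2 : deriv Φ t < deriv Φ 1 := hanti ht.1
    rw [eq_div_iff (by linarith)] at ht'
    have h3 : Φ 1 = (X - 2) * (-deriv Φ 1) := by
      rw [hX, add_sub_cancel_left, div_mul_cancel₀ _ (by linarith)]
    have h4 := hIpos X (hall X)
    nlinarith
  obtain ⟨x₁, hx₁⟩ := hbdd
  have hZc : IsClosed {x | 0 ≤ x ∧ Φ x = 0} :=
    (isClosed_le continuous_const continuous_id).inter (isClosed_eq hc continuous_const)
  have hZne : {x | 0 ≤ x ∧ Φ x = 0}.Nonempty := by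
    refine ⟨|x₁|, abs_nonneg _, le_antisymm ?_ (hΦ0 _)⟩
    rw [← Function.notMem_support.1 hx₁]
    exact hbell.le_of_abs_le hc (by simp)
  have hZb : BddBelow {x | 0 ≤ x ∧ Φ x = 0} := ⟨0, fun x hx => hx.1⟩
  obtain ⟨l, hl⟩ : ∃ l, l = sInf {x | 0 ≤ x ∧ Φ x = 0} := ⟨_, rfl⟩
  have hlZ : 0 ≤ l ∧ Φ l = 0 := by
    have := hZc.csInf_mem hZne hZb
    rwa [← hl] at this
  have hl0 : 0 < l := hlZ.1.lt_of_ne fun h => by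
    have := hlZ.2
    rw [← h] at this
    exact h00.ne' this
  have hzero : ∀ x, x ∉ Ioo (-l) l → Φ x = 0 := by
    intro x hx
    refine le_antisymm ?_ (hΦ0 x)
    rw [← hlZ.2]
    refine hbell.le_of_abs_le hc ?_
    rw [abs_of_pos hl0]
    by_contra! h
    exact hx (abs_lt.1 h)
  have hposI : ∀ x ∈ Ioo (-l) l, 0 < Φ x := by
    intro x hx
    refine (hΦ0 x).lt_of_ne' fun h => ?_
    have hm : |x| ∈ {x | 0 ≤ x ∧ Φ x = 0} := ⟨abs_nonneg x, le_antisymm (by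
      rw [← h]; exact hbell.le_of_abs_le hc (by simp)) (hΦ0 _)⟩
    have := csInf_le hZb hm
    rw [← hl] at this
    exact absurd (abs_lt.2 hx) (not_lt.2 this)
  have hI : ∀ x ∈ Ioo (-l) l, x ∈ Function.support Φ := fun x hx => (hposI x hx).ne'
  exact ⟨l, by linarith, hω, by positivity, hl0, hbell.1, hc, hposI, hzero, hsm.mono hI,
    fun x hx => hsq x (hI x hx), fun x hx => hdd x (hI x hx)⟩

end

end Compacton

/-! ### The operator across the end points of the interval -/

namespace Compacton

/-- The support of `f` avoids `a` and `b`, so `f` vanishes near them and the cut-off is smooth. This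
splits a test function into independent inner and outer parts. -/
lemma IsTest.indicator_Ioo {U : Set ℝ} {f : ℝ → ℝ} {a b : ℝ} (hf : IsTest U f) (ha : a ∉ U)
    (hb : b ∉ U) : IsTest (Ioo a b ∩ U) ((Ioo a b).indicator f) := by
  have hts : tsupport ((Ioo a b).indicator f) ⊆ tsupport f :=
    closure_mono (by rw [support_indicator]; exact inter_subset_right)
  refine ⟨contDiff_iff_contDiffAt.2 fun x => ?_, ?_, fun x hx => ?_⟩
  · by_cases hx : x ∈ tsupport f
    · have hxU := hf.subset hx
      have hxa : x ≠ a := fun h => ha (h ▸ hxU)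
      have hxb : x ≠ b := fun h => hb (h ▸ hxU)
      by_cases hI : x ∈ Ioo a b
      · refine hf.smooth.contDiffAt.congr_of_eventuallyEq ?_
        filter_upwards [isOpen_Ioo.mem_nhds hI] with y hy
        exact indicator_of_mem hy f
      · have hI' : x ∈ (Icc a b)ᶜ := fun h =>
          hI ⟨h.1.lt_of_ne' hxa, h.2.lt_of_ne hxb⟩
        refine (contDiffAt_const (c := (0 : ℝ))).congr_of_eventuallyEq ?_
        filter_upwards [isClosed_Icc.isOpen_compl.mem_nhds hI'] with y hy
        exact indicator_of_notMem (fun h => hy (Ioo_subset_Icc_self h)) f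
    · refine (contDiffAt_const (c := (0 : ℝ))).congr_of_eventuallyEq ?_
      filter_upwards [notMem_tsupport_iff_eventuallyEq.1 hx] with y hy
      simp [indicator, hy]
  · exact HasCompactSupport.of_support_subset_isCompact hf.compact
      (subset_closure.trans hts)
  · have hxU := hf.subset (hts hx)
    have hx' : x ∈ Icc a b := by
      have : tsupport ((Ioo a b).indicator f) ⊆ Icc a b :=
        closure_minimal (by
          rw [support_indicator]
          exact inter_subset_left.trans Ioo_subset_Icc_self) isClosed_Icc
      exact this hx
    exact ⟨⟨hx'.1.lt_of_ne fun h => ha (h ▸ hxU), hx'.2.lt_of_ne fun h => hb (h ▸ hxU)⟩, hxU⟩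

lemma IsTest.indicator_compl_Ioo {U : Set ℝ} {f : ℝ → ℝ} {a b : ℝ} (hf : IsTest U f) (ha : a ∉ U)
    (hb : b ∉ U) : IsTest U ((Ioo a b)ᶜ.indicator f) :=
  (hf.sub ((hf.indicator_Ioo ha hb).mono inter_subset_right)).congr fun x => by
    rw [indicator_compl]; rfl

/-- The operator on test functions vanishing near the end points of the interval. -/
noncomputable def fullOp (s ω κ l : ℝ) (Φ f : ℝ → ℝ) (x : ℝ) : ℝ :=
  innerOp s κ Φ ((Ioo (-l) l).indicator f) x + ω * (Ioo (-l) l)ᶜ.indicator f x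

lemma innerOp_add (s κ : ℝ) (Φ : ℝ → ℝ) {U : Set ℝ} {f g : ℝ → ℝ} (hf : IsTest U f)
    (hg : IsTest U g) (x : ℝ) :
    innerOp s κ Φ (fun x => f x + g x) x = innerOp s κ Φ f x + innerOp s κ Φ g x := by
  have h1 : deriv (fun x => f x + g x) = fun x => deriv f x + deriv g x :=
    funext fun x => ((hf.hasDerivAt x).fun_add (hg.hasDerivAt x)).deriv
  rw [innerOp, innerOp, innerOp, h1,
    ((hf.deriv.hasDerivAt x).fun_add (hg.deriv.hasDerivAt x)).deriv]
  ring

lemma innerOp_const_mul (s κ : ℝ) (Φ : ℝ → ℝ) {U : Set ℝ} {f : ℝ → ℝ} (hf : IsTest U f)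
    (c x : ℝ) : innerOp s κ Φ (fun x => c * f x) x = c * innerOp s κ Φ f x := by
  have h1 : deriv (fun x => c * f x) = fun x => c * deriv f x :=
    funext fun x => ((hf.hasDerivAt x).const_mul c).deriv
  rw [innerOp, innerOp, h1, ((hf.deriv.hasDerivAt x).const_mul c).deriv]
  ring

section

variable {s ω κ l : ℝ} {Φ : ℝ → ℝ} {U : Set ℝ} (h1 : -l ∉ U) (h2 : l ∉ U)
include h1 h2

lemma fullOp_add {f g : ℝ → ℝ} (hf : IsTest U f) (hg : IsTest U g) (x : ℝ) :
    fullOp s ω κ l Φ (fun x => f x + g x) x = fullOp s ω κ l Φ f x + fullOp s ω κ l Φ g x := by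
  have e1 : (Ioo (-l) l).indicator (fun x => f x + g x) =
      fun x => (Ioo (-l) l).indicator f x + (Ioo (-l) l).indicator g x := indicator_add _ f g
  have e2 : (Ioo (-l) l)ᶜ.indicator (fun x => f x + g x) =
      fun x => (Ioo (-l) l)ᶜ.indicator f x + (Ioo (-l) l)ᶜ.indicator g x := indicator_add _ f g
  rw [fullOp, fullOp, fullOp, e1, e2,
    innerOp_add s κ Φ (hf.indicator_Ioo h1 h2) (hg.indicator_Ioo h1 h2)]
  ring

lemma fullOp_const_mul {f : ℝ → ℝ} (hf : IsTest U f) (c x : ℝ) :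
    fullOp s ω κ l Φ (fun x => c * f x) x = c * fullOp s ω κ l Φ f x := by
  have e1 : (Ioo (-l) l).indicator (fun x => c * f x) =
      fun x => c * (Ioo (-l) l).indicator f x := by
    funext x; simp only [indicator]; split_ifs <;> simp
  have e2 : (Ioo (-l) l)ᶜ.indicator (fun x => c * f x) =
      fun x => c * (Ioo (-l) l)ᶜ.indicator f x := by
    funext x; simp only [indicator]; split_ifs <;> simp
  rw [fullOp, fullOp, e1, e2, innerOp_const_mul s κ Φ (hf.indicator_Ioo h1 h2)]
  ring

end

namespace Profile

variable {s ω κ l : ℝ} {Φ : ℝ → ℝ} (P : Profile s ω κ l Φ) {U : Set ℝ} (h1 : -l ∉ U) (h2 : l ∉ U)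
include P h1 h2

lemma isTest_fullOp (hU : Ioo (-l) l ⊆ U) {f : ℝ → ℝ} (hf : IsTest U f) :
    IsTest U (fullOp s ω κ l Φ f) :=
  ((P.isTest_innerOp ((hf.indicator_Ioo h1 h2).mono inter_subset_left)).mono hU).add
    ((hf.indicator_compl_Ioo h1 h2).const_mul ω)

omit P in
lemma integral_sq_split {f : ℝ → ℝ} (hf : IsTest U f) : ∫ x, f x ^ 2 =
    (∫ x, (Ioo (-l) l).indicator f x ^ 2) + ∫ x, (Ioo (-l) l)ᶜ.indicator f x ^ 2 := by
  have hi := hf.indicator_Ioo h1 h2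
  have ho := hf.indicator_compl_Ioo h1 h2
  have e1 := (hi.mul hi).integrable
  have e2 := (ho.mul ho).integrable
  simp only [← sq] at e1 e2
  rw [← integral_add e1 e2]
  congr 1
  funext x
  by_cases hx : x ∈ Ioo (-l) l <;> simp [indicator, hx]

lemma integral_fullOp_mul {f : ℝ → ℝ} (hf : IsTest U f) : ∫ x, fullOp s ω κ l Φ f x * f x =
    (∫ x, innerOp s κ Φ ((Ioo (-l) l).indicator f) x * (Ioo (-l) l).indicator f x)
      + ω * ∫ x, (Ioo (-l) l)ᶜ.indicator f x ^ 2 := by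
  have hi := (hf.indicator_Ioo h1 h2).mono inter_subset_left
  have ho := hf.indicator_compl_Ioo h1 h2
  have e2 := (ho.mul ho).integrable
  simp only [← sq] at e2
  rw [← integral_const_mul, ← integral_add ((P.isTest_innerOp hi).mul hi).integrable
    (e2.const_mul ω)]
  congr 1
  funext x
  rw [fullOp]
  by_cases hx : x ∈ Ioo (-l) l
  · simp [indicator, hx]
  · rw [(P.isTest_innerOp hi).eq_zero hx]
    simp only [indicator, hx, mem_compl_iff]
    simp
    ring

lemma full_lower_bound {f : ℝ → ℝ} (hf : IsTest U f) :
    -(s * (s + 1) * ω) * ∫ x, f x ^ 2 ≤ ∫ x, fullOp s ω κ l Φ f x * f x := by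
  rw [P.integral_fullOp_mul h1 h2 hf, integral_sq_split h1 h2 hf]
  have a := P.lower_bound ((hf.indicator_Ioo h1 h2).mono inter_subset_left)
  have b : 0 ≤ ∫ x, (Ioo (-l) l)ᶜ.indicator f x ^ 2 := integral_nonneg fun x => sq_nonneg _
  have hs := P.s_pos
  have hω := P.ω_pos
  have c : 0 ≤ s * (s + 1) * ω := by positivity
  nlinarith [mul_nonneg c b, mul_nonneg hω.le b]

lemma full_gap {f : ℝ → ℝ} (hf : IsTest U f)
    (h0 : ∫ x, f x * (Ioo (-l) l).indicator (fun x => Φ x ^ s) x = 0)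
    (h0' : ∫ x, f x * (Ioo (-l) l).indicator (deriv Φ) x = 0) :
    min (ω / 4) (ω * s / 2) * ∫ x, f x ^ 2 ≤ ∫ x, fullOp s ω κ l Φ f x * f x := by
  rw [P.integral_fullOp_mul h1 h2 hf, integral_sq_split h1 h2 hf]
  have a := P.gap ((hf.indicator_Ioo h1 h2).mono inter_subset_left)
    (by rw [← h0]; congr 1; funext x; simp only [indicator]; split_ifs <;> ring)
    (by rw [← h0']; congr 1; funext x; simp only [indicator]; split_ifs <;> ring)
  have b : 0 ≤ ∫ x, (Ioo (-l) l)ᶜ.indicator f x ^ 2 := integral_nonneg fun x => sq_nonneg _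
  have hω := P.ω_pos
  -- Outside the interval the operator is multiplication by `ω`, which already exceeds the gap.
  have c : min (ω / 4) (ω * s / 2) ≤ ω := (min_le_left _ _).trans (by linarith)
  nlinarith [mul_le_mul_of_nonneg_right c b]

lemma integral_fullOp_mul_rpow {f : ℝ → ℝ} (hf : IsTest U f) :
    ∫ x, fullOp s ω κ l Φ f x * (Ioo (-l) l).indicator (fun x => Φ x ^ s) x =
      -(s * (s + 1) * ω) * ∫ x, f x * (Ioo (-l) l).indicator (fun x => Φ x ^ s) x := by
  have hi := (hf.indicator_Ioo h1 h2).mono inter_subset_left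
  have e1 : ∀ x, fullOp s ω κ l Φ f x * (Ioo (-l) l).indicator (fun x => Φ x ^ s) x =
      Φ x ^ s * innerOp s κ Φ ((Ioo (-l) l).indicator f) x := fun x => by
    by_cases hx : x ∈ Ioo (-l) l
    · simp [fullOp, hx, mul_comm]
    · simp [hx, (P.isTest_innerOp hi).eq_zero hx]
  have e2 : ∀ x, f x * (Ioo (-l) l).indicator (fun x => Φ x ^ s) x =
      Φ x ^ s * (Ioo (-l) l).indicator f x := fun x => by
    by_cases hx : x ∈ Ioo (-l) l
    · simp [hx, mul_comm]
    · simp [hx]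
  simp only [e1, e2]
  exact P.integral_rpow_mul_innerOp hi

lemma integral_fullOp_mul_deriv {f : ℝ → ℝ} (hf : IsTest U f) :
    ∫ x, fullOp s ω κ l Φ f x * (Ioo (-l) l).indicator (deriv Φ) x = 0 := by
  have hi := (hf.indicator_Ioo h1 h2).mono inter_subset_left
  rw [← P.integral_deriv_mul_innerOp hi]
  congr 1
  funext x
  by_cases hx : x ∈ Ioo (-l) l
  · simp [fullOp, hx, mul_comm]
  · simp [hx, (P.isTest_innerOp hi).eq_zero hx]

/-- The operator `fullOp` has dense range after a shift below its lower bound. -/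
lemma full_ae_eq_zero_of_orthogonal (hU : IsOpen U) (hIU : Ioo (-l) l ⊆ U) {u : ℝ → ℂ}
    (hu : MemLp u 2 volume)
    (h : ∀ f, IsTest U f →
      ∫ x, (fullOp s ω κ l Φ f x + (2 * s + 1) * (2 * s) * ω * f x) • u x = 0) :
    ∀ᵐ x, x ∈ U → u x = 0 := by
  have hs := P.s_pos
  have hω := P.ω_pos
  have hin := P.ae_eq_zero_of_orthogonal hu fun f hf => by
    rw [← h f (hf.mono hIU)]
    congr 1
    funext x
    have e1 : (Ioo (-l) l).indicator f = f := indicator_eq_self.2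
      (subset_closure.trans hf.subset)
    rw [fullOp, e1]
    by_cases hx : x ∈ Ioo (-l) l
    · simp [hx]
    · simp [hx, hf.eq_zero hx]
  -- Outside, the shifted operator is multiplication by a positive constant, so orthogonality kills
  -- `u` directly.
  have hout : ∀ᵐ x, x ∈ U ∩ (Icc (-l) l)ᶜ → u x = 0 := by
    refine (hU.inter isClosed_Icc.isOpen_compl).ae_eq_zero_of_integral_contDiff_smul_eq_zero
      ((hu.locallyIntegrable (by norm_num)).locallyIntegrableOn _) fun f f1 f2 f3 => ?_
    have hf : IsTest (U ∩ (Icc (-l) l)ᶜ) f := ⟨f1, f2, f3⟩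
    have := h f (hf.mono inter_subset_left)
    have e : ∀ x, (fullOp s ω κ l Φ f x + (2 * s + 1) * (2 * s) * ω * f x) • u x
        = (ω + (2 * s + 1) * (2 * s) * ω) • (f x • u x) := by
      intro x
      have e1 : (Ioo (-l) l).indicator f = fun _ => 0 := by
        funext y
        by_cases hy : y ∈ Ioo (-l) l
        · rw [indicator_of_mem hy]
          exact hf.eq_zero fun hy' => hy'.2 (Ioo_subset_Icc_self hy)
        · exact indicator_of_notMem hy f
      have e2 : (Ioo (-l) l)ᶜ.indicator f x = f x := by
        rw [indicator_compl, e1]; simp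
      have e3 : innerOp s κ Φ (fun _ => 0) x = 0 := by simp [innerOp]
      rw [fullOp, e1, e2, e3, smul_smul]
      congr 1
      ring
    simp only [e] at this
    rw [integral_smul] at this
    exact (smul_eq_zero.1 this).resolve_left (by positivity)
  filter_upwards [hin, hout] with x hx1 hx2 hx
  by_cases hI : x ∈ Ioo (-l) l
  · exact hx1 hI
  · exact hx2 ⟨hx, fun h => hI ⟨h.1.lt_of_ne fun h' => h1 (h' ▸ hx),
      h.2.lt_of_ne fun h' => h2 (h' ▸ hx)⟩⟩

end Profile

end Compacton

/-! ### The core in the complex Hilbert space and its spectral data -/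

namespace Compacton

open scoped InnerProductSpace

/-- The complex function with given real and imaginary parts. -/
noncomputable def toComplex (f g : ℝ → ℝ) (x : ℝ) : ℂ := (f x : ℂ) + Complex.I * (g x : ℂ)

section

variable {Ω U : Set ℝ}

lemma memLp_toComplex {f g : ℝ → ℝ} {μ : Measure ℝ} (hf : MemLp f 2 μ) (hg : MemLp g 2 μ) :
    MemLp (toComplex f g) 2 μ := by
  have h1 : MemLp (fun x => (f x : ℂ)) 2 μ := Complex.ofRealCLM.comp_memLp' hf
  have h2 : MemLp (fun x => (g x : ℂ)) 2 μ := Complex.ofRealCLM.comp_memLp' hg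
  have h3 : MemLp (fun x => Complex.I * (g x : ℂ)) 2 μ := h2.const_mul Complex.I
  exact h1.add h3

lemma IsTest.memLp {f : ℝ → ℝ} (hf : IsTest U f) {μ : Measure ℝ} [IsFiniteMeasureOnCompacts μ] :
    MemLp f 2 μ :=
  hf.continuous.memLp_of_hasCompactSupport hf.compact

/-- Reduces complex inner products to real integrals over the line, where the interval estimates
live; only the first factor needs support in `Ω`. -/
lemma inner_of_ae_eq (hU : U ⊆ Ω) {a b : L2 Ω} {f₁ g₁ f₂ g₂ : ℝ → ℝ} (hf₁ : IsTest U f₁)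
    (hg₁ : IsTest U g₁) (hf₂ : MemLp f₂ 2 (volume.restrict Ω))
    (hg₂ : MemLp g₂ 2 (volume.restrict Ω))
    (ha : (a : ℝ → ℂ) =ᵐ[volume.restrict Ω] toComplex f₁ g₁)
    (hb : (b : ℝ → ℂ) =ᵐ[volume.restrict Ω] toComplex f₂ g₂) :
    ⟪a, b⟫_ℂ = (((∫ x, f₁ x * f₂ x) + ∫ x, g₁ x * g₂ x : ℝ) : ℂ)
      + Complex.I * (((∫ x, f₁ x * g₂ x) - ∫ x, g₁ x * f₂ x : ℝ) : ℂ) := by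
  have hset : ∀ {f : ℝ → ℝ}, IsTest U f → ∀ g : ℝ → ℝ,
      ∫ x in Ω, f x * g x = ∫ x, f x * g x := fun hf g =>
    setIntegral_eq_integral_of_forall_compl_eq_zero fun x hx => by
      rw [hf.eq_zero fun h => hx (hU h), zero_mul]
  have i11 : Integrable (fun x => f₁ x * f₂ x) (volume.restrict Ω) := hf₁.memLp.integrable_mul hf₂
  have i22 : Integrable (fun x => g₁ x * g₂ x) (volume.restrict Ω) := hg₁.memLp.integrable_mul hg₂
  have i12 : Integrable (fun x => f₁ x * g₂ x) (volume.restrict Ω) := hf₁.memLp.integrable_mul hg₂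
  have i21 : Integrable (fun x => g₁ x * f₂ x) (volume.restrict Ω) := hg₁.memLp.integrable_mul hf₂
  rw [L2.inner_def]
  have e : ∫ x, ⟪a x, b x⟫_ℂ ∂(volume.restrict Ω) = ∫ x in Ω,
      (((f₁ x * f₂ x + g₁ x * g₂ x : ℝ) : ℂ)
        + Complex.I * ((f₁ x * g₂ x - g₁ x * f₂ x : ℝ) : ℂ)) := by
    refine integral_congr_ae ?_
    filter_upwards [ha, hb] with x hx hy
    rw [hx, hy, RCLike.inner_apply, toComplex, toComplex]
    simp only [map_add, map_mul, Complex.conj_ofReal, Complex.conj_I]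
    push_cast
    linear_combination (-(g₁ x : ℂ) * g₂ x) * Complex.I_sq
  rw [e, integral_add (i11.add i22).ofReal ((i12.sub i21).ofReal.const_mul _), integral_const_mul,
    integral_complex_ofReal, integral_complex_ofReal, integral_add i11 i22, integral_sub i12 i21,
    hset hf₁, hset hg₁, hset hf₁, hset hg₁]

end

section

variable {s ω κ l : ℝ} {Φ : ℝ → ℝ} {Ω U : Set ℝ}

/-- The graph of the operator on test functions vanishing near the end points. -/
noncomputable def core (s ω κ l : ℝ) (Φ : ℝ → ℝ) (Ω U : Set ℝ) (h1 : -l ∉ U) (h2 : l ∉ U) :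
    Submodule ℂ (L2 Ω × L2 Ω) where
  carrier := {w | ∃ f g, IsTest U f ∧ IsTest U g ∧
    (w.1 : ℝ → ℂ) =ᵐ[volume.restrict Ω] toComplex f g ∧
    (w.2 : ℝ → ℂ) =ᵐ[volume.restrict Ω] toComplex (fullOp s ω κ l Φ f) (fullOp s ω κ l Φ g)}
  zero_mem' := by
    refine ⟨fun _ => 0, fun _ => 0, .zero, .zero, ?_, ?_⟩
    · filter_upwards [Lp.coeFn_zero ℂ 2 (volume.restrict Ω)] with x hx
      simpa [toComplex] using hx
    · filter_upwards [Lp.coeFn_zero ℂ 2 (volume.restrict Ω)] with x hx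
      have e : innerOp s κ Φ (fun _ => 0) x = 0 := by simp [innerOp]
      have e' : ∀ S : Set ℝ, S.indicator (fun _ => (0 : ℝ)) = fun _ => 0 := fun S =>
        indicator_zero ℝ S
      simpa [toComplex, fullOp, e', e] using hx
  add_mem' := by
    rintro v w ⟨f, g, hf, hg, h3, h4⟩ ⟨f', g', hf', hg', h3', h4'⟩
    refine ⟨_, _, hf.add hf', hg.add hg', ?_, ?_⟩
    · filter_upwards [Lp.coeFn_add v.1 w.1, h3, h3'] with x hx h h'
      simp only [Prod.fst_add, hx, Pi.add_apply, h, h', toComplex]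
      push_cast; ring
    · filter_upwards [Lp.coeFn_add v.2 w.2, h4, h4'] with x hx h h'
      simp only [Prod.snd_add, hx, Pi.add_apply, h, h', toComplex, fullOp_add h1 h2 hf hf',
        fullOp_add h1 h2 hg hg']
      push_cast; ring
  smul_mem' := by
    rintro c w ⟨f, g, hf, hg, h3, h4⟩
    refine ⟨_, _, (hf.const_mul c.re).add (hg.const_mul (-c.im)),
      (hg.const_mul c.re).add (hf.const_mul c.im), ?_, ?_⟩
    · filter_upwards [Lp.coeFn_smul c w.1, h3] with x hx h
      simp only [Prod.smul_fst, hx, Pi.smul_apply, h, toComplex, smul_eq_mul]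
      conv_lhs => rw [← Complex.re_add_im c]
      push_cast
      linear_combination (c.im * g x : ℂ) * Complex.I_sq
    · filter_upwards [Lp.coeFn_smul c w.2, h4] with x hx h
      simp only [Prod.smul_snd, hx, Pi.smul_apply, h, toComplex, smul_eq_mul]
      rw [fullOp_add h1 h2 (hf.const_mul _) (hg.const_mul _),
        fullOp_add h1 h2 (hg.const_mul _) (hf.const_mul _), fullOp_const_mul h1 h2 hf,
        fullOp_const_mul h1 h2 hf, fullOp_const_mul h1 h2 hg, fullOp_const_mul h1 h2 hg]
      conv_lhs => rw [← Complex.re_add_im c]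
      push_cast
      linear_combination (c.im * fullOp s ω κ l Φ g x : ℂ) * Complex.I_sq

namespace Profile

variable (P : Profile s ω κ l Φ)
include P

lemma exists_mem_core (h1 : -l ∉ U) (h2 : l ∉ U) (hIU : Ioo (-l) l ⊆ U) {f : ℝ → ℝ}
    (hf : IsTest U f) : ∃ w ∈ core s ω κ l Φ Ω U h1 h2,
      (w.1 : ℝ → ℂ) =ᵐ[volume.restrict Ω] toComplex f (fun _ => 0) ∧
      (w.2 : ℝ → ℂ) =ᵐ[volume.restrict Ω] toComplex (fullOp s ω κ l Φ f) (fun _ => 0) := by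
  have h0 : IsTest U (fun _ => (0 : ℝ)) := .zero
  have e : fullOp s ω κ l Φ (fun _ => 0) = fun _ => 0 := by
    funext x
    simpa using fullOp_const_mul h1 h2 (s := s) (ω := ω) (κ := κ) (Φ := Φ) hf 0 x
  have m1 : MemLp (toComplex f fun _ => 0) 2 (volume.restrict Ω) :=
    memLp_toComplex hf.memLp h0.memLp
  have m2 : MemLp (toComplex (fullOp s ω κ l Φ f) fun _ => 0) 2 (volume.restrict Ω) :=
    memLp_toComplex (P.isTest_fullOp h1 h2 hIU hf).memLp h0.memLp
  exact ⟨(m1.toLp, m2.toLp), ⟨f, _, hf, h0, m1.coeFn_toLp, by rw [e]; exact m2.coeFn_toLp⟩,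
    m1.coeFn_toLp, m2.coeFn_toLp⟩

lemma memLp_indicator_rpow {μ : Measure ℝ} [IsFiniteMeasureOnCompacts μ] :
    MemLp ((Ioo (-l) l).indicator fun x => Φ x ^ s) 2 μ := by
  have hs := P.s_pos
  have e : ((Ioo (-l) l).indicator fun x => Φ x ^ s) = fun x => Φ x ^ s := by
    refine indicator_eq_self.2 fun x hx => ?_
    by_contra h
    exact hx (by simp only [P.zero x h, Real.zero_rpow hs.ne'])
  rw [e]
  refine (P.cont.rpow_const fun x => Or.inr hs.le).memLp_of_hasCompactSupport ?_
  refine HasCompactSupport.of_support_subset_isCompact (isCompact_Icc (a := -l) (b := l)) ?_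
  intro x hx
  by_contra h
  exact hx (by simp only [P.zero x fun h' => h (Ioo_subset_Icc_self h'), Real.zero_rpow hs.ne'])

lemma memLp_indicator_deriv : MemLp ((Ioo (-l) l).indicator (deriv Φ)) 2 volume := by
  rw [memLp_indicator_iff_restrict measurableSet_Ioo]
  refine MemLp.of_bound (measurable_deriv Φ).aestronglyMeasurable (Real.sqrt ω) ?_
  filter_upwards [ae_restrict_mem measurableSet_Ioo] with x hx
  rw [Real.norm_eq_abs]
  refine Real.abs_le_sqrt ?_
  rw [P.deriv_sq x hx]
  have := mul_nonneg P.κ_pos.le (Real.rpow_nonneg (P.pos x hx).le (2 * s))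
  linarith

/-- Outside the closed interval `Φ` is locally zero, and the two end points, where `Φ` need not be
differentiable, form a null set. -/
lemma indicator_deriv_ae_eq : (Ioo (-l) l).indicator (deriv Φ) =ᵐ[volume] deriv Φ := by
  have hne : ∀ a : ℝ, ∀ᵐ x : ℝ, x ≠ a := fun a => by
    simp [ae_iff, measure_singleton]
  filter_upwards [hne (-l), hne l] with x h1 h2
  by_cases hx : x ∈ Ioo (-l) l
  · rw [indicator_of_mem hx]
  · have hx' : x ∈ (Icc (-l) l)ᶜ := fun h => hx ⟨h.1.lt_of_ne' h1, h.2.lt_of_ne h2⟩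
    have : Φ =ᶠ[nhds x] fun _ => 0 := by
      filter_upwards [isClosed_Icc.isOpen_compl.mem_nhds hx'] with y hy
      exact P.zero y fun h => hy (Ioo_subset_Icc_self h)
    rw [indicator_of_notMem hx, this.deriv_eq]
    simp

/-- The spectral picture for an operator extending the core. -/
theorem spectrum (hΩ : IsOpen Ω) (hI : Ioo (-l) l ⊆ Ω) {A : L2 Ω →ₗ.[ℂ] L2 Ω}
    (hA : IsSelfAdjoint A) (hU : U = Ω \ {-l, l}) (h1 : -l ∉ U) (h2 : l ∉ U)
    (hCA : core s ω κ l Φ Ω U h1 h2 ≤ A.graph) :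
    ∃ u : L2 Ω, (u : ℝ → ℂ) =ᵐ[volume.restrict Ω] (fun x => ((deriv Φ x : ℝ) : ℂ)) ∧ u ≠ 0 ∧
      (∀ μ : ℝ, μ < 0 → (IsEigenvalue A (μ : ℂ) ↔ μ = -(s * (s + 1) * ω))) ∧
      Module.finrank ℂ (eigenspace A ((-(s * (s + 1) * ω) : ℝ) : ℂ)) = 1 ∧
      eigenspace A 0 = Submodule.span ℂ {u} ∧
      spec A \ {((-(s * (s + 1) * ω) : ℝ) : ℂ), 0} ⊆
        (fun r : ℝ => (r : ℂ)) '' Ici (min (ω / 4) (ω * s / 2)) := by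
  have hs := P.s_pos
  have hω := P.ω_pos
  have hl := P.l_pos
  have hUΩ : U ⊆ Ω := hU ▸ sdiff_subset
  have hUo : IsOpen U := by
    rw [hU]; exact hΩ.sdiff (Set.toFinite _).isClosed
  have hIU : Ioo (-l) l ⊆ U := by
    rw [hU]
    intro x hx
    refine ⟨hI hx, ?_⟩
    rintro (h | h)
    · exact hx.1.ne' h
    · exact hx.2.ne h
  have z2 : MemLp (fun _ : ℝ => (0 : ℝ)) 2 (volume.restrict Ω) := MemLp.zero'
  have E0 : MemLp ((Ioo (-l) l).indicator fun x => Φ x ^ s) 2 (volume.restrict Ω) :=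
    P.memLp_indicator_rpow
  have E1 : MemLp ((Ioo (-l) l).indicator (deriv Φ)) 2 (volume.restrict Ω) :=
    P.memLp_indicator_deriv.restrict Ω
  have m0 := memLp_toComplex E0 z2
  have m1 := memLp_toComplex E1 z2
  set e₀ : L2 Ω := m0.toLp with he₀
  set e₁ : L2 Ω := m1.toLp with he₁
  have a0 : (e₀ : ℝ → ℂ) =ᵐ[volume.restrict Ω] _ := m0.coeFn_toLp
  have a1 : (e₁ : ℝ → ℂ) =ᵐ[volume.restrict Ω] _ := m1.coeFn_toLp
  -- The eigenfunctions `Φ ^ s` and `Φ'` are even and odd; cutting both off by an even bump puts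
  -- them in the core and keeps the cross pairings zero.
  obtain ⟨ρ, hρ, hρ0, hρe, hρpos⟩ := P.exists_even_bump
  have hdodd := deriv_neg_of_even P.even
  have k0 : IsTest (Ioo (-l) l) fun x => Φ x ^ s * ρ x := hρ.mul_left isOpen_Ioo (P.smooth_rpow s)
  have k1 : IsTest (Ioo (-l) l) fun x => deriv Φ x * ρ x := hρ.mul_left isOpen_Ioo P.smooth_deriv
  obtain ⟨χ₀, hχ₀, c0, -⟩ := P.exists_mem_core (Ω := Ω) h1 h2 hIU (k0.mono hIU)
  obtain ⟨χ₁, hχ₁, c1, -⟩ := P.exists_mem_core (Ω := Ω) h1 h2 hIU (k1.mono hIU)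
  have hindo : ∀ {k f : ℝ → ℝ}, IsTest (Ioo (-l) l) k → ∀ x,
      k x * (Ioo (-l) l).indicator f x = k x * f x := fun hk x => by
    by_cases hx : x ∈ Ioo (-l) l
    · rw [indicator_of_mem hx]
    · rw [hk.eq_zero hx, zero_mul, zero_mul]
  -- pairings of the cut-off functions
  have p00 : 0 < ∫ x, Φ x ^ s * ρ x * Φ x ^ s := by
    have t := k0.mul_left isOpen_Ioo (P.smooth_rpow s)
    have : 0 < ∫ x, Φ x ^ s * (Φ x ^ s * ρ x) := by
      refine t.continuous.integral_pos_of_hasCompactSupport_nonneg_nonzero t.compact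
        (fun x => ?_) (x := 0) ?_
      · simp only [Pi.zero_apply]
        rw [← mul_assoc]
        exact mul_nonneg (mul_self_nonneg _) (hρ0 x)
      · have := P.pos 0 ⟨by linarith, hl⟩
        have := hρpos 0 ⟨by linarith, by linarith⟩
        positivity
    simpa only [mul_comm] using this
  have p11 : 0 < ∫ x, deriv Φ x * ρ x * deriv Φ x := by
    have t := k1.mul_left isOpen_Ioo P.smooth_deriv
    obtain ⟨y, hy, hy'⟩ : ∃ y ∈ Ioo (-(l / 2)) (l / 2), deriv Φ y ≠ 0 := by
      by_contra! h
      have h0 : (0 : ℝ) ∈ Ioo (-(l / 2)) (l / 2) := ⟨by linarith, by linarith⟩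
      have : deriv Φ =ᶠ[nhds 0] fun _ => 0 := by
        filter_upwards [isOpen_Ioo.mem_nhds h0] with z hz using h z hz
      -- If `Φ'` vanished near the origin, so would `Φ''`, contradicting `Φ Φ'' = -κ s Φ ^ (2s) <
      -- 0`.
      have h3 := P.deriv_deriv 0 ⟨by linarith, hl⟩
      rw [this.deriv_eq] at h3
      have h4 := Real.rpow_pos_of_pos (P.pos 0 ⟨by linarith, hl⟩) (2 * s)
      have h5 := mul_pos (mul_pos P.κ_pos hs) h4
      simp only [deriv_const, mul_zero] at h3
      linarith
    have : 0 < ∫ x, deriv Φ x * (deriv Φ x * ρ x) := by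
      refine t.continuous.integral_pos_of_hasCompactSupport_nonneg_nonzero t.compact
        (fun x => ?_) (x := y) ?_
      · simp only [Pi.zero_apply]
        rw [← mul_assoc]
        exact mul_nonneg (mul_self_nonneg _) (hρ0 x)
      · have := (hρpos y hy).ne'
        positivity
    simpa only [mul_comm] using this
  have p01 : ∫ x, Φ x ^ s * ρ x * deriv Φ x = 0 :=
    integral_eq_zero_of_odd fun x => by rw [hdodd, P.even, hρe]; ring
  have p10 : ∫ x, deriv Φ x * ρ x * Φ x ^ s = 0 :=
    integral_eq_zero_of_odd fun x => by rw [hdodd, P.even, hρe]; ring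
  have q00 : ⟪χ₀.1, e₀⟫_ℂ = ((∫ x, Φ x ^ s * ρ x * Φ x ^ s : ℝ) : ℂ) := by
    rw [inner_of_ae_eq hUΩ (k0.mono hIU) .zero E0 z2 c0 a0]
    simp only [hindo k0]
    simp
  have q01 : ⟪χ₀.1, e₁⟫_ℂ = 0 := by
    rw [inner_of_ae_eq hUΩ (k0.mono hIU) .zero E1 z2 c0 a1]
    simp only [hindo k0, p01]
    simp
  have q10 : ⟪χ₁.1, e₀⟫_ℂ = 0 := by
    rw [inner_of_ae_eq hUΩ (k1.mono hIU) .zero E0 z2 c1 a0]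
    simp only [hindo k1, p10]
    simp
  have q11 : ⟪χ₁.1, e₁⟫_ℂ = ((∫ x, deriv Φ x * ρ x * deriv Φ x : ℝ) : ℂ) := by
    rw [inner_of_ae_eq hUΩ (k1.mono hIU) .zero E1 z2 c1 a1]
    simp only [hindo k1]
    simp
  have n00 : ⟪e₀, χ₀.1⟫_ℂ ≠ 0 := by
    rw [← inner_conj_symm, q00, Complex.conj_ofReal]
    exact_mod_cast p00.ne'
  have n11 : ⟪e₁, χ₁.1⟫_ℂ ≠ 0 := by
    rw [← inner_conj_symm, q11, Complex.conj_ofReal]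
    exact_mod_cast p11.ne'
  have n10 : ⟪e₁, χ₀.1⟫_ℂ = 0 := by rw [← inner_conj_symm, q01, map_zero]
  have n01 : ⟪e₀, χ₁.1⟫_ℂ = 0 := by rw [← inner_conj_symm, q10, map_zero]
  have hne0 : e₀ ≠ 0 := fun h => n00 (by rw [h, inner_zero_left])
  have hne1 : e₁ ≠ 0 := fun h => n11 (by rw [h, inner_zero_left])
  -- norms and forms on the core
  have hform : ∀ {w : L2 Ω × L2 Ω} {f g : ℝ → ℝ}, IsTest U f → IsTest U g →
      (w.1 : ℝ → ℂ) =ᵐ[volume.restrict Ω] toComplex f g →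
      (w.2 : ℝ → ℂ) =ᵐ[volume.restrict Ω] toComplex (fullOp s ω κ l Φ f) (fullOp s ω κ l Φ g) →
      ‖w.1‖ ^ 2 = (∫ x, f x ^ 2) + ∫ x, g x ^ 2 ∧ RCLike.re ⟪w.2, w.1⟫_ℂ =
        (∫ x, fullOp s ω κ l Φ f x * f x) + ∫ x, fullOp s ω κ l Φ g x * g x := by
    intro w f g hf hg b1 b2
    have hF := P.isTest_fullOp h1 h2 hIU hf
    have hG := P.isTest_fullOp h1 h2 hIU hg
    constructor
    · rw [← inner_self_eq_norm_sq (𝕜 := ℂ), inner_of_ae_eq hUΩ hf hg hf.memLp hg.memLp b1 b1]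
      simp [sq]
    · rw [inner_of_ae_eq hUΩ hF hG hf.memLp hg.memLp b2 b1]
      simp
  have hzero : ∀ {a b c d : ℝ}, (((a + b : ℝ) : ℂ) + Complex.I * ((c - d : ℝ) : ℂ)) = 0 →
      a + b = 0 ∧ c - d = 0 := by
    intro a b c d h
    have h3 := congrArg Complex.re h
    have h4 := congrArg Complex.im h
    simp at h3 h4
    exact ⟨h3, h4⟩
  -- The shift comes from the second factorization; it lies below the bottom `-s (s + 1) ω` because
  -- `2s (2s + 1) > s (s + 1)`.
  have main := spectrum_of_core hA hCA (l := -((2 * s + 1) * (2 * s) * ω))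
    (m := -(s * (s + 1) * ω)) (δ := min (ω / 4) (ω * s / 2)) (e₀ := e₀) (e₁ := e₁)
    (by have := mul_pos hs hω; nlinarith [mul_pos hs this])
    (by have : 0 < s * (s + 1) * ω := by positivity
        linarith) P.delta_pos ?_ ?_ hne0 hne1 ?_ ?_ ?_ hχ₀ hχ₁ n00 n10 n01 n11
  · refine ⟨e₁, ?_, hne1, main⟩
    filter_upwards [a1, ae_restrict_of_ae P.indicator_deriv_ae_eq] with x hx hx'
    rw [hx, toComplex, hx']
    simp
  · rintro w ⟨f, g, hf, hg, b1, b2⟩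
    obtain ⟨n, r⟩ := hform hf hg b1 b2
    rw [n, r, mul_add]
    exact add_le_add (P.full_lower_bound h1 h2 hf) (P.full_lower_bound h1 h2 hg)
  · intro u hu
    have hmem : MemLp (Ω.indicator (u : ℝ → ℂ)) 2 volume :=
      (memLp_indicator_iff_restrict hΩ.measurableSet).2 (Lp.memLp u)
    have hae := P.full_ae_eq_zero_of_orthogonal h1 h2 hUo hIU hmem fun f hf => by
      obtain ⟨w, hw, b1, b2⟩ := P.exists_mem_core (Ω := Ω) h1 h2 hIU hf
      have := hu w hw
      rw [L2.inner_def] at this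
      have e : ∫ x, (fullOp s ω κ l Φ f x + (2 * s + 1) * (2 * s) * ω * f x) •
          Ω.indicator (u : ℝ → ℂ) x = ∫ x in Ω,
          (fullOp s ω κ l Φ f x + (2 * s + 1) * (2 * s) * ω * f x) • u x := by
        rw [← integral_indicator hΩ.measurableSet]
        congr 1
        funext x
        by_cases hx : x ∈ Ω <;> simp [hx]
      rw [e, ← this]
      refine integral_congr_ae ?_
      filter_upwards [Lp.coeFn_sub w.2 (((-((2 * s + 1) * (2 * s) * ω) : ℝ) : ℂ) • w.1),
        Lp.coeFn_smul ((-((2 * s + 1) * (2 * s) * ω) : ℝ) : ℂ) w.1, b1, b2] with x d1 d2 d3 d4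
      rw [d1, Pi.sub_apply, d2, Pi.smul_apply, d3, d4, RCLike.inner_apply]
      simp only [toComplex, Complex.real_smul, smul_eq_mul, map_sub, map_add, map_mul,
        Complex.conj_ofReal]
      push_cast
      simp
      ring
    rw [Lp.eq_zero_iff_ae_eq_zero]
    have hne : ∀ a : ℝ, ∀ᵐ x : ℝ, x ≠ a := fun a => by
      simp [ae_iff, measure_singleton]
    filter_upwards [ae_restrict_mem hΩ.measurableSet, ae_restrict_of_ae hae,
      ae_restrict_of_ae (hne (-l)), ae_restrict_of_ae (hne l)] with x d1 d2 d3 d4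
    have hxU : x ∈ U := by
      rw [hU]
      refine ⟨d1, ?_⟩
      rintro (h | h)
      · exact d3 h
      · exact d4 h
    simpa [d1] using d2 hxU
  · rintro w ⟨f, g, hf, hg, b1, b2⟩
    rw [inner_smul_right, inner_of_ae_eq hUΩ hf hg E0 z2 b1 a0,
      inner_of_ae_eq hUΩ (P.isTest_fullOp h1 h2 hIU hf) (P.isTest_fullOp h1 h2 hIU hg) E0 z2 b2 a0,
      P.integral_fullOp_mul_rpow h1 h2 hf, P.integral_fullOp_mul_rpow h1 h2 hg]
    simp only [mul_zero, integral_zero]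
    push_cast
    ring
  · rintro w ⟨f, g, hf, hg, b1, b2⟩
    rw [inner_of_ae_eq hUΩ (P.isTest_fullOp h1 h2 hIU hf) (P.isTest_fullOp h1 h2 hIU hg) E1 z2
      b2 a1, P.integral_fullOp_mul_deriv h1 h2 hf, P.integral_fullOp_mul_deriv h1 h2 hg]
    simp
  · rintro w ⟨f, g, hf, hg, b1, b2⟩ o0 o1
    obtain ⟨n, r⟩ := hform hf hg b1 b2
    rw [← inner_conj_symm, inner_of_ae_eq hUΩ hf hg E0 z2 b1 a0, map_eq_zero] at o0
    rw [← inner_conj_symm, inner_of_ae_eq hUΩ hf hg E1 z2 b1 a1, map_eq_zero] at o1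
    obtain ⟨v1, v2⟩ := hzero o0
    obtain ⟨v3, v4⟩ := hzero o1
    simp only [mul_zero, integral_zero, add_zero, zero_sub, neg_eq_zero] at v1 v2 v3 v4
    rw [n, r, mul_add]
    exact add_le_add (P.full_gap h1 h2 hf v1 v3) (P.full_gap h1 h2 hg v2 v4)

end Profile

end

end Compacton

/-! ### Identification with the given differential expression -/

namespace Compacton

lemma hasDerivAt_toComplex {f g : ℝ → ℝ} {f' g' x : ℝ} (hf : HasDerivAt f f' x)
    (hg : HasDerivAt g g' x) :
    HasDerivAt (toComplex f g) ((f' : ℂ) + Complex.I * (g' : ℂ)) x :=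
  hf.ofReal_comp.fun_add (hg.ofReal_comp.const_mul Complex.I)

lemma toComplex_mul_left (a f g : ℝ → ℝ) :
    (fun y => (a y : ℂ) * toComplex f g y) =
      toComplex (fun y => a y * f y) (fun y => a y * g y) := by
  funext y
  simp only [toComplex]
  push_cast
  ring

section

variable {U Ω : Set ℝ} {f g : ℝ → ℝ}

lemma contDiff_toComplex (hf : IsTest U f) (hg : IsTest U g) : ContDiff ℝ ∞ (toComplex f g) :=
  (Complex.ofRealCLM.contDiff.comp hf.smooth).add
    (contDiff_const.mul (Complex.ofRealCLM.contDiff.comp hg.smooth))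

lemma support_toComplex_subset :
    Function.support (toComplex f g) ⊆ tsupport f ∪ tsupport g := by
  intro x hx
  by_contra h
  rw [mem_union, not_or] at h
  apply hx
  simp [toComplex, image_eq_zero_of_notMem_tsupport h.1, image_eq_zero_of_notMem_tsupport h.2]

lemma hasCompactSupport_toComplex (hf : IsTest U f) (hg : IsTest U g) :
    HasCompactSupport (toComplex f g) :=
  HasCompactSupport.of_support_subset_isCompact (IsCompact.union hf.compact hg.compact)
    support_toComplex_subset

lemma tsupport_toComplex_subset (hf : IsTest U f) (hg : IsTest U g) :
    tsupport (toComplex f g) ⊆ U :=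
  (closure_minimal support_toComplex_subset
    ((isClosed_tsupport f).union (isClosed_tsupport g))).trans (union_subset hf.subset hg.subset)

variable {p ω l : ℝ} {Φ : ℝ → ℝ}
  (P : Profile ((p - 2) / 2) ω (2 * multiplier ω Φ / p) l Φ) (hp : 2 < p)
include P hp

/-- Expanding `Φ (Φ f)''` and eliminating `Φ'²` and `Φ Φ''` cancels the term `ω f`. What is left of
the potential is `κ s (2s + 1) Φ ^ (2s)`, since `c = κ (s + 1)` and `p - 1 = 2s + 1`. -/
lemma linPlus_of_mem (hf : IsTest U f) (hg : IsTest U g) {x : ℝ} (hx : x ∈ Ioo (-l) l) :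
    linPlus ω p Φ (toComplex f g) x =
      toComplex (fullOp ((p - 2) / 2) ω (2 * multiplier ω Φ / p) l Φ f)
        (fullOp ((p - 2) / 2) ω (2 * multiplier ω Φ / p) l Φ g) x := by
  have hp0 : p ≠ 0 := by linarith
  have hd1 : ∀ {k : ℝ → ℝ}, IsTest U k → ∀ y ∈ Ioo (-l) l,
      HasDerivAt (fun y => Φ y * k y) (deriv Φ y * k y + Φ y * deriv k y) y := fun hk y hy =>
    (P.hasDerivAt hy).fun_mul (hk.hasDerivAt y)
  have hd2 : ∀ {k : ℝ → ℝ}, IsTest U k → HasDerivAt (fun y => deriv Φ y * k y + Φ y * deriv k y)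
      (deriv (deriv Φ) x * k x + deriv Φ x * deriv k x +
        (deriv Φ x * deriv k x + Φ x * deriv (deriv k) x)) x := fun hk =>
    ((P.hasDerivAt_deriv hx).fun_mul (hk.hasDerivAt x)).fun_add
      ((P.hasDerivAt hx).fun_mul (hk.deriv.hasDerivAt x))
  have e1 : deriv (fun y => (Φ y : ℂ) * toComplex f g y) =ᶠ[nhds x]
      toComplex (fun y => deriv Φ y * f y + Φ y * deriv f y)
        (fun y => deriv Φ y * g y + Φ y * deriv g y) := by
    filter_upwards [isOpen_Ioo.mem_nhds hx] with y hy
    rw [toComplex_mul_left]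
    exact (hasDerivAt_toComplex (hd1 hf y hy) (hd1 hg y hy)).deriv
  have e2 : deriv (fun y => Φ y * deriv Φ y) x =
      deriv Φ x * deriv Φ x + Φ x * deriv (deriv Φ) x :=
    ((P.hasDerivAt hx).fun_mul (P.hasDerivAt_deriv hx)).deriv
  have e3 : ∀ k : ℝ → ℝ, fullOp ((p - 2) / 2) ω (2 * multiplier ω Φ / p) l Φ k x =
      innerOp ((p - 2) / 2) (2 * multiplier ω Φ / p) Φ k x := by
    intro k
    have : (Ioo (-l) l).indicator k =ᶠ[nhds x] k := by
      filter_upwards [isOpen_Ioo.mem_nhds hx] with y hy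
      exact indicator_of_mem hy k
    rw [fullOp, innerOp, innerOp, this.deriv_eq, this.deriv.deriv_eq, this.eq_of_nhds]
    simp [hx]
  have h1 := P.deriv_sq x hx
  have h2 := P.deriv_deriv x hx
  have e4 : ∀ k : ℝ → ℝ, innerOp ((p - 2) / 2) (2 * multiplier ω Φ / p) Φ k x =
      -Φ x * (deriv (deriv Φ) x * k x + deriv Φ x * deriv k x +
        (deriv Φ x * deriv k x + Φ x * deriv (deriv k) x)) + ω * k x
        - (deriv Φ x * deriv Φ x + Φ x * deriv (deriv Φ) x) * k x
        - ((p - 1) * multiplier ω Φ * Φ x ^ (p - 2)) * k x := by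
    intro k
    rw [show 2 * ((p - 2) / 2) = p - 2 by ring] at h1 h2
    rw [innerOp, show 2 * ((p - 2) / 2) = p - 2 by ring]
    have h3 : 2 * multiplier ω Φ / p * ((p - 2) / 2) * (p - 2 + 1) =
        -(2 * (2 * multiplier ω Φ / p * ((p - 2) / 2)) + 2 * multiplier ω Φ / p
          - (p - 1) * multiplier ω Φ) := by
      field_simp
      ring
    rw [h3]
    linear_combination 2 * k x * h2 + k x * h1
  rw [linPlus, e1.deriv_eq, (hasDerivAt_toComplex (hd2 hf) (hd2 hg)).deriv, e2, toComplex,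
    toComplex, e3, e3, e4, e4]
  push_cast
  ring

lemma linPlus_of_notMem {x : ℝ} (hx : x ∈ (Icc (-l) l)ᶜ) :
    linPlus ω p Φ (toComplex f g) x =
      toComplex (fullOp ((p - 2) / 2) ω (2 * multiplier ω Φ / p) l Φ f)
        (fullOp ((p - 2) / 2) ω (2 * multiplier ω Φ / p) l Φ g) x := by
  have hx' : x ∉ Ioo (-l) l := fun h => hx (Ioo_subset_Icc_self h)
  have hΦ : Φ =ᶠ[nhds x] fun _ => 0 := by
    filter_upwards [isClosed_Icc.isOpen_compl.mem_nhds hx] with y hy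
    exact P.zero y fun h => hy (Ioo_subset_Icc_self h)
  have e1 : (fun y => Φ y * deriv Φ y) =ᶠ[nhds x] fun _ => 0 := by
    filter_upwards [hΦ] with y hy
    rw [hy, zero_mul]
  have h0 : Φ x = 0 := hΦ.eq_of_nhds
  have e2 : ∀ k : ℝ → ℝ, fullOp ((p - 2) / 2) ω (2 * multiplier ω Φ / p) l Φ k x = ω * k x := by
    intro k
    rw [fullOp, innerOp, indicator_of_notMem hx' k, h0]
    simp [hx']
  rw [linPlus, e1.deriv_eq, toComplex, toComplex, e2, e2, h0,
    Real.zero_rpow (by linarith : p - 2 ≠ 0)]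
  simp
  ring

lemma core_le_graph {A : L2 Ω →ₗ.[ℂ] L2 Ω} (hUΩ : U ⊆ Ω) (h1 : -l ∉ U) (h2 : l ∉ U)
    (hext : linPlusGraph ω p Φ Ω ⊆ (A.graph : Set (L2 Ω × L2 Ω))) :
    core ((p - 2) / 2) ω (2 * multiplier ω Φ / p) l Φ Ω U h1 h2 ≤ A.graph := by
  rintro w ⟨f, g, hf, hg, b1, b2⟩
  refine hext ⟨toComplex f g, contDiff_toComplex hf hg, hasCompactSupport_toComplex hf hg,
    (tsupport_toComplex_subset hf hg).trans hUΩ, b1, b2.trans ?_⟩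
  have hne : ∀ a : ℝ, ∀ᵐ x : ℝ, x ≠ a := fun a => by
    simp [ae_iff, measure_singleton]
  filter_upwards [ae_restrict_of_ae (hne (-l)), ae_restrict_of_ae (hne l)] with x d1 d2
  by_cases hx : x ∈ Ioo (-l) l
  · exact (linPlus_of_mem P hp hf hg hx).symm
  · exact (linPlus_of_notMem P hp fun h => hx ⟨h.1.lt_of_ne' d1, h.2.lt_of_ne d2⟩).symm

end

end Compacton

theorem proposition5 (p ω : ℝ) (hp : 2 < p) (hω : 0 < ω) (Φ : ℝ → ℝ)
    (hbell : Compacton.BellShaped Φ) (hmin : Compacton.IsConstrainedMinimizer ω p Φ)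
    (Ω : Set ℝ) (hΩ : Ω = Set.univ ∨ Ω = Function.support Φ)
    (A : Compacton.L2 Ω →ₗ.[ℂ] Compacton.L2 Ω) (hA : IsSelfAdjoint A)
    (hext : Compacton.linPlusGraph ω p Φ Ω ⊆ (A.graph : Set (Compacton.L2 Ω × Compacton.L2 Ω))) :
    ∃ ζ : ℝ, 0 < ζ ∧
      (∀ μ : ℝ, μ < 0 → (Compacton.IsEigenvalue A (μ : ℂ) ↔ μ = -ζ ^ 2)) ∧
      Module.finrank ℂ (Compacton.eigenspace A ((-ζ ^ 2 : ℝ) : ℂ)) = 1 ∧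
      (∃ u : Compacton.L2 Ω,
        (u : ℝ → ℂ) =ᵐ[(MeasureTheory.volume : MeasureTheory.Measure ℝ).restrict Ω]
          (fun x => ((deriv Φ x : ℝ) : ℂ)) ∧
        u ≠ 0 ∧ Compacton.eigenspace A 0 = Submodule.span ℂ {u}) ∧
      ∃ δ : ℝ, 0 < δ ∧
        Compacton.spec A \ {((-ζ ^ 2 : ℝ) : ℂ), 0} ⊆ (fun r : ℝ => (r : ℂ)) '' Set.Ici δ := by
  obtain ⟨l, P⟩ := Compacton.exists_profile hp hbell hmin hω
  have hopen : IsOpen Ω := by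
    rcases hΩ with h | h
    · rw [h]; exact isOpen_univ
    · rw [h]; exact isOpen_ne_fun P.cont continuous_const
  have hI : Ioo (-l) l ⊆ Ω := by
    rcases hΩ with h | h
    · rw [h]; exact subset_univ _
    · rw [h]; exact fun x hx => (P.pos x hx).ne'
  -- The end points are removed from `Ω` so that the core only sees regions where the coefficients
  -- are smooth.
  have h1 : -l ∉ Ω \ {-l, l} := fun h => h.2 (by simp)
  have h2 : l ∉ Ω \ {-l, l} := fun h => h.2 (by simp)
  obtain ⟨u, hu, hu0, heig, hdim, hker, hspec⟩ := P.spectrum hopen hI hA rfl h1 h2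
    (Compacton.core_le_graph P hp sdiff_subset h1 h2 hext)
  have hpos : 0 < (p - 2) / 2 * ((p - 2) / 2 + 1) * ω := by
    have := P.s_pos
    positivity
  have hsq : -Real.sqrt ((p - 2) / 2 * ((p - 2) / 2 + 1) * ω) ^ 2 =
      -((p - 2) / 2 * ((p - 2) / 2 + 1) * ω) := by rw [Real.sq_sqrt hpos.le]
  -- Here `ζ² = s (s + 1) ω = p (p - 2) ω / 4`.
  refine ⟨Real.sqrt ((p - 2) / 2 * ((p - 2) / 2 + 1) * ω), Real.sqrt_pos.2 hpos, ?_⟩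
  rw [hsq]
  exact ⟨heig, hdim, ⟨u, hu, hu0, hker⟩, _, P.delta_pos, hspec⟩
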